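/- For a prime $p$ let $\mathbb{Z}_p$ be the ring of $p$-adic integers; for $x,y\in\mathbb{Q}_p$ write $x\equiv y \pmod{p^r}$ when $x-y\in p^r\mathbb{Z}_p$. Let $(x)_n=x(x+1)\cdots(x+n-1)$, $(x)_0=1$. For odd $p$ let $\Gamma_p:\mathbb{Z}_p\to\mathbb{Z}_p^\times$ be Morita's $p$-adic gamma function, the continuous function $$\Gamma_p(s)=\lim_{k\to s,\ k\in\mathbb{N}}(-1)^k\prod_{0<j<k,\ p\nmid j}j .$$ Theorem. The following congruences hold for all primes $p$ satisfying the condition stated. (B.2) If $p>2$: $\displaystyle\sum_{n=0}^{(p-1)/2}(4n+1)(-1)^n\frac{(1/2)_n^3}{(1)_n^3}\equiv\frac{-p}{\Gamma_p(1/2)^2}\pmod{p^3}$. (C.2) If $p>2$: $\displaystyle\sum_{n=0}^{(p-1)/2}(4n+1)\frac{(1/2)_n^4}{(1)_n^4}\equiv p\pmod{p^3}$. (D.2) If $p\equiv1\pmod 6$: $\displaystyle\sum_{n=0}^{(p-1)/3}(6n+1)\frac{(1/3)_n^6}{(1)_n^6}\equiv-p\,\Gamma_p(1/3)^9\pmod{p^4}$.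 (E.2) If $p\equiv1\pmod 6$: $\displaystyle\sum_{n=0}^{(p-1)/3}(6n+1)(-1)^n\frac{(1/3)_n^3}{(1)_n^3}\equiv p\pmod{p^3}$. (F.2) If $p\equiv1\pmod 4$: $\displaystyle\sum_{n=0}^{(p-1)/4}(8n+1)(-1)^n\frac{(1/4)_n^3}{(1)_n^3}\equiv\frac{-p}{\Gamma_p(1/4)\Gamma_p(3/4)}\pmod{p^3}$. (G.2), extended to modulus $p^4$. If $p\equiv1\pmod 4$: $\displaystyle\sum_{n=0}^{(p-1)/4}(8n+1)\frac{(1/4)_n^4}{(1)_n^4}\equiv\frac{p\,\Gamma_p(1/2)\Gamma_p(1/4)}{\Gamma_p(3/4)}\pmod{p^4}$. (H.2) If $p\equiv1\pmod 4$: $\displaystyle\sum_{n=0}^{(p-1)/2}\frac{(1/2)_n^3}{(1)_n^3}\equiv-\Gamma_p(1/4)^4\pmod{p^2}$. If $p\equiv3\pmod 4$, the same sum is $\equiv0\pmod{p^2}$, and moreover it is $\equiv-\dfrac{p^2\,\Gamma_p(1/4)^4}{16}\pmod{p^3}$. -/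

import Mathlib

noncomputable section

/-- The rising factorial (Pochhammer symbol) `(x)_n = x (x + 1) ⋯ (x + n - 1)` in a field. -/
def pochhammer {K : Type*} [Field K] (x : K) (n : ℕ) : K :=
  (ascPochhammer K n).eval x

/-- Morita's `p`-adic gamma function at a natural number:
`(-1)^k` times the product of all `0 < j < k` that are prime to `p`. -/
def moritaGammaNat (p k : ℕ) : ℤ :=
  (-1) ^ k * ∏ j ∈ (Finset.Ioo 0 k).filter (fun j => Nat.Coprime j p), (j : ℤ)

/-- Morita's `p`-adic gamma function `ℤ_p → ℤ_p` (`p` odd): the limit of its values at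
natural numbers `k` as `k` tends to `s` in `ℤ_p`. -/
def moritaGamma (p : ℕ) [Fact p.Prime] (s : ℤ_[p]) : ℤ_[p] :=
  Filter.limUnder (Filter.comap (fun k : ℕ => (k : ℤ_[p])) (nhds s))
    (fun k : ℕ => ((moritaGammaNat p k : ℤ) : ℤ_[p]))

/-- The same function with its argument and value read in `ℚ_p`; it is only meaningful on
`p`-adic integers `x` (and is set to `0` elsewhere). -/
def padicGamma (p : ℕ) [Fact p.Prime] (x : ℚ_[p]) : ℚ_[p] :=
  if h : ‖x‖ ≤ 1 then ((moritaGamma p ⟨x, h⟩ : ℤ_[p]) : ℚ_[p]) else 0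

/-- `x ≡ y (mod p^r)` in `ℚ_p`, that is, `x - y ∈ p^r ℤ_p`. -/
def PadicCongr (p : ℕ) [Fact p.Prime] (r : ℕ) (x y : ℚ_[p]) : Prop :=
  ∃ z : ℤ_[p], x - y = (p : ℚ_[p]) ^ r * (z : ℚ_[p])

end

/-!
# Supercongruences of Ramanujan type

Write `a = 1 / m` and `p = m N + 1`, so that `a + N = p / m` is divisible by `p`. Apart from the
sums of cubes without prefactor, each sum is a very-well-poised hypergeometric series with all
parameters equal to `a`, cut off at `N`. Replace three of these parameters by `a + β`, `a + γ`,
`a + δ`, and the corresponding denominator parameters by `1 - β`, `1 - γ`, `1 - δ`, with `β`, `γ`,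
`δ` divisible by `p` and of sum zero. Modulo `p ^ 4` every summand then changes only through the
second and third elementary symmetric functions of `β`, `γ`, `δ` (`wellPoisedFactor_congr`).
Modulo `p` the summand is odd and its first-order variations are even under `n ↦ N - n`, so the
coefficients of these symmetric functions in the sum are themselves divisible by `p`
(`perturbedSum_congr`). Hence the perturbation by `-(a + N)`, `a + N`, `0` does not affect the sum
modulo `p ^ 3`, and a combination of two perturbations recovers it modulo `p ^ 4`
(`two_mul_sum_congr_perturbedSum`). With the parameter `a - (a + N) = -N` the series terminates,
and the classical formulas for the terminating very-well-poised `₄F₃(-1)`, `₅F₄(1)` and `₇F₆(1)`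
evaluate it as a product of rising factorials; they are proved by induction on `N` with
telescoping certificates.

The rising factorials are translated to Morita's gamma function by its functional equation and
reflection formula, which in turn rest on Wilson's theorem modulo `p ^ r`. The values of the gamma
function at `a + k p / m` are compared by `padicGamma_second_difference` and
`padicGamma_third_difference`: along `p ℤ_p` the second and third multiplicative differences of
the gamma function are `1` modulo `p ^ 2` and `p ^ 3`, because sums of inverses and of inverse
squares over full periods vanish modulo `p`.

For the sum of cubes without prefactor, `(1/2)_n ^ 2` is compared with
`(1/2 - p/2)_n (1/2 + p/2)_n = (-N)_n (N + 1)_n`, for which the sum is the square of the value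
of a Legendre polynomial at `0`. If `p ≡ 3 (mod 4)` this vanishes, and the second-order correction
is read off from a second summation formula with a free parameter, `sum_whipple_free`.
-/

/-! ### Rising factorials and hypergeometric summation formulas -/

section Pochhammer

variable {K : Type*} [Field K]

lemma pochhammer_zero (x : K) : pochhammer x 0 = 1 := by simp [pochhammer]

lemma pochhammer_succ (x : K) (n : ℕ) : pochhammer x (n + 1) = pochhammer x n * (x + n) := by
  simp [pochhammer, ascPochhammer_succ_eval]

lemma pochhammer_eq_prod (x : K) (n : ℕ) : pochhammer x n = ∏ j ∈ Finset.range n, (x + j) := by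
  induction n with
  | zero => simp [pochhammer_zero]
  | succ n ih => rw [pochhammer_succ, ih, Finset.prod_range_succ]

lemma pochhammer_ne_zero {x : K} (hx : ∀ j : ℕ, x + j ≠ 0) (n : ℕ) : pochhammer x n ≠ 0 := by
  rw [pochhammer_eq_prod]
  exact Finset.prod_ne_zero_iff.2 fun j _ => hx j

lemma mul_pochhammer_add_one (x : K) (n : ℕ) :
    x * pochhammer (x + 1) n = pochhammer x n * (x + n) := by
  induction n with
  | zero => simp [pochhammer_zero]
  | succ n ih =>
    rw [pochhammer_succ, pochhammer_succ, ← mul_assoc, ih]; push_cast; ring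

lemma pochhammer_one (n : ℕ) : pochhammer (1 : K) n = n.factorial := by
  simp [pochhammer, ascPochhammer_eval_one]

lemma pochhammer_neg_natCast (N : ℕ) {n : ℕ} (h : N < n) : pochhammer (-(N : K)) n = 0 := by
  rw [pochhammer_eq_prod]
  exact Finset.prod_eq_zero (Finset.mem_range.2 h) (by simp)

/-- Reversing the order of the factors of a rising factorial. -/
lemma pochhammer_reflect (x : K) (n : ℕ) :
    pochhammer x n = (-1) ^ n * pochhammer (1 - x - n) n := by
  have h : ((-1 : K)) ^ n = ∏ _j ∈ Finset.range n, (-1 : K) := by simp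
  rw [pochhammer_eq_prod, pochhammer_eq_prod, ← Finset.prod_range_reflect, h,
    ← Finset.prod_mul_distrib]
  refine Finset.prod_congr rfl fun j hj => ?_
  have := Finset.mem_range.1 hj
  rw [show n - 1 - j = n - (j + 1) by omega, Nat.cast_sub (by omega)]
  push_cast; ring

lemma pochhammer_add_one {x : K} (hx : x ≠ 0) (n : ℕ) :
    pochhammer (x + 1) n = pochhammer x n * (x + n) / x := by
  rw [← mul_pochhammer_add_one, mul_div_cancel_left₀ _ hx]

/-- `(-N)_k` in terms of `(-N-1)_k`. -/
lemma pochhammer_neg_natCast_eq [CharZero K] (N k : ℕ) :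
    pochhammer (-(N : K)) k = pochhammer (-((N + 1 : ℕ) : K)) k * (N + 1 - k) / (N + 1) := by
  have := mul_pochhammer_add_one (-((N + 1 : ℕ) : K)) k
  rw [show -((N + 1 : ℕ) : K) + 1 = -(N : K) by push_cast; ring] at this
  rw [eq_div_iff (Nat.cast_add_one_ne_zero N)]
  push_cast at this ⊢
  linear_combination -this

end Pochhammer

section Summation

variable {K : Type*} [Field K]

/-- A telescoping certificate `G` turns the linear recurrence `D S(N + 1) = C S(N)`, for sums over
`0 ≤ k ≤ N`, into a termwise identity: `t` and `s` are the summands of `S(N + 1)` and `S(N)`. In the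
applications `G` is the rational multiple of the summand that Zeilberger's algorithm produces. -/
lemma sum_eq_of_certificate {N : ℕ} {t s G : ℕ → K} {C D R : K} (hD : D ≠ 0)
    (hG0 : G 0 = 0) (hG : ∀ k < N + 1 + 1, D * t k - C * s k = G (k + 1) - G k)
    (hGN : G (N + 1 + 1) = 0) (hs : s (N + 1) = 0) (hR : ∑ k ∈ Finset.range (N + 1), s k = R) :
    ∑ k ∈ Finset.range (N + 1 + 1), t k = C * R / D := by
  have h : ∑ k ∈ Finset.range (N + 1 + 1), (D * t k - C * s k) = 0 := by
    rw [Finset.sum_congr rfl fun k hk => hG k (Finset.mem_range.1 hk), Finset.sum_range_sub, hG0,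
      hGN, sub_zero]
  rw [Finset.sum_sub_distrib, ← Finset.mul_sum, ← Finset.mul_sum, Finset.sum_range_succ s, hs,
    add_zero, hR] at h
  rw [eq_div_iff hD]
  linear_combination h

/-- The terminating very-well-poised `₄F₃(-1)` sum. -/
theorem sum_wellPoised_four_three [CharZero K] (a b : K) (ha : ∀ j : ℕ, 1 + a + j ≠ 0)
    (hb : ∀ j : ℕ, 1 + a - b + j ≠ 0) (N : ℕ) :
    ∑ k ∈ Finset.range (N + 1), (a + 2 * k) * (-1) ^ k *
      (pochhammer a k * pochhammer b k * pochhammer (-(N : K)) k /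
        (pochhammer 1 k * pochhammer (1 + a - b) k * pochhammer (1 + a + N) k)) =
      a * pochhammer (1 + a) N / pochhammer (1 + a - b) N := by
  induction N with
  | zero => simp [pochhammer_zero]
  | succ N ih =>
    have hM : ∀ j : ℕ, 1 + a + N + j ≠ 0 := fun j => by
      have := ha (N + j); push_cast at this; rwa [← add_assoc] at this
    have h1 : ∀ j : ℕ, (1 : K) + j ≠ 0 := fun j => by
      rw [add_comm]; exact Nat.cast_add_one_ne_zero j
    have q0 : 1 + a + (N : K) ≠ 0 := by simpa using hM 0
    have q2 := hb N
    have p2 := pochhammer_ne_zero hb N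
    refine (sum_eq_of_certificate (C := 1 + a + N) (D := 1 + a - b + N)
      (G := fun n => -(1 + a + N) * (-1) ^ n * (pochhammer a n * pochhammer b n *
          pochhammer (-((N + 1 : ℕ) : K)) n * n * (n + a - b) /
          ((N + 1) * (pochhammer 1 n * pochhammer (1 + a - b) n * pochhammer (1 + a + N) n))))
      q2 (by simp) (fun k _ => ?_) ?_ ?_ ih).trans ?_
    · have e1 : 1 + a + ((N + 1 : ℕ) : K) = 1 + a + N + 1 := by push_cast; ring
      rw [pochhammer_neg_natCast_eq N k, e1, pochhammer_add_one q0]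
      simp only [pochhammer_succ]
      have p2 := pochhammer_ne_zero hb k
      have q1 := hM k
      have q2 := hb k
      have q3 := h1 k
      generalize pochhammer (1 : K) k = P1 at *
      generalize pochhammer (1 + a - b) k = P2 at *
      generalize pochhammer (1 + a + (N : K)) k = P3 at *
      generalize pochhammer a k = A at *
      generalize pochhammer b k = B at *
      generalize pochhammer (-((N + 1 : ℕ) : K)) k = C at *
      push_cast
      field_simp
      ring
    · simp only [pochhammer_neg_natCast (N + 1) (Nat.lt_succ_self _)]; simp
    · simp only [pochhammer_neg_natCast N (Nat.lt_succ_self _)]; simp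
    · rw [pochhammer_succ, pochhammer_succ]
      field_simp

/-- The terminating very-well-poised `₅F₄(1)` sum. -/
theorem sum_wellPoised_five_four [CharZero K] (a b c : K) (ha : ∀ j : ℕ, 1 + a + j ≠ 0)
    (hb : ∀ j : ℕ, 1 + a - b + j ≠ 0) (hc : ∀ j : ℕ, 1 + a - c + j ≠ 0) (N : ℕ) :
    ∑ k ∈ Finset.range (N + 1), (a + 2 * k) *
      (pochhammer a k * pochhammer b k * pochhammer c k * pochhammer (-(N : K)) k /
        (pochhammer 1 k * pochhammer (1 + a - b) k * pochhammer (1 + a - c) k *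
          pochhammer (1 + a + N) k)) =
      a * (pochhammer (1 + a) N * pochhammer (1 + a - b - c) N) /
        (pochhammer (1 + a - b) N * pochhammer (1 + a - c) N) := by
  induction N with
  | zero => simp [pochhammer_zero]
  | succ N ih =>
    have hM : ∀ j : ℕ, 1 + a + N + j ≠ 0 := fun j => by
      have := ha (N + j); push_cast at this; rwa [← add_assoc] at this
    have h1 : ∀ j : ℕ, (1 : K) + j ≠ 0 := fun j => by
      rw [add_comm]; exact Nat.cast_add_one_ne_zero j
    have q0 : 1 + a + (N : K) ≠ 0 := by simpa using hM 0
    have q2 := hb N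
    have p2 := pochhammer_ne_zero hb N
    have q3 := hc N
    have p3 := pochhammer_ne_zero hc N
    refine (sum_eq_of_certificate (C := (1 + a + N) * (1 + a - b - c + N))
      (D := (1 + a - b + N) * (1 + a - c + N))
      (G := fun n => -(1 + a + N) * (pochhammer a n * pochhammer b n * pochhammer c n *
          pochhammer (-((N + 1 : ℕ) : K)) n * n * (n + a - b) * (n + a - c) /
          ((N + 1) * (pochhammer 1 n * pochhammer (1 + a - b) n * pochhammer (1 + a - c) n *
            pochhammer (1 + a + N) n))))
      (mul_ne_zero q2 q3) (by simp) (fun k _ => ?_) ?_ ?_ ih).trans ?_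
    · have e1 : 1 + a + ((N + 1 : ℕ) : K) = 1 + a + N + 1 := by push_cast; ring
      rw [pochhammer_neg_natCast_eq N k, e1, pochhammer_add_one q0]
      simp only [pochhammer_succ]
      have p2 := pochhammer_ne_zero hb k
      have p3 := pochhammer_ne_zero hM k
      have q1 := hM k
      have q2 := hb k
      have q3 := h1 k
      have q4 := hc k
      generalize pochhammer (1 : K) k = P1 at *
      generalize pochhammer (1 + a - b) k = P2 at *
      generalize pochhammer (1 + a + (N : K)) k = P3 at *
      generalize pochhammer (1 + a - c) k = P4 at *
      generalize pochhammer a k = A at *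
      generalize pochhammer b k = B at *
      generalize pochhammer c k = E at *
      generalize pochhammer (-((N + 1 : ℕ) : K)) k = C at *
      push_cast
      field_simp
      ring
    · simp only [pochhammer_neg_natCast (N + 1) (Nat.lt_succ_self _)]; simp
    · simp only [pochhammer_neg_natCast N (Nat.lt_succ_self _)]; simp
    · simp only [pochhammer_succ]
      field_simp

/-- The polynomial identity behind the certificate for Dougall's sum. -/
lemma dougall_certificate_poly {a b c d M k e ek fk n₁ nk r : K} (he : e = M + a - (b + c + d))
    (hek : ek = M + a - (b + c + d) + k) (hfk : fk = b + c + d - M + k) (hn : n₁ = M - a)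
    (hnk : nk = M - a - k) (hr : r = 2 * M - (b + c + d)) :
    -((M - b) * (M - c) * (M - d) * (a + 2 * k) * ek * n₁ * fk) -
      (M - b - c) * (M - b - d) * (M - c - d) * (a + 2 * k) * nk * e * (M + k) =
      r * (-((a + k) * (b + k) * (c + k) * (d + k) * ek * nk) -
          k * (k + a - b) * (k + a - c) * (k + a - d) * fk * (M + k)) := by
  subst he hek hfk hn hnk hr
  ring

/-- The polynomial identity `h`, divided by the product of the denominators of the summands and of
the certificate; `Φ` stands for the common quotient of rising factorials. -/
lemma dougall_certificate_frac {u₁ u₂ v₁ v₂ w r ek fk Mk e f M n₁ nk Φ : K} (he : e ≠ 0)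
    (hf : fk ≠ 0) (hM : Mk ≠ 0) (hn : n₁ ≠ 0)
    (h : -(u₁ * w * ek * n₁ * fk) - u₂ * w * nk * e * Mk =
      r * (-(v₁ * ek * nk) - v₂ * fk * Mk)) :
    (-u₁ * f) * (Φ * (w * ek * M / (e * Mk))) - (M * u₂) * (Φ * (w * nk * f / (n₁ * fk))) =
      Φ * (M * r * f / e * (-(v₁ * ek * nk) / (n₁ * fk * Mk))) -
        Φ * (M * r * f / e * (v₂ / n₁)) := by
  have e₁ : (-u₁ * f) * (Φ * (w * ek * M / (e * Mk))) - (M * u₂) * (Φ * (w * nk * f / (n₁ * fk))) =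
      Φ * f * M * (-(u₁ * w * ek * n₁ * fk) - u₂ * w * nk * e * Mk) / (e * Mk * n₁ * fk) := by
    field_simp
  rw [e₁, h]
  field_simp

/-- The certificate for Dougall's sum, with all rising factorials abstracted to variables. -/
lemma dougall_certificate_step {A B E F H C P₁ P₂ P₃ P₄ P₅ P₆ : K}
    {D₁ D₂ u₁ u₂ w r ek fk Mk e f M n₁ nk nk' k k' l ak bk ck dk x₂ x₄ x₅ y₂ y₄ y₅ z₂ z₄ z₅ : K}
    (he : e ≠ 0) (hfk : fk ≠ 0) (hMk : Mk ≠ 0) (hn : n₁ ≠ 0)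
    (hl : l ≠ 0) (hx₂ : x₂ ≠ 0) (hx₄ : x₄ ≠ 0) (hx₅ : x₅ ≠ 0)
    (hD₁ : D₁ = -u₁ * f) (hD₂ : D₂ = M * u₂) (hk : k' = l) (hz₂ : z₂ = x₂) (hz₄ : z₄ = x₄)
    (hz₅ : z₅ = x₅) (hnk : nk' = -nk)
    (h : -(u₁ * w * ek * n₁ * fk) - u₂ * w * nk * e * Mk =
      r * (-((ak * bk * ck * dk) * ek * nk) - (k * y₂ * y₄ * y₅) * fk * Mk)) :
    D₁ * (w * (A * B * E * F * (H * ek / e) * C /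
        (P₁ * P₂ * P₄ * P₅ * P₆ * (P₃ * Mk / M)))) -
      D₂ * (w * (A * B * E * F * H * (C * nk / n₁) /
        (P₁ * P₂ * P₄ * P₅ * (P₆ * fk / f) * P₃))) =
      M * r / e * f * (A * ak * (B * bk) * (E * ck) * (F * dk) * (H * ek) * (C * nk') *
          k' * z₂ * z₄ * z₅ /
        (n₁ * (P₁ * l * (P₂ * x₂) * (P₄ * x₄) * (P₅ * x₅) * (P₆ * fk) * (P₃ * Mk)))) -
      M * r / e * f * (A * B * E * F * H * C * k * y₂ * y₄ * y₅ /
        (n₁ * (P₁ * P₂ * P₄ * P₅ * P₆ * P₃))) := by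
  subst hD₁ hD₂ hk hz₂ hz₄ hz₅ hnk
  have e₁ : w * (A * B * E * F * (H * ek / e) * C / (P₁ * P₂ * P₄ * P₅ * P₆ * (P₃ * Mk / M))) =
      A * B * E * F * H * C / (P₁ * P₂ * P₄ * P₅ * P₆ * P₃) * (w * ek * M / (e * Mk)) := by
    simp only [div_eq_mul_inv, mul_inv, inv_inv]; ring
  have e₂ : w * (A * B * E * F * H * (C * nk / n₁) / (P₁ * P₂ * P₄ * P₅ * (P₆ * fk / f) * P₃)) =
      A * B * E * F * H * C / (P₁ * P₂ * P₄ * P₅ * P₆ * P₃) * (w * nk * f / (n₁ * fk)) := by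
    simp only [div_eq_mul_inv, mul_inv, inv_inv]; ring
  have e₃ : A * ak * (B * bk) * (E * ck) * (F * dk) * (H * ek) * (C * -nk) *
          k' * z₂ * z₄ * z₅ /
        (n₁ * (P₁ * k' * (P₂ * z₂) * (P₄ * z₄) * (P₅ * z₅) * (P₆ * fk) * (P₃ * Mk))) =
      A * B * E * F * H * C * (-(ak * bk * ck * dk * ek * nk)) /
        (P₁ * P₂ * P₄ * P₅ * P₆ * P₃ * (n₁ * fk * Mk)) := by
    rw [← mul_div_mul_right (A * B * E * F * H * C * (-(ak * bk * ck * dk * ek * nk))) _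
      (mul_ne_zero (mul_ne_zero (mul_ne_zero hl hx₂) hx₄) hx₅)]
    congr 1 <;> ring
  rw [e₁, e₂, e₃, dougall_certificate_frac he hfk hMk hn h]
  ring

/-- Dougall's terminating very-well-poised 2-balanced `₇F₆(1)` sum. -/
theorem sum_wellPoised_seven_six [CharZero K] (a b c d : K) (ha : ∀ j : ℕ, 1 + a + j ≠ 0)
    (hb : ∀ j : ℕ, 1 + a - b + j ≠ 0) (hc : ∀ j : ℕ, 1 + a - c + j ≠ 0)
    (hd : ∀ j : ℕ, 1 + a - d + j ≠ 0) (he : ∀ j : ℤ, b + c + d - a + j ≠ 0)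
    (he' : ∀ j : ℕ, 1 + 2 * a - b - c - d + j ≠ 0) (N : ℕ) :
    ∑ k ∈ Finset.range (N + 1), (a + 2 * k) *
      (pochhammer a k * pochhammer b k * pochhammer c k * pochhammer d k *
        pochhammer (1 + 2 * a - b - c - d + N) k * pochhammer (-(N : K)) k /
        (pochhammer 1 k * pochhammer (1 + a - b) k * pochhammer (1 + a - c) k *
          pochhammer (1 + a - d) k * pochhammer (b + c + d - a - N) k *
          pochhammer (1 + a + N) k)) =
      a * (pochhammer (1 + a) N * pochhammer (1 + a - b - c) N * pochhammer (1 + a - b - d) N *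
          pochhammer (1 + a - c - d) N) /
        (pochhammer (1 + a - b) N * pochhammer (1 + a - c) N * pochhammer (1 + a - d) N *
          pochhammer (1 + a - b - c - d) N) := by
  induction N with
  | zero => simp [pochhammer_zero]
  | succ N ih =>
    have hM : ∀ j : ℕ, 1 + a + N + j ≠ 0 := fun j => by
      have := ha (N + j); push_cast at this; rwa [← add_assoc] at this
    have h1 : ∀ j : ℕ, (1 : K) + j ≠ 0 := fun j => by
      rw [add_comm]; exact Nat.cast_add_one_ne_zero j
    have hs : ∀ j : ℕ, 1 + a - b - c - d + j ≠ 0 := fun j => by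
      have := he (-1 - j); push_cast at this
      contrapose! this; linear_combination -this
    have hE : ∀ j : ℕ, b + c + d - a - (N + 1 : ℕ) + j ≠ 0 := fun j => by
      have := he (-(N + 1) + j); push_cast at this ⊢
      contrapose! this; linear_combination this
    have hN : (N : K) + 1 ≠ 0 := Nat.cast_add_one_ne_zero N
    have q0 : 1 + a + (N : K) ≠ 0 := by simpa using hM 0
    have q00 : b + c + d - a - (N + 1 : ℕ) ≠ 0 := by simpa using hE 0
    have qe := he' N
    have q2 := hb N
    have q3 := hc N
    have q4 := hd N
    have q5 := hs N
    refine (sum_eq_of_certificate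
      (C := (1 + a + N) * (1 + a - b - c + N) * (1 + a - b - d + N) * (1 + a - c - d + N))
      (D := (1 + a - b + N) * (1 + a - c + N) * (1 + a - d + N) * (1 + a - b - c - d + N))
      (G := fun n => (1 + a + N) * (2 * (1 + a + N) - b - c - d) /
          (1 + 2 * a - b - c - d + N) * (b + c + d - a - (N + 1 : ℕ)) *
          (pochhammer a n * pochhammer b n * pochhammer c n * pochhammer d n *
          pochhammer (1 + 2 * a - b - c - d + N) n *
          pochhammer (-((N + 1 : ℕ) : K)) n * n * (n + a - b) * (n + a - c) * (n + a - d) /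
          ((N + 1) * (pochhammer 1 n * pochhammer (1 + a - b) n * pochhammer (1 + a - c) n *
            pochhammer (1 + a - d) n * pochhammer (b + c + d - a - (N + 1 : ℕ)) n *
            pochhammer (1 + a + N) n))))
      (mul_ne_zero (mul_ne_zero (mul_ne_zero q2 q3) q4) q5) (by simp) (fun k _ => ?_) ?_ ?_
        ih).trans ?_
    · have e1 : 1 + a + ((N + 1 : ℕ) : K) = 1 + a + N + 1 := by push_cast; ring
      have e2 : 1 + 2 * a - b - c - d + ((N + 1 : ℕ) : K) =
        1 + 2 * a - b - c - d + N + 1 := by push_cast; ring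
      have e3 : b + c + d - a - (N : K) = b + c + d - a - (N + 1 : ℕ) + 1 := by push_cast; ring
      rw [pochhammer_neg_natCast_eq N k, e1, pochhammer_add_one q0, e2, pochhammer_add_one qe,
        e3, pochhammer_add_one q00]
      simp only [pochhammer_succ]
      have q1 := hM k
      have q2 := hb k
      have q3 := h1 k
      have q4 := hc k
      have q5 := hd k
      have q6 := hE k
      refine dougall_certificate_step qe q6 q1 hN q3 q2 q4 q5
        (u₁ := (1 + a + N - b) * (1 + a + N - c) * (1 + a + N - d))
        (u₂ := (1 + a + N - b - c) * (1 + a + N - b - d) * (1 + a + N - c - d))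
        ?_ ?_ ?_ ?_ ?_ ?_ ?_ ?_
      · push_cast; ring
      · ring
      · push_cast; ring
      · push_cast; ring
      · push_cast; ring
      · push_cast; ring
      · push_cast; ring
      · apply dougall_certificate_poly <;> push_cast <;> ring
    · simp only [pochhammer_neg_natCast (N + 1) (Nat.lt_succ_self _)]; simp
    · simp only [pochhammer_neg_natCast N (Nat.lt_succ_self _)]; simp
    · simp only [pochhammer_succ]
      generalize pochhammer (1 + a - b) N = P2 at *
      generalize pochhammer (1 + a - c) N = P3 at *
      generalize pochhammer (1 + a - d) N = P4 at *
      generalize pochhammer (1 + a - b - c - d) N = P5 at *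
      rw [mul_div_assoc', div_div]
      congr 1 <;> ring

end Summation

section Whipple

variable {K : Type*} [Field K]

/-- A terminating Whipple `₃F₂(1)` sum whose numerator parameters `a`, `1 - a` are free. -/
theorem sum_whipple_free [CharZero K] (a : K) (N : ℕ) (hN : 0 < N) :
    ∑ k ∈ Finset.range (N + 1), pochhammer a k * pochhammer (1 - a) k * pochhammer (-(N : K)) k /
        (pochhammer 1 k ^ 2 * pochhammer (-(2 * N : K)) k) =
      ∏ i ∈ Finset.range N, (a + 2 * i + 1) * (2 * i + 2 - a) / ((2 * i + 1) * (2 * i + 2)) := by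
  induction N, Nat.succ_le_of_lt hN using Nat.le_induction with
  | base =>
    simp [Finset.sum_range_succ, pochhammer_succ, pochhammer_zero]
    field_simp
    ring
  | succ N hN1 ih =>
    have ih := ih (by omega)
    have h1 : ∀ j : ℕ, (1 : K) + j ≠ 0 := fun j => by
      rw [add_comm]; exact Nat.cast_add_one_ne_zero j
    have m1 : (2 * N + 1 : K) ≠ 0 := by exact_mod_cast Nat.cast_add_one_ne_zero (R := K) (2 * N)
    have m2 : (2 * N + 2 : K) ≠ 0 := by
      exact_mod_cast Nat.cast_add_one_ne_zero (R := K) (2 * N + 1)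
    have m1k : ∀ k ≤ N + 1, (2 * N + 1 - k : K) ≠ 0 := fun k hk => by
      have := (Nat.cast_ne_zero (R := K)).2 (show 2 * N + 1 - k ≠ 0 by omega)
      rw [Nat.cast_sub (by omega)] at this
      exact_mod_cast this
    have m2k : ∀ k ≤ N + 1, (2 * N + 2 - k : K) ≠ 0 := fun k hk => by
      have := (Nat.cast_ne_zero (R := K)).2 (show 2 * N + 2 - k ≠ 0 by omega)
      rw [Nat.cast_sub (by omega)] at this
      exact_mod_cast this
    have m0k : ∀ k ≤ N, (-(2 * N) + k : K) ≠ 0 := fun k hk => by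
      have := (Nat.cast_ne_zero (R := K)).2 (show 2 * N - k ≠ 0 by omega)
      rw [Nat.cast_sub (by omega)] at this
      push_cast at this
      contrapose! this
      linear_combination -this
    refine (sum_eq_of_certificate (C := (a + 2 * N + 1) * (2 * N + 2 - a))
      (D := (2 * N + 1) * (2 * N + 2))
      (G := fun n => pochhammer a n * pochhammer (1 - a) n * pochhammer (-((N + 1 : ℕ) : K)) n *
        n ^ 2 * (n - 1 - 2 * N) /
          ((N + 1) * (pochhammer 1 n ^ 2 * pochhammer (-(2 * N : K)) n)))
      (mul_ne_zero m1 m2) (by simp) (fun k hk => ?_) ?_ ?_ ih).trans ?_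
    · have e1 : pochhammer (-(2 * ((N + 1 : ℕ) : K))) k = pochhammer (-(2 * N) : K) k *
          ((2 * N + 1) * (2 * N + 2)) / ((2 * N + 1 - k) * (2 * N + 2 - k)) := by
        have h := pochhammer_neg_natCast_eq (K := K) (2 * N) k
        have h' := pochhammer_neg_natCast_eq (K := K) (2 * N + 1) k
        rw [h'] at h
        push_cast at h ⊢
        have a1 := m1k k (by omega)
        have a2 := m2k k (by omega)
        rw [show (2 * (N : K) + 1 + 1) = 2 * N + 2 by ring] at h
        rw [h, mul_add, mul_one]
        have a2' : 2 * ((N : K) + 1) - k ≠ 0 := by convert a2 using 1; ring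
        field_simp
      have e2 := pochhammer_neg_natCast_eq (K := K) N k
      rw [e1, e2]
      have q1 := h1 k
      have a1 := m1k k (by omega)
      have a2 := m2k k (by omega)
      rcases Nat.lt_or_ge N k with hk' | hk'
      -- At `k = N + 1` the next denominator may vanish (it does for `N = 1`), but so does the
      -- numerator.
      · obtain rfl : k = N + 1 := by omega
        simp only [pochhammer_neg_natCast (N + 1) (Nat.lt_succ_self _)]
        generalize pochhammer (1 : K) (N + 1) = P1 at *
        generalize pochhammer (-(2 * N) : K) (N + 1) = P2 at *
        push_cast at *
        field_simp
        ring
      · simp only [pochhammer_succ]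
        have a3 := m0k k hk'
        generalize pochhammer (1 : K) k = P1 at *
        generalize pochhammer (-(2 * N) : K) k = P2 at *
        generalize pochhammer a k = A at *
        generalize pochhammer (1 - a) k = B at *
        generalize pochhammer (-((N + 1 : ℕ) : K)) k = C at *
        push_cast
        field_simp
        ring
    · simp only [pochhammer_neg_natCast (N + 1) (Nat.lt_succ_self _)]; simp
    · simp only [pochhammer_neg_natCast N (Nat.lt_succ_self _)]; simp
    · rw [Finset.prod_range_succ]; ring

/-- The sum `₃F₂(1 / 2, -N, N + 1; 1, 1; 1)`, which is the square of the value at `0` of the `N`-th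
Legendre polynomial, under the step from `N` to `N + 2`. -/
theorem sum_whipple_step [CharZero K] (N : ℕ) :
    ∑ k ∈ Finset.range (N + 2 + 1), pochhammer (1 / 2 : K) k * pochhammer (-((N + 2 : ℕ) : K)) k *
        pochhammer ((N + 2 : ℕ) + 1 : K) k / (pochhammer 1 k : K) ^ 3 =
      (N + 1) ^ 2 / (N + 2) ^ 2 * ∑ k ∈ Finset.range (N + 1), pochhammer (1 / 2 : K) k *
        pochhammer (-(N : K)) k * pochhammer (N + 1 : K) k / (pochhammer 1 k : K) ^ 3 := by
  have h1 : ∀ j : ℕ, (1 : K) + j ≠ 0 := fun j => by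
    rw [add_comm]; exact Nat.cast_add_one_ne_zero j
  have n1 : (N : K) + 1 ≠ 0 := Nat.cast_add_one_ne_zero N
  have n2 : (N : K) + 2 ≠ 0 := by
    have := Nat.cast_add_one_ne_zero (R := K) (N + 1)
    push_cast at this; convert this using 1; ring
  have hd : (N + 2 : K) ^ 2 ≠ 0 := pow_ne_zero 2 n2
  have ih := Finset.sum_range_succ (fun k => pochhammer (1 / 2 : K) k *
        pochhammer (-(N : K)) k * pochhammer (N + 1 : K) k / (pochhammer 1 k : K) ^ 3) (N + 1)
  simp only [pochhammer_neg_natCast N (Nat.lt_succ_self _), mul_zero, zero_mul, zero_div,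
    add_zero] at ih
  refine (sum_eq_of_certificate (N := N + 1) (C := ((N : K) + 1) ^ 2) hd
      (G := fun n => -2 * (2 * N + 3) * (pochhammer (1 / 2 : K) n * pochhammer (N + 1 : K) n *
        pochhammer (-((N + 1 + 1 : ℕ) : K)) n * n ^ 3 /
        ((N + 1) * (N + 2) * pochhammer 1 n ^ 3)))
      (by simp) (fun k _ => ?_) ?_ ?_ ih).trans (by ring)
  · have e1 : pochhammer (((N + 2 : ℕ) : K) + 1) k =
        pochhammer ((N : K) + 1) k * (N + 1 + k) * (N + 2 + k) / ((N + 1) * (N + 2)) := by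
      have h := pochhammer_add_one n2 k
      have h' := pochhammer_add_one n1 k
      rw [show ((N + 2 : ℕ) : K) + 1 = N + 2 + 1 by push_cast; ring, h,
        show (N : K) + 2 = N + 1 + 1 by ring, h']
      field_simp
    have e2 := pochhammer_neg_natCast_eq (K := K) N k
    have e3 := pochhammer_neg_natCast_eq (K := K) (N + 1) k
    rw [e1, e2, e3]
    simp only [pochhammer_succ]
    have q1 := h1 k
    have n2' : (N : K) + 1 + 1 ≠ 0 := by convert n2 using 1; ring
    generalize pochhammer (1 : K) k = P1 at *
    generalize pochhammer (1 / 2 : K) k = A at *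
    generalize pochhammer ((N : K) + 1) k = B at *
    generalize pochhammer (-((N + 1 + 1 : ℕ) : K)) k = C at *
    push_cast
    rw [show (N : K) + 1 + 1 = N + 2 by ring] at *
    field_simp
    ring
  · simp only [pochhammer_neg_natCast (N + 1 + 1) (Nat.lt_succ_self _)]; simp
  · simp only [pochhammer_neg_natCast N (show N < N + 1 + 1 by omega)]; simp

end Whipple

/-! ### Congruences between `p`-adic numbers -/

section Congr

variable {p : ℕ} [Fact p.Prime]

lemma padicCongr_iff {r : ℕ} {x y : ℚ_[p]} :
    PadicCongr p r x y ↔ ‖x - y‖ ≤ (p : ℝ) ^ (-(r : ℤ)) := by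
  have hp : (p : ℚ_[p]) ≠ 0 := Nat.cast_ne_zero.2 (Fact.out : p.Prime).ne_zero
  have hp0 : (0 : ℝ) < p := Nat.cast_pos.2 (Fact.out : p.Prime).pos
  constructor
  · rintro ⟨z, hz⟩
    rw [hz, norm_mul, Padic.norm_p_pow]
    exact mul_le_of_le_one_right (zpow_nonneg hp0.le _) z.2
  · intro h
    refine ⟨⟨(x - y) / (p : ℚ_[p]) ^ r, ?_⟩, ?_⟩
    · rw [norm_div, Padic.norm_p_pow]
      exact (div_le_one (zpow_pos hp0 _)).2 h
    · simp only
      field_simp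

lemma exists_padicInt_coe {x : ℚ_[p]} (hx : ‖x‖ ≤ 1) : ∃ X : ℤ_[p], (X : ℚ_[p]) = x :=
  ⟨⟨x, hx⟩, rfl⟩

namespace PadicCongr

variable {r s : ℕ} {x y z x' y' c : ℚ_[p]}

lemma refl (x : ℚ_[p]) : PadicCongr p r x x := ⟨0, by simp⟩

lemma of_eq (h : x = y) : PadicCongr p r x y := h ▸ refl x

lemma symm (h : PadicCongr p r x y) : PadicCongr p r y x := by
  obtain ⟨z, hz⟩ := h
  exact ⟨-z, by push_cast; linear_combination -hz⟩

lemma trans (h : PadicCongr p r x y) (h' : PadicCongr p r y z) : PadicCongr p r x z := by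
  obtain ⟨u, hu⟩ := h
  obtain ⟨v, hv⟩ := h'
  exact ⟨u + v, by push_cast; linear_combination hu + hv⟩

lemma add (h : PadicCongr p r x y) (h' : PadicCongr p r x' y') :
    PadicCongr p r (x + x') (y + y') := by
  obtain ⟨u, hu⟩ := h
  obtain ⟨v, hv⟩ := h'
  exact ⟨u + v, by push_cast; linear_combination hu + hv⟩

lemma neg (h : PadicCongr p r x y) : PadicCongr p r (-x) (-y) := by
  obtain ⟨u, hu⟩ := h
  exact ⟨-u, by push_cast; linear_combination -hu⟩

lemma sub (h : PadicCongr p r x y) (h' : PadicCongr p r x' y') :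
    PadicCongr p r (x - x') (y - y') := by
  rw [sub_eq_add_neg, sub_eq_add_neg]
  exact h.add h'.neg

lemma sum {ι : Type*} {s : Finset ι} {f g : ι → ℚ_[p]} (h : ∀ i ∈ s, PadicCongr p r (f i) (g i)) :
    PadicCongr p r (∑ i ∈ s, f i) (∑ i ∈ s, g i) := by
  classical
  induction s using Finset.induction_on with
  | empty => simpa using refl _
  | insert a s ha ih =>
    rw [Finset.sum_insert ha, Finset.sum_insert ha]
    exact (h a (by simp)).add (ih fun i hi => h i (by simp [hi]))

lemma mul_left (hc : ‖c‖ ≤ 1) (h : PadicCongr p r x y) : PadicCongr p r (c * x) (c * y) := by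
  obtain ⟨u, hu⟩ := h
  obtain ⟨c, rfl⟩ := exists_padicInt_coe hc
  exact ⟨c * u, by push_cast; linear_combination c * hu⟩

lemma mul_right (hc : ‖c‖ ≤ 1) (h : PadicCongr p r x y) : PadicCongr p r (x * c) (y * c) := by
  rw [mul_comm x, mul_comm y]; exact h.mul_left hc

lemma mul (h : PadicCongr p r x y) (h' : PadicCongr p r x' y') (hx : ‖x‖ ≤ 1) (hy : ‖y'‖ ≤ 1) :
    PadicCongr p r (x * x') (y * y') :=
  (h'.mul_left hx).trans (h.mul_right hy)

lemma mono (h : PadicCongr p s x y) (hrs : r ≤ s) : PadicCongr p r x y := by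
  obtain ⟨u, hu⟩ := h
  refine ⟨(p : ℤ_[p]) ^ (s - r) * u, ?_⟩
  rw [hu]; push_cast
  rw [← mul_assoc, ← pow_add, Nat.add_sub_cancel' hrs]

/-- Multiplying the modulus: `x ≡ y (mod p ^ r)` and `c ≡ 0 (mod p ^ s)` give
`c x ≡ c y (mod p ^ (s + r))`. -/
lemma mul_of_zero (hc : PadicCongr p s c 0) (h : PadicCongr p r x y) :
    PadicCongr p (s + r) (c * x) (c * y) := by
  obtain ⟨u, hu⟩ := hc
  obtain ⟨v, hv⟩ := h
  refine ⟨u * v, ?_⟩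
  rw [sub_zero] at hu
  rw [← mul_sub, hv, hu]; push_cast; ring

lemma zero_mul (hc : PadicCongr p s c 0) (h : PadicCongr p r x 0) :
    PadicCongr p (s + r) (c * x) 0 := by
  simpa using hc.mul_of_zero h

lemma zero_pow (hc : PadicCongr p 1 c 0) (n : ℕ) : PadicCongr p n (c ^ n) 0 := by
  induction n with
  | zero =>
    obtain ⟨u, hu⟩ := hc
    exact ⟨1, by simp⟩
  | succ n ih => rw [pow_succ]; exact ih.zero_mul hc

lemma zero_mul_le (hc : PadicCongr p s c 0) (hx : ‖x‖ ≤ 1) : PadicCongr p s (c * x) 0 := by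
  simpa using hc.mul_right hx

lemma iff_sub : PadicCongr p r x y ↔ PadicCongr p r (x - y) 0 := by
  simp [PadicCongr]

lemma norm_le_of_zero (h : PadicCongr p r x 0) : ‖x‖ ≤ 1 := by
  obtain ⟨u, hu⟩ := h
  rw [sub_zero] at hu
  rw [hu, ← PadicInt.coe_natCast, ← PadicInt.coe_pow, ← PadicInt.coe_mul]
  exact PadicInt.norm_le_one _

lemma norm_le (h : PadicCongr p r x y) (hx : ‖x‖ ≤ 1) : ‖y‖ ≤ 1 := by
  have h' := (iff_sub.1 h.symm).norm_le_of_zero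
  have := Padic.nonarchimedean (y - x) x
  rw [sub_add_cancel] at this
  exact this.trans (max_le h' hx)

/-- Divisibility by `p`, read off the discrete norm. -/
lemma zero_iff_lt : PadicCongr p 1 x 0 ↔ ‖x‖ < 1 := by
  rw [padicCongr_iff, sub_zero]
  have := Padic.norm_le_pow_iff_norm_lt_pow_add_one x (-1)
  simpa using this

lemma norm_eq_one (h : PadicCongr p 1 x y) (hx : ‖x‖ = 1) : ‖y‖ = 1 := by
  have h' := zero_iff_lt.1 (iff_sub.1 h.symm)
  rw [← hx] at h' ⊢
  exact Padic.norm_eq_of_norm_sub_lt_right h'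

/-- Congruences may be divided by units. -/
lemma cancel_left (hc : ‖c‖ = 1) (h : PadicCongr p r (c * x) (c * y)) : PadicCongr p r x y := by
  have hc0 : c ≠ 0 := norm_ne_zero_iff.1 (by rw [hc]; exact one_ne_zero)
  have := h.mul_left (c := c⁻¹) (by rw [norm_inv, hc, inv_one])
  rwa [inv_mul_cancel_left₀ hc0, inv_mul_cancel_left₀ hc0] at this

lemma inv (h : PadicCongr p r x y) (hx : ‖x‖ = 1) (hy : ‖y‖ = 1) :
    PadicCongr p r x⁻¹ y⁻¹ := by
  have hx0 : x ≠ 0 := norm_ne_zero_iff.1 (by rw [hx]; exact one_ne_zero)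
  have hy0 : y ≠ 0 := norm_ne_zero_iff.1 (by rw [hy]; exact one_ne_zero)
  refine cancel_left (c := x * y) (by rw [norm_mul, hx, hy, one_mul]) ?_
  convert h.symm using 1 <;> field_simp

lemma div (h : PadicCongr p r x y) (h' : PadicCongr p r x' y') (hx : ‖x‖ ≤ 1) (hx' : ‖x'‖ = 1)
    (hy' : ‖y'‖ = 1) : PadicCongr p r (x / x') (y / y') := by
  rw [div_eq_mul_inv, div_eq_mul_inv]
  exact h.mul (h'.inv hx' hy') hx (by rw [norm_inv, hy', inv_one])

lemma pow (h : PadicCongr p r x y) (hx : ‖x‖ ≤ 1) (n : ℕ) : PadicCongr p r (x ^ n) (y ^ n) := by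
  induction n with
  | zero => simpa using refl _
  | succ n ih =>
    rw [pow_succ, pow_succ]
    exact ih.mul h (by rw [norm_pow]; exact pow_le_one₀ (norm_nonneg _) hx) (h.norm_le hx)

lemma eq_of_forall (h : ∀ r, PadicCongr p r x y) : x = y := by
  rw [← sub_eq_zero, ← norm_eq_zero]
  refine le_antisymm (le_of_forall_pos_le_add fun ε hε => ?_) (norm_nonneg _)
  obtain ⟨n, hn⟩ := PadicInt.exists_pow_neg_lt p hε
  rw [zero_add]
  exact (padicCongr_iff.1 (h n)).trans hn.le

lemma p_zero : PadicCongr p 1 (p : ℚ_[p]) 0 := ⟨1, by simp⟩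

end PadicCongr

/-! ### Norms of sums and products of `p`-adic integers -/

lemma norm_add_le_one {x y : ℚ_[p]} (hx : ‖x‖ ≤ 1) (hy : ‖y‖ ≤ 1) : ‖x + y‖ ≤ 1 :=
  (Padic.nonarchimedean x y).trans (max_le hx hy)

lemma norm_sub_le_one {x y : ℚ_[p]} (hx : ‖x‖ ≤ 1) (hy : ‖y‖ ≤ 1) : ‖x - y‖ ≤ 1 := by
  rw [sub_eq_add_neg]; exact norm_add_le_one hx (by rwa [norm_neg])

lemma norm_mul_le_one {x y : ℚ_[p]} (hx : ‖x‖ ≤ 1) (hy : ‖y‖ ≤ 1) : ‖x * y‖ ≤ 1 := by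
  rw [norm_mul]; exact mul_le_one₀ hx (norm_nonneg _) hy

lemma norm_pow_le_one {x : ℚ_[p]} (hx : ‖x‖ ≤ 1) (n : ℕ) : ‖x ^ n‖ ≤ 1 := by
  rw [norm_pow]; exact pow_le_one₀ (norm_nonneg _) hx

lemma norm_natCast_le_one (n : ℕ) : ‖(n : ℚ_[p])‖ ≤ 1 := by
  exact_mod_cast Padic.norm_int_le_one (p := p) n

lemma norm_sum_le_one {ι : Type*} {s : Finset ι} {f : ι → ℚ_[p]} (h : ∀ i ∈ s, ‖f i‖ ≤ 1) :
    ‖∑ i ∈ s, f i‖ ≤ 1 := by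
  classical
  induction s using Finset.induction_on with
  | empty => simp
  | insert a s ha ih =>
    rw [Finset.sum_insert ha]
    exact norm_add_le_one (h a (by simp)) (ih fun i hi => h i (by simp [hi]))

lemma norm_natCast_eq_one {n : ℕ} (h0 : 0 < n) (hn : n < p) : ‖(n : ℚ_[p])‖ = 1 :=
  Padic.norm_natCast_eq_one_iff.2
    (((Fact.out : p.Prime).coprime_iff_not_dvd).2 (Nat.not_dvd_of_pos_of_lt h0 hn))

lemma norm_pochhammer_eq_one {x : ℚ_[p]} {n : ℕ} (h : ∀ j < n, ‖x + j‖ = 1) :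
    ‖pochhammer x n‖ = 1 := by
  rw [pochhammer_eq_prod, norm_prod]
  exact Finset.prod_eq_one fun j hj => h j (Finset.mem_range.1 hj)

lemma ne_zero_of_norm_eq_one {x : ℚ_[p]} (h : ‖x‖ = 1) : x ≠ 0 :=
  norm_ne_zero_iff.1 (by rw [h]; exact one_ne_zero)

end Congr

/-! ### Perturbing three parameters of a well-poised sum -/

section Perturb

variable {p : ℕ} [Fact p.Prime]

lemma norm_natCast_div_add_eq_one {m i j : ℕ} (hm0 : 0 < m) (hmp : m < p) (h0 : 0 < i + m * j)
    (hp : i + m * j < p) : ‖(i : ℚ_[p]) / m + j‖ = 1 := by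
  have h1 := norm_natCast_eq_one hm0 hmp
  have hm := ne_zero_of_norm_eq_one h1
  have h2 := norm_natCast_eq_one h0 hp
  rw [show (i : ℚ_[p]) / m + j = ((i + m * j : ℕ) : ℚ_[p]) / m by push_cast; field_simp,
    norm_div, h1, h2, div_one]

lemma norm_one_sub_add_eq_one {β : ℚ_[p]} (hβ : PadicCongr p 1 β 0) {j : ℕ} (hj : j + 1 < p) :
    ‖1 - β + j‖ = 1 := by
  have h1 : ‖((j + 1 : ℕ) : ℚ_[p])‖ = 1 := norm_natCast_eq_one (Nat.succ_pos j) hj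
  refine PadicCongr.norm_eq_one (x := ((j + 1 : ℕ) : ℚ_[p])) ?_ h1
  rw [PadicCongr.iff_sub]
  convert hβ using 1
  push_cast; ring

lemma norm_add_eq_one {x β : ℚ_[p]} (hβ : PadicCongr p 1 β 0) (hx : ‖x‖ = 1) : ‖x + β‖ = 1 := by
  refine PadicCongr.norm_eq_one (x := x) ?_ hx
  rw [PadicCongr.iff_sub]
  convert hβ.neg using 1 <;> ring

/-- First-order expansion of a ratio of two cubics without linear terms, as they arise from
`∏_i (1 + β_i x)` and `∏_i (1 - β_i y)` with `∑_i β_i = 0`. -/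
lemma cubic_ratio_congr {x y e f : ℚ_[p]} (hx : ‖x‖ ≤ 1) (hy : ‖y‖ ≤ 1)
    (he : PadicCongr p 2 e 0) (hf : PadicCongr p 3 f 0) :
    PadicCongr p 4 ((1 + e * x ^ 2 + f * x ^ 3) / (1 + e * y ^ 2 - f * y ^ 3))
      (1 + e * (x ^ 2 - y ^ 2) + f * (x ^ 3 + y ^ 3)) := by
  have hY : ‖1 + e * y ^ 2 - f * y ^ 3‖ = 1 := by
    have := norm_add_eq_one (p := p) (x := 1) (β := e * y ^ 2 - f * y ^ 3) ?_ norm_one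
    · rwa [← add_sub_assoc] at this
    · have h1 := (he.mono (show 1 ≤ 2 by norm_num)).zero_mul_le (norm_pow_le_one hy 2)
      have h2 := (hf.mono (show 1 ≤ 3 by norm_num)).zero_mul_le (norm_pow_le_one hy 3)
      simpa using h1.sub h2
  have hY0 := ne_zero_of_norm_eq_one hY
  refine PadicCongr.cancel_left hY ?_
  rw [mul_div_cancel₀ _ hY0]
  obtain ⟨X, rfl⟩ := exists_padicInt_coe hx
  obtain ⟨Y, rfl⟩ : ∃ Y : ℤ_[p], (Y : ℚ_[p]) = y := ⟨⟨y, hy⟩, rfl⟩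
  obtain ⟨u, hu⟩ := he
  obtain ⟨v, hv⟩ := hf
  rw [sub_zero] at hu hv
  subst hu hv
  refine ⟨-((u * Y ^ 2 - p * v * Y ^ 3) * (u * (X ^ 2 - Y ^ 2) + p * v * (X ^ 3 + Y ^ 3))), ?_⟩
  push_cast
  ring

/-- The coefficient in `∏_i (a + β_i)_n / (1 - β_i)_n`, for `β_1 + β_2 + β_3 = 0`, of the
second elementary symmetric function of the `β_i`. -/
noncomputable def quadraticTerm (a : ℚ_[p]) (n : ℕ) : ℚ_[p] :=
  ∑ j ∈ Finset.range n, ((a + j)⁻¹ ^ 2 - (1 + j : ℚ_[p])⁻¹ ^ 2)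

/-- The coefficient in `∏_i (a + β_i)_n / (1 - β_i)_n`, for `β_1 + β_2 + β_3 = 0`, of the
third elementary symmetric function of the `β_i`. -/
noncomputable def cubicTerm (a : ℚ_[p]) (n : ℕ) : ℚ_[p] :=
  ∑ j ∈ Finset.range n, ((a + j)⁻¹ ^ 3 + (1 + j : ℚ_[p])⁻¹ ^ 3)

lemma norm_quadraticTerm_le {a : ℚ_[p]} {n : ℕ} (ha : ∀ j < n, ‖a + j‖ = 1) (hn : n < p) :
    ‖quadraticTerm a n‖ ≤ 1 := by
  refine norm_sum_le_one fun j hj => ?_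
  have hj := Finset.mem_range.1 hj
  have h1 : ‖(1 + j : ℚ_[p])‖ = 1 := by
    simpa using norm_one_sub_add_eq_one (p := p) (PadicCongr.refl 0) (j := j) (by omega)
  refine norm_sub_le_one (norm_pow_le_one ?_ 2) (norm_pow_le_one ?_ 2)
  · rw [norm_inv, ha j hj, inv_one]
  · rw [norm_inv, h1, inv_one]

lemma norm_cubicTerm_le {a : ℚ_[p]} {n : ℕ} (ha : ∀ j < n, ‖a + j‖ = 1) (hn : n < p) :
    ‖cubicTerm a n‖ ≤ 1 := by
  refine norm_sum_le_one fun j hj => ?_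
  have hj := Finset.mem_range.1 hj
  have h1 : ‖(1 + j : ℚ_[p])‖ = 1 := by
    simpa using norm_one_sub_add_eq_one (p := p) (PadicCongr.refl 0) (j := j) (by omega)
  refine norm_add_le_one (norm_pow_le_one ?_ 3) (norm_pow_le_one ?_ 3)
  · rw [norm_inv, ha j hj, inv_one]
  · rw [norm_inv, h1, inv_one]

/-- The product of three well-poised ratios `(a)_n / (1)_n` with parameters perturbed by `β`, `γ`,
`δ`. -/
noncomputable def wellPoisedFactor (a β γ δ : ℚ_[p]) (n : ℕ) : ℚ_[p] :=
  pochhammer (a + β) n * pochhammer (a + γ) n * pochhammer (a + δ) n /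
    (pochhammer (1 - β) n * pochhammer (1 - γ) n * pochhammer (1 - δ) n)

/-- If `β + γ + δ = 0`, the perturbation only enters through the second and third elementary
symmetric functions. -/
lemma wellPoisedFactor_congr {a β γ δ : ℚ_[p]} (hβ : PadicCongr p 1 β 0)
    (hγ : PadicCongr p 1 γ 0) (hδ : PadicCongr p 1 δ 0) (h0 : β + γ + δ = 0) (n : ℕ)
    (ha : ∀ j < n, ‖a + j‖ = 1) (hn : n < p) :
    PadicCongr p 4 (wellPoisedFactor a β γ δ n)
      ((pochhammer a n / pochhammer 1 n) ^ 3 *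
        (1 + (β * γ + β * δ + γ * δ) * quadraticTerm a n + β * γ * δ * cubicTerm a n)) := by
  have he : PadicCongr p 2 (β * γ + β * δ + γ * δ) 0 := by
    simpa using ((hβ.zero_mul hγ).add (hβ.zero_mul hδ)).add (hγ.zero_mul hδ)
  have hf : PadicCongr p 3 (β * γ * δ) 0 := (hβ.zero_mul hγ).zero_mul hδ
  induction n with
  | zero =>
    simp [wellPoisedFactor, pochhammer_zero, quadraticTerm, cubicTerm, PadicCongr.refl]
  | succ n ih =>
    have ih := ih (fun j hj => ha j (by omega)) (by omega)
    have hA := norm_quadraticTerm_le (a := a) (n := n) (fun j hj => ha j (by omega)) (by omega)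
    have hB := norm_cubicTerm_le (a := a) (n := n) (fun j hj => ha j (by omega)) (by omega)
    have hu := ha n (Nat.lt_succ_self n)
    have hv : ‖(1 + n : ℚ_[p])‖ = 1 := by
      simpa using norm_one_sub_add_eq_one (p := p) (PadicCongr.refl 0) (j := n) hn
    have u0 := ne_zero_of_norm_eq_one hu
    have v0 := ne_zero_of_norm_eq_one hv
    have huv : ‖(a + n) / (1 + n)‖ ≤ 1 := by rw [norm_div, hu, hv, div_one]
    have hr : ∀ n' ≤ n, ‖pochhammer a n' / pochhammer (1 : ℚ_[p]) n'‖ = 1 := fun n' hn' => by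
      rw [norm_div, norm_pochhammer_eq_one fun j hj => ha j (by omega),
        norm_pochhammer_eq_one fun j hj => ?_, div_one]
      simpa using norm_one_sub_add_eq_one (p := p) (PadicCongr.refl 0) (j := j) (by omega)
    have hx : ‖(a + n)⁻¹‖ ≤ 1 := by rw [norm_inv, hu, inv_one]
    have hy : ‖(1 + n : ℚ_[p])⁻¹‖ ≤ 1 := by rw [norm_inv, hv, inv_one]
    have hc := cubic_ratio_congr hx hy he hf
    set e := β * γ + β * δ + γ * δ with he'
    set f := β * γ * δ with hf'
    have e1 : wellPoisedFactor a β γ δ (n + 1) = wellPoisedFactor a β γ δ n *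
        (((a + n) / (1 + n)) ^ 3 * ((1 + e * (a + n)⁻¹ ^ 2 + f * (a + n)⁻¹ ^ 3) /
          (1 + e * (1 + n : ℚ_[p])⁻¹ ^ 2 - f * (1 + n : ℚ_[p])⁻¹ ^ 3))) := by
      have e2 : (a + β + n) * (a + γ + n) * (a + δ + n) =
          (a + n) ^ 3 * (1 + e * (a + n)⁻¹ ^ 2 + f * (a + n)⁻¹ ^ 3) := by
        have : δ = -β - γ := by linear_combination h0
        rw [he', hf', this]; field_simp; ring
      have e3 : (1 - β + n) * (1 - γ + n) * (1 - δ + n) =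
          (1 + n) ^ 3 * (1 + e * (1 + n : ℚ_[p])⁻¹ ^ 2 - f * (1 + n : ℚ_[p])⁻¹ ^ 3) := by
        have : δ = -β - γ := by linear_combination h0
        rw [he', hf', this]; field_simp; ring
      simp only [wellPoisedFactor, pochhammer_succ]
      rw [div_pow, div_mul_div_comm, div_mul_div_comm, ← e2, ← e3]
      congr 1 <;> ring
    have hD : quadraticTerm a (n + 1) = quadraticTerm a n +
        ((a + n)⁻¹ ^ 2 - (1 + n : ℚ_[p])⁻¹ ^ 2) := Finset.sum_range_succ _ _
    have hC : cubicTerm a (n + 1) = cubicTerm a n +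
        ((a + n)⁻¹ ^ 3 + (1 + n : ℚ_[p])⁻¹ ^ 3) := Finset.sum_range_succ _ _
    rw [e1, hD, hC, pochhammer_succ, pochhammer_succ]
    have hd : ‖(a + n)⁻¹ ^ 2 - (1 + n : ℚ_[p])⁻¹ ^ 2‖ ≤ 1 :=
      norm_sub_le_one (norm_pow_le_one hx 2) (norm_pow_le_one hy 2)
    have hc' : ‖(a + n)⁻¹ ^ 3 + (1 + n : ℚ_[p])⁻¹ ^ 3‖ ≤ 1 :=
      norm_add_le_one (norm_pow_le_one hx 3) (norm_pow_le_one hy 3)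
    have hr' := (hr n le_rfl).le
    have hprod := ih.symm.mul (hc.symm.mul_left (norm_pow_le_one huv 3)) ?_ ?_
    · refine hprod.symm.trans ?_
      generalize (a + n)⁻¹ ^ 2 - (1 + n : ℚ_[p])⁻¹ ^ 2 = d at *
      generalize (a + n)⁻¹ ^ 3 + (1 + n : ℚ_[p])⁻¹ ^ 3 = c at *
      generalize quadraticTerm a n = D at *
      generalize cubicTerm a n = C at *
      have key : PadicCongr p 4 ((1 + e * D + f * C) * (1 + e * d + f * c))
          (1 + e * (D + d) + f * (C + c)) := by
        obtain ⟨D, rfl⟩ := exists_padicInt_coe hA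
        obtain ⟨d, rfl⟩ := exists_padicInt_coe hd
        obtain ⟨C, rfl⟩ := exists_padicInt_coe hB
        obtain ⟨c, rfl⟩ := exists_padicInt_coe hc'
        obtain ⟨u, hu⟩ := he
        obtain ⟨v, hv⟩ := hf
        rw [sub_zero] at hu hv
        rw [hu, hv]
        refine ⟨(u * D + p * v * C) * (u * d + p * v * c), ?_⟩
        push_cast
        ring
      have := key.mul_left (c := (pochhammer a n / pochhammer 1 n) ^ 3 *
          ((a + (n : ℚ_[p])) / (1 + n : ℚ_[p])) ^ 3)
        (norm_mul_le_one (norm_pow_le_one hr' 3) (norm_pow_le_one huv 3))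
      convert this using 1
      · ring
      · rw [mul_div_mul_comm, mul_pow]
    · refine norm_mul_le_one (norm_pow_le_one hr' 3) (norm_add_le_one (norm_add_le_one (by simp)
        (norm_mul_le_one he.norm_le_of_zero hA)) (norm_mul_le_one hf.norm_le_of_zero hB))
    · refine norm_mul_le_one (norm_pow_le_one huv 3) (hc.symm.norm_le ?_)
      exact norm_add_le_one (norm_add_le_one (by simp)
        (norm_mul_le_one he.norm_le_of_zero hd)) (norm_mul_le_one hf.norm_le_of_zero hc')

end Perturb

/-! ### Antisymmetry of the summand modulo `p` -/

section Antisymmetry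

/-- A sum which is odd under reversing the range vanishes. -/
lemma sum_eq_zero_of_reflect {K : Type*} [Field K] [CharZero K] {N : ℕ} {f : ℕ → K}
    (hf : ∀ n ≤ N, f (N - n) = -f n) : ∑ n ∈ Finset.range (N + 1), f n = 0 := by
  have h := Finset.sum_flip (n := N) f
  rw [Finset.sum_congr rfl fun n hn => hf n (Nat.lt_succ_iff.1 (Finset.mem_range.1 hn)),
    Finset.sum_neg_distrib] at h
  linear_combination (-1 / 2 : K) * h

variable {p : ℕ} [Fact p.Prime]

/-- The generalized harmonic number `1 + 2⁻ⁱ + ⋯ + n⁻ⁱ`. -/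
noncomputable def harmonicPow (p : ℕ) [Fact p.Prime] (i n : ℕ) : ℚ_[p] :=
  ∑ j ∈ Finset.range n, (1 + j : ℚ_[p])⁻¹ ^ i

lemma sum_inv_sub_pow (N i : ℕ) {n : ℕ} (hn : n ≤ N) :
    ∑ j ∈ Finset.range n, ((N : ℚ_[p]) - j)⁻¹ ^ i =
      harmonicPow p i N - harmonicPow p i (N - n) := by
  induction n with
  | zero => simp
  | succ n ih =>
    rw [Finset.sum_range_succ, ih (by omega), show N - n = N - (n + 1) + 1 by omega, harmonicPow,
      harmonicPow, harmonicPow, Finset.sum_range_succ _ (N - (n + 1)), Nat.cast_sub hn]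
    push_cast
    rw [show (1 : ℚ_[p]) + (N - (n + 1)) = N - n by ring]
    ring

section

variable {a : ℚ_[p]} {N : ℕ}

lemma norm_natCast_sub_eq_one (hN : N < p) {j : ℕ} (hj : j < N) : ‖(N : ℚ_[p]) - j‖ = 1 := by
  rw [← Nat.cast_sub hj.le]
  exact norm_natCast_eq_one (by omega) (by omega)

lemma norm_one_add_natCast_eq_one {j : ℕ} (hj : j + 1 < p) : ‖(1 + j : ℚ_[p])‖ = 1 := by
  simpa using norm_one_sub_add_eq_one (p := p) (PadicCongr.refl 0) hj

lemma inv_add_congr (ha : PadicCongr p 1 (a + N) 0) (hN : N < p) {j : ℕ} (hj : j < N) :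
    PadicCongr p 1 (a + j)⁻¹ (-((N : ℚ_[p]) - j)⁻¹) := by
  have h1 := norm_natCast_sub_eq_one hN hj
  have h2 : PadicCongr p 1 (-((N : ℚ_[p]) - j)) (a + j) := by
    rw [PadicCongr.iff_sub]
    convert ha.neg using 1 <;> ring
  have h3 : ‖-((N : ℚ_[p]) - j)‖ = 1 := by rwa [norm_neg]
  have := h2.symm.inv (h2.norm_eq_one h3) h3
  rwa [inv_neg] at this

lemma quadraticTerm_congr (ha : PadicCongr p 1 (a + N) 0) (hN : N < p) {n : ℕ} (hn : n ≤ N) :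
    PadicCongr p 1 (quadraticTerm a n)
      (harmonicPow p 2 N - harmonicPow p 2 (N - n) - harmonicPow p 2 n) := by
  rw [← sum_inv_sub_pow N 2 hn, harmonicPow, ← Finset.sum_sub_distrib]
  refine PadicCongr.sum fun j hj => ?_
  have hj := Finset.mem_range.1 hj
  have h1 := norm_natCast_sub_eq_one hN (show j < N by omega)
  have h := inv_add_congr ha hN (show j < N by omega)
  have := h.symm.pow (by rw [norm_neg, norm_inv, h1, inv_one]) 2
  rw [neg_sq] at this
  exact this.symm.sub (PadicCongr.refl _)

lemma cubicTerm_congr (ha : PadicCongr p 1 (a + N) 0) (hN : N < p) {n : ℕ} (hn : n ≤ N) :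
    PadicCongr p 1 (cubicTerm a n)
      (-(harmonicPow p 3 N - harmonicPow p 3 (N - n)) + harmonicPow p 3 n) := by
  rw [← sum_inv_sub_pow N 3 hn, harmonicPow, ← Finset.sum_neg_distrib, ← Finset.sum_add_distrib]
  refine PadicCongr.sum fun j hj => ?_
  have hj := Finset.mem_range.1 hj
  have h1 := norm_natCast_sub_eq_one hN (show j < N by omega)
  have h := inv_add_congr ha hN (show j < N by omega)
  have := h.symm.pow (by rw [norm_neg, norm_inv, h1, inv_one]) 3
  rw [Odd.neg_pow (by decide)] at this
  exact this.symm.add (PadicCongr.refl _)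

/-- Modulo `p` the ratio `(a)_n / n!` is a binomial coefficient, since `a ≡ -N`. -/
lemma pochhammer_div_congr_choose (ha : PadicCongr p 1 (a + N) 0) (hN : N < p) {n : ℕ}
    (hn : n ≤ N) :
    PadicCongr p 1 (pochhammer a n / pochhammer 1 n) ((-1) ^ n * (N.choose n : ℚ_[p])) := by
  induction n with
  | zero => simp [pochhammer_zero, PadicCongr.refl]
  | succ n ih =>
    have hv := norm_one_add_natCast_eq_one (p := p) (j := n) (by omega)
    have hv0 := ne_zero_of_norm_eq_one hv
    have h1 : PadicCongr p 1 (-((N : ℚ_[p]) - n)) (a + n) := by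
      rw [PadicCongr.iff_sub]
      convert ha.neg using 1 <;> ring
    have h2 : ‖((-1) ^ n * (N.choose n : ℚ_[p]))‖ ≤ 1 :=
      norm_mul_le_one (by simp) (norm_natCast_le_one _)
    have h3 := (ih (by omega)).symm.mul (h1.mul_right (c := (1 + n : ℚ_[p])⁻¹)
      (by rw [norm_inv, hv, inv_one])) h2 ?_
    · rw [pochhammer_succ, pochhammer_succ, mul_div_mul_comm, div_eq_mul_inv (a + n)]
      convert h3.symm using 1
      have := Nat.choose_succ_right_eq N n
      have h4 : (N.choose (n + 1) : ℚ_[p]) * (n + 1) = N.choose n * (N - n) := by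
        rw [← Nat.cast_sub (by omega)]
        exact_mod_cast this
      rw [← div_eq_mul_inv, mul_div_assoc', eq_div_iff hv0, pow_succ]
      linear_combination (-(-1) ^ n) * h4
    · refine norm_mul_le_one (h1.norm_le ?_) (by rw [norm_inv, hv, inv_one])
      rw [norm_neg, norm_natCast_sub_eq_one hN (by omega)]

end

variable {m N : ℕ}

/-- Modulo `p` one has `2 m n + 1 ≡ m (2 n - N)` and `(a)_n / n! ≡ ± N.choose n`, so that the
hypergeometric summand is odd under `n ↦ N - n`; weighted by anything even, it sums to zero. -/
lemma sum_odd_summand_congr_zero {a s : ℚ_[p]} (hm : (m : ℚ_[p]) * a = 1)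
    (ha : PadicCongr p 1 (a + N) 0) (hN : N < p) {q : ℕ} (hs : s * (-1) ^ q = 1) {w v : ℕ → ℚ_[p]}
    (hw : ∀ n ≤ N, PadicCongr p 1 (w n) (v n)) (hv : ∀ n ≤ N, v (N - n) = v n)
    (hw1 : ∀ n ≤ N, ‖w n‖ ≤ 1) :
    PadicCongr p 1 (∑ n ∈ Finset.range (N + 1), (2 * m * n + 1) * s ^ n *
      (pochhammer a n / pochhammer 1 n) ^ q * w n) 0 := by
  have hs1 : ‖s‖ = 1 := by
    have := congrArg norm hs
    simpa using this
  have hM : ∀ n : ℕ, ‖(2 * m * n + 1 : ℚ_[p])‖ ≤ 1 := fun n => by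
    exact_mod_cast norm_natCast_le_one (p := p) (2 * m * n + 1)
  have hzero :
      ∑ n ∈ Finset.range (N + 1), m * ((2 * n - N : ℚ_[p]) * (N.choose n) ^ q * v n) = 0 := by
    rw [← Finset.mul_sum, sum_eq_zero_of_reflect, mul_zero]
    intro n hn
    rw [Nat.choose_symm hn, hv n hn, Nat.cast_sub hn]
    ring
  rw [← hzero]
  refine PadicCongr.sum fun n hn => ?_
  have hn := Nat.lt_succ_iff.1 (Finset.mem_range.1 hn)
  have h1 : PadicCongr p 1 (2 * m * n + 1 : ℚ_[p]) (m * (2 * n - N)) := by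
    have := ha.mul_left (norm_natCast_le_one (p := p) m)
    rw [PadicCongr.iff_sub]
    convert this using 1
    · linear_combination (-1 : ℚ_[p]) * hm
    · ring
  have h2 := (pochhammer_div_congr_choose ha hN hn).symm.pow
    (norm_mul_le_one (by simp) (norm_natCast_le_one _)) q
  have h3 : s ^ n * ((-1) ^ n * (N.choose n : ℚ_[p])) ^ q = (N.choose n : ℚ_[p]) ^ q := by
    rw [mul_pow, ← pow_mul, mul_comm n q, pow_mul, ← mul_assoc, ← mul_pow, hs, one_pow, one_mul]
  have hc : ‖(N.choose n : ℚ_[p]) ^ q‖ ≤ 1 := norm_pow_le_one (norm_natCast_le_one _) q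
  have h4 : PadicCongr p 1 (s ^ n * (pochhammer a n / pochhammer 1 n) ^ q)
      ((N.choose n : ℚ_[p]) ^ q) := by
    rw [← h3]
    exact h2.symm.mul_left (by rw [norm_pow, hs1, one_pow])
  have h5 := (h1.mul h4 (hM n) hc).mul (hw n hn) ?_ ((hw n hn).norm_le (hw1 n hn))
  · convert h5 using 1 <;> ring
  · exact norm_mul_le_one (hM n) (h4.symm.norm_le hc)

/-- The truncated sum of `(2 m n + 1) s ^ n ((a)_n / (1)_n) ^ (q + 3)`, in which three of the
factors `(a)_n / (1)_n` have their parameters perturbed by `β`, `γ`, `δ`. -/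
noncomputable def perturbedSum (m N q : ℕ) (a s β γ δ : ℚ_[p]) : ℚ_[p] :=
  ∑ n ∈ Finset.range (N + 1), (2 * m * n + 1) * s ^ n *
    ((pochhammer a n / pochhammer 1 n) ^ q * wellPoisedFactor a β γ δ n)

variable {a s : ℚ_[p]}

/-- The perturbed sum depends on the perturbation only through its second and third elementary
symmetric functions, and their coefficients `A`, `B` are divisible by `p`. -/
theorem perturbedSum_congr (hm : (m : ℚ_[p]) * a = 1)
    (ha : PadicCongr p 1 (a + N) 0) (ha1 : ∀ j < N, ‖a + j‖ = 1) (hN : N < p) {q : ℕ}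
    (hs : s * (-1) ^ (q + 3) = 1) :
    ∃ A B : ℚ_[p], PadicCongr p 1 A 0 ∧ PadicCongr p 1 B 0 ∧ ∀ β γ δ : ℚ_[p],
      PadicCongr p 1 β 0 → PadicCongr p 1 γ 0 → PadicCongr p 1 δ 0 → β + γ + δ = 0 →
      PadicCongr p 4 (perturbedSum m N q a s β γ δ)
        (∑ n ∈ Finset.range (N + 1), (2 * m * n + 1) * s ^ n *
          (pochhammer a n / pochhammer 1 n) ^ (q + 3) +
          (β * γ + β * δ + γ * δ) * A + β * γ * δ * B) := by
  refine ⟨_, _, sum_odd_summand_congr_zero hm ha hN hs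
    (fun n hn => quadraticTerm_congr ha hN hn) (fun n hn => ?_)
      (fun n hn => norm_quadraticTerm_le (fun j hj => ha1 j (by omega)) (by omega)),
    sum_odd_summand_congr_zero hm ha hN hs
    (fun n hn => cubicTerm_congr ha hN hn) (fun n hn => ?_)
      (fun n hn => norm_cubicTerm_le (fun j hj => ha1 j (by omega)) (by omega)), ?_⟩
  · rw [Nat.sub_sub_self hn]; ring
  · rw [Nat.sub_sub_self hn]; ring
  · intro β γ δ hβ hγ hδ h0
    rw [Finset.mul_sum, Finset.mul_sum, ← Finset.sum_add_distrib, ← Finset.sum_add_distrib]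
    refine PadicCongr.sum fun n hn => ?_
    have hn := Nat.lt_succ_iff.1 (Finset.mem_range.1 hn)
    have hs1 : ‖s‖ = 1 := by
      have := congrArg norm hs
      simpa using this
    have hM : ‖(2 * m * n + 1 : ℚ_[p])‖ ≤ 1 := by
      exact_mod_cast norm_natCast_le_one (p := p) (2 * m * n + 1)
    have hr : ‖pochhammer a n / pochhammer (1 : ℚ_[p]) n‖ ≤ 1 := by
      rw [norm_div, norm_pochhammer_eq_one fun j hj => ha1 j (by omega),
        norm_pochhammer_eq_one fun j hj => norm_one_add_natCast_eq_one (by omega), div_one]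
    have h := wellPoisedFactor_congr hβ hγ hδ h0 n (fun j hj => ha1 j (by omega)) (by omega)
    have h' := (h.mul_left (norm_pow_le_one hr q)).mul_left (c := (2 * m * n + 1 : ℚ_[p]) * s ^ n)
      (norm_mul_le_one hM (by rw [norm_pow, hs1, one_pow]))
    refine h'.trans (PadicCongr.of_eq ?_)
    ring

/-- Perturbing two parameters in opposite directions does not change the sum modulo `p ^ 3`. -/
theorem sum_congr_perturbedSum (hm : (m : ℚ_[p]) * a = 1)
    (ha : PadicCongr p 1 (a + N) 0) (ha1 : ∀ j < N, ‖a + j‖ = 1) (hN : N < p) {q : ℕ}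
    (hs : s * (-1) ^ (q + 3) = 1) :
    PadicCongr p 3 (∑ n ∈ Finset.range (N + 1), (2 * m * n + 1) * s ^ n *
      (pochhammer a n / pochhammer 1 n) ^ (q + 3))
      (perturbedSum m N q a s (-(a + N)) (a + N) 0) := by
  obtain ⟨A, B, hA, hB, h⟩ := perturbedSum_congr hm ha ha1 hN hs
  have h1 := h (-(a + N)) (a + N) 0 (by simpa using ha.neg) ha (PadicCongr.refl 0) (by ring)
  have h2 := ((ha.zero_pow 2).zero_mul hA).neg
  refine PadicCongr.trans ?_ (h1.mono (by norm_num)).symm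
  rw [PadicCongr.iff_sub]
  convert h2.neg using 1 <;> ring

/-- A combination of two perturbed sums which agrees with the unperturbed one modulo `p ^ 4`: the
perturbations by `(-1, 1, 0)` and `(-1, -1, 2)` times `a + N` have second elementary symmetric
functions in the ratio `1 : 3`, and the third ones are divisible by `p ^ 3`. -/
theorem two_mul_sum_congr_perturbedSum (hm : (m : ℚ_[p]) * a = 1)
    (ha : PadicCongr p 1 (a + N) 0) (ha1 : ∀ j < N, ‖a + j‖ = 1) (hN : N < p) {q : ℕ}
    (hs : s * (-1) ^ (q + 3) = 1) :
    PadicCongr p 4 (2 * ∑ n ∈ Finset.range (N + 1), (2 * m * n + 1) * s ^ n *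
      (pochhammer a n / pochhammer 1 n) ^ (q + 3))
      (3 * perturbedSum m N q a s (-(a + N)) (a + N) 0 -
        perturbedSum m N q a s (-(a + N)) (-(a + N)) (2 * (a + N))) := by
  obtain ⟨A, B, hA, hB, h⟩ := perturbedSum_congr hm ha ha1 hN hs
  have ha' : PadicCongr p 1 (-(a + N)) 0 := by simpa using ha.neg
  have ha2 : PadicCongr p 1 (2 * (a + N)) 0 := by
    rw [two_mul]; simpa using ha.add ha
  have h1 := h (-(a + N)) (a + N) 0 ha' ha (PadicCongr.refl 0) (by ring)
  have h2 := h (-(a + N)) (-(a + N)) (2 * (a + N)) ha' ha' ha2 (by ring)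
  have h3 := ((ha'.zero_mul ha').zero_mul ha2).zero_mul hB
  have h4 := (h1.mul_left (c := 3) (by exact_mod_cast norm_natCast_le_one (p := p) 3)).sub h2
  refine PadicCongr.trans ?_ h4.symm
  rw [PadicCongr.iff_sub]
  convert h3 using 1; ring

end Antisymmetry

/-! ### Closed forms of the perturbed sums -/

section ClosedForm

variable {p : ℕ} [Fact p.Prime] {m N : ℕ}

lemma intCast_div_add_ne_zero (hm : 0 < m) {z : ℤ} (hz : ¬ (m : ℤ) ∣ z) (j : ℤ) :
    (z : ℚ_[p]) / m + j ≠ 0 := by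
  intro h
  have hm' : (m : ℚ_[p]) ≠ 0 := by exact_mod_cast hm.ne'
  apply hz
  refine ⟨-j, ?_⟩
  field_simp at h
  have : ((z + m * j : ℤ) : ℚ_[p]) = 0 := by push_cast; linear_combination h
  have := Int.cast_eq_zero.1 this
  linarith

lemma pochhammer_one_sub_add (a : ℚ_[p]) (N : ℕ) :
    pochhammer (1 - (a + N)) N = (-1) ^ N * pochhammer a N := by
  rw [pochhammer_reflect]
  congr 2
  ring

/-- Data common to most of the sums: `p = m N + 1` with `m ≥ 2`, and `a = 1 / m`, so that
`a + N = p / m`. -/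
structure TerminatingData (p m N : ℕ) [Fact p.Prime] (a : ℚ_[p]) : Prop where
  eq : p = m * N + 1
  one_lt : 1 < m
  def_a : a = 1 / m

namespace TerminatingData

variable {a : ℚ_[p]} (S : TerminatingData p m N a)
include S

lemma pos : 0 < N := by
  rcases Nat.eq_zero_or_pos N with h | h
  · have := S.eq
    rw [h] at this
    exact absurd this (Fact.out : p.Prime).ne_one
  · exact h

lemma lt : m < p := by
  have h1 := S.eq
  have := Nat.le_mul_of_pos_right m S.pos
  omega

lemma two_mul_lt : 2 * N < p := by
  have h1 := S.eq
  have := Nat.mul_le_mul_right N S.one_lt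
  omega

lemma lt' : N < p := by
  have := S.two_mul_lt
  omega

lemma norm_m : ‖(m : ℚ_[p])‖ = 1 := norm_natCast_eq_one (by have := S.one_lt; omega) S.lt

lemma m_ne_zero : (m : ℚ_[p]) ≠ 0 := ne_zero_of_norm_eq_one S.norm_m

lemma mul_eq_one : (m : ℚ_[p]) * a = 1 := by
  rw [S.def_a, mul_one_div_cancel S.m_ne_zero]

lemma mul_add_eq : (m : ℚ_[p]) * (a + N) = p := by
  rw [mul_add, S.mul_eq_one]
  have := congrArg (Nat.cast : ℕ → ℚ_[p]) S.eq
  push_cast at this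
  rw [this, add_comm]

lemma add_congr : PadicCongr p 1 (a + N) 0 := by
  have h : a + N = (p : ℚ_[p]) * (m : ℚ_[p])⁻¹ := by
    rw [← S.mul_add_eq, mul_comm, inv_mul_cancel_left₀ S.m_ne_zero]
  rw [h]
  exact PadicCongr.p_zero.zero_mul_le (by rw [norm_inv, S.norm_m, inv_one])

lemma norm_add {j : ℕ} (hj : j < N) : ‖a + j‖ = 1 := by
  have h1 := S.eq
  have h2 := S.one_lt
  have h3 := norm_natCast_div_add_eq_one (p := p) (m := m) (i := 1) (j := j) (by omega) S.lt
    (by omega) (by have := Nat.mul_lt_mul_of_pos_left hj (show 0 < m by omega); omega)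
  rwa [S.def_a, ← Nat.cast_one]

/-- No integer translate of `z / m + t (a + N)` vanishes unless `m` divides `z + t`. -/
lemma ne_zero {z t : ℤ} (h : ¬ (m : ℤ) ∣ z + t) (j : ℤ) {x : ℚ_[p]}
    (hx : x = z / m + t * (a + N) + j) : x ≠ 0 := by
  have h1 := intCast_div_add_ne_zero (p := p) (m := m) (z := z + t)
    (by have := S.one_lt; omega) h (t * N + j)
  convert h1 using 1
  rw [hx, S.def_a]
  push_cast
  ring

lemma not_dvd_one : ¬ (m : ℤ) ∣ 1 := by
  have := S.one_lt
  intro h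
  have := Int.le_of_dvd one_pos h
  omega

lemma pochhammer_a_ne_zero (n : ℕ) : pochhammer a n ≠ 0 :=
  pochhammer_ne_zero (fun j => S.ne_zero (z := 1) (t := 0) (by simpa using S.not_dvd_one) j
    (by rw [S.def_a]; simp)) n

lemma one_add_a_ne_zero (j : ℕ) : 1 + a + j ≠ 0 :=
  S.ne_zero (z := 1) (t := 0) (by simpa using S.not_dvd_one) (1 + j)
    (by rw [S.def_a]; push_cast; ring)

lemma one_sub_ne_zero (j : ℕ) : 1 - (a + N) + j ≠ 0 :=
  S.ne_zero (z := 0) (t := -1) (by simpa using S.not_dvd_one) (1 + j) (by push_cast; ring)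

lemma one_add_ne_zero (j : ℕ) : 1 + (a + N) + j ≠ 0 :=
  S.ne_zero (z := 0) (t := 1) (by simpa using S.not_dvd_one) (1 + j) (by push_cast; ring)

/-- The factor `p` of the closed forms. -/
lemma mul_pochhammer_one_add : (m : ℚ_[p]) * (a * pochhammer (1 + a) N) = p * pochhammer a N := by
  rw [add_comm 1 a, mul_pochhammer_add_one, ← S.mul_add_eq]
  ring

/-- The prefactor `2 m n + 1` is the very-well-poised factor `(a + 2 n) / a`. -/
lemma prefactor (n : ℕ) : (2 * m * n + 1 : ℚ_[p]) = m * (a + 2 * n) := by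
  rw [mul_add, S.mul_eq_one]; ring

/-- For cubes, the perturbation by `(-1, 1, 0)` times `a + N` is summed by the `₄F₃(-1)` formula. -/
lemma perturbedSum_zero :
    perturbedSum m N 0 a (-1) (-(a + N)) (a + N) 0 = (-1) ^ N * p := by
  have h := sum_wellPoised_four_three a (a + (a + N)) S.one_add_a_ne_zero
    (fun j => by convert S.one_sub_ne_zero j using 1; ring) N
  have h2 := congrArg (fun x => (m : ℚ_[p]) * x) h
  simp only [Finset.mul_sum] at h2
  have e1 : 1 + a - (a + (a + (N : ℚ_[p]))) = 1 - (a + N) := by ring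
  rw [mul_div_assoc', S.mul_pochhammer_one_add, e1, pochhammer_one_sub_add,
    mul_div_mul_right _ _ (S.pochhammer_a_ne_zero N)] at h2
  have e2 : (p : ℚ_[p]) / (-1) ^ N = (-1) ^ N * p := by
    rcases Nat.even_or_odd N with h | h
    · simp [h.neg_one_pow]
    · simp [h.neg_one_pow, div_neg]
  rw [e2] at h2
  rw [← h2]
  refine Finset.sum_congr rfl fun n _ => ?_
  rw [S.prefactor, wellPoisedFactor, pow_zero, one_mul]
  have e3 : a + -(a + (N : ℚ_[p])) = -N := by ring
  have e4 : 1 - -(a + (N : ℚ_[p])) = 1 + a + N := by ring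
  rw [e3, e4, sub_zero, add_zero]
  ring

/-- For fourth powers, the terminating perturbations are summed by the `₅F₄(1)` formula. -/
lemma perturbedSum_one {γ δ : ℚ_[p]} (hγ : ∀ j : ℕ, 1 - γ + j ≠ 0) (hδ : ∀ j : ℕ, 1 - δ + j ≠ 0) :
    perturbedSum m N 1 a 1 (-(a + N)) γ δ =
      p * (pochhammer a N * pochhammer (1 - a - γ - δ) N /
        (pochhammer (1 - γ) N * pochhammer (1 - δ) N)) := by
  have h := sum_wellPoised_five_four a (a + γ) (a + δ) S.one_add_a_ne_zero
    (fun j => by convert hγ j using 1; ring) (fun j => by convert hδ j using 1; ring) N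
  have h2 := congrArg (fun x => (m : ℚ_[p]) * x) h
  simp only [Finset.mul_sum] at h2
  have e1 : 1 + a - (a + γ) = 1 - γ := by ring
  have e2 : 1 + a - (a + δ) = 1 - δ := by ring
  have e3 : 1 - γ - (a + δ) = 1 - a - γ - δ := by ring
  rw [mul_div_assoc', ← mul_assoc a, ← mul_assoc (m : ℚ_[p]), S.mul_pochhammer_one_add, e1, e2, e3,
    mul_assoc, ← mul_div_assoc'] at h2
  rw [← h2]
  refine Finset.sum_congr rfl fun n _ => ?_
  rw [S.prefactor, wellPoisedFactor, pow_one, one_pow, mul_one]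
  have e3 : a + -(a + (N : ℚ_[p])) = -N := by ring
  have e4 : 1 - -(a + (N : ℚ_[p])) = 1 + a + N := by ring
  rw [e3, e4]
  ring

/-- For sixth powers and `a = 1 / 3`, Dougall's formula applies: its balancing condition is then the
vanishing of the sum of the three perturbations. -/
lemma perturbedSum_three (hm3 : m = 3) {γ : ℚ_[p]} (hγ : ∀ j : ℕ, 1 - γ + j ≠ 0)
    (hγ2 : ∀ j : ℤ, 2 * a + γ + j ≠ 0) (hγ3 : ∀ j : ℕ, 2 * a - γ + j ≠ 0) :
    perturbedSum m N 3 a 1 (-(a + N)) γ (a + N - γ) =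
      p * (pochhammer a N * pochhammer (2 * a) N * pochhammer (2 * a - γ) N ^ 2 /
        (pochhammer 1 N ^ 2 * pochhammer (1 - γ) N * pochhammer (a - γ) N)) := by
  have h3 : 3 * a = 1 := by
    have := S.mul_eq_one
    rw [hm3] at this
    exact_mod_cast this
  have h1 : ∀ j : ℕ, 1 + a - a + (j : ℚ_[p]) ≠ 0 := fun j => by
    rw [add_sub_cancel_right, add_comm]
    exact Nat.cast_add_one_ne_zero j
  have h := sum_wellPoised_seven_six a a a (a + γ) S.one_add_a_ne_zero h1 h1
    (fun j => by convert hγ j using 1; ring) (fun j => by convert hγ2 j using 1; ring)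
    (fun j => by
      have := hγ3 j
      contrapose! this
      linear_combination this + h3) N
  have h2 := congrArg (fun x => (m : ℚ_[p]) * x) h
  simp only [Finset.mul_sum] at h2
  have e1 : 1 + a - a = 1 := by ring
  have e2 : 1 + a - (a + γ) = 1 - γ := by ring
  have e5 : 1 - a = 2 * a := by linear_combination -h3
  have e3 : 1 - (a + γ) = 2 * a - γ := by linear_combination -h3
  have e4 : 2 * a - (a + γ) = a - γ := by ring
  have e6 : 1 + 2 * a - a - a - (a + γ) + N = a + (a + N - γ) := by linear_combination -h3
  have e7 : a + a + (a + γ) - a - N = 1 - (a + N - γ) := by linear_combination h3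
  rw [e6, e7] at h2
  simp only [e1, e2, e5, e3, e4] at h2
  rw [mul_div_assoc', ← mul_assoc a, ← mul_assoc a, ← mul_assoc a, ← mul_assoc (m : ℚ_[p]),
    ← mul_assoc (m : ℚ_[p]), ← mul_assoc (m : ℚ_[p]), S.mul_pochhammer_one_add] at h2
  refine Eq.trans ?_ (h2.trans (by ring))
  refine Finset.sum_congr rfl fun n _ => ?_
  rw [S.prefactor, wellPoisedFactor, one_pow, mul_one]
  have e3 : a + -(a + (N : ℚ_[p])) = -N := by ring
  have e4 : 1 - -(a + (N : ℚ_[p])) = 1 + a + N := by ring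
  rw [e3, e4]
  ring

/-- The alternating sum of cubes. -/
theorem sum_cube_congr :
    PadicCongr p 3 (∑ n ∈ Finset.range (N + 1), (2 * m * n + 1) * (-1) ^ n *
      (pochhammer a n ^ 3 / pochhammer (1 : ℚ_[p]) n ^ 3)) ((-1) ^ N * p) := by
  have h := sum_congr_perturbedSum (q := 0) (s := -1) S.mul_eq_one S.add_congr
    (fun j hj => S.norm_add hj) S.lt' (by norm_num)
  rw [S.perturbedSum_zero] at h
  simpa only [div_pow] using h

end TerminatingData

/-- The sum of fourth powers for `a = 1 / 2`. -/
theorem sum_fourth_half_congr (S : TerminatingData p 2 N (1 / 2 : ℚ_[p])) :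
    PadicCongr p 3 (∑ n ∈ Finset.range (N + 1), (2 * (2 : ℕ) * n + 1) *
      (pochhammer (1 / 2 : ℚ_[p]) n ^ 4 / pochhammer (1 : ℚ_[p]) n ^ 4)) p := by
  have h := sum_congr_perturbedSum (q := 1) (s := 1) S.mul_eq_one S.add_congr
    (fun j hj => S.norm_add hj) S.lt' (by norm_num)
  rw [S.perturbedSum_one S.one_sub_ne_zero
    (fun j => by rw [sub_zero, add_comm]; exact Nat.cast_add_one_ne_zero j)] at h
  have e1 : pochhammer (1 - 1 / 2 - (1 / 2 + N) - 0 : ℚ_[p]) N =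
      (-1) ^ N * pochhammer 1 N := by
    rw [pochhammer_reflect]
    congr 2
    ring
  have h1 : pochhammer (1 : ℚ_[p]) N ≠ 0 := by
    rw [pochhammer_one]
    exact_mod_cast N.factorial_ne_zero
  rw [e1, pochhammer_one_sub_add, sub_zero] at h
  have hp := S.pochhammer_a_ne_zero N
  have e2 : pochhammer (1 / 2 : ℚ_[p]) N * ((-1) ^ N * pochhammer 1 N) /
      ((-1) ^ N * pochhammer (1 / 2 : ℚ_[p]) N * pochhammer 1 N) = 1 := by
    rw [div_eq_one_iff_eq]
    · ring
    · exact mul_ne_zero (mul_ne_zero (by simp) hp) h1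
  rw [e2, mul_one] at h
  simpa only [div_pow, one_pow, mul_one] using h

end ClosedForm

/-! ### Wilson's theorem for prime powers and the continuity of Morita's gamma function -/

section GammaNat

/-- Any `n` consecutive integers form a complete residue system. -/
lemma prod_range_natCast_zmod {M : Type*} [CommMonoid M] (n : ℕ) [NeZero n] (f : ZMod n → M)
    (k : ℕ) : ∏ j ∈ Finset.range n, f ((k + j : ℕ) : ZMod n) = ∏ x : ZMod n, f x := by
  rw [← Equiv.prod_comp (Equiv.addLeft (k : ZMod n))]
  refine Finset.prod_bij' (fun j _ => (j : ZMod n)) (fun x _ => x.val) ?_ ?_ ?_ ?_ ?_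
  · simp
  · intro x _; exact Finset.mem_range.2 (ZMod.val_lt x)
  · intro j hj; exact ZMod.val_cast_of_lt (Finset.mem_range.1 hj)
  · intro x _; simp
  · intro j _; simp

lemma sum_range_natCast_zmod {M : Type*} [AddCommMonoid M] (n : ℕ) [NeZero n] (f : ZMod n → M)
    (k : ℕ) : ∑ j ∈ Finset.range n, f ((k + j : ℕ) : ZMod n) = ∑ x : ZMod n, f x :=
  prod_range_natCast_zmod (M := Multiplicative M) n f k

variable {p : ℕ} [Fact p.Prime]

lemma zmod_units_sq_eq_one (hp : p ≠ 2) {r : ℕ} {u : (ZMod (p ^ r))ˣ} (hu : u * u = 1) :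
    u = 1 ∨ u = -1 := by
  have hp' := (Fact.out : p.Prime)
  obtain ⟨z, hz⟩ := ZMod.intCast_surjective (u : ZMod (p ^ r))
  have h1 : ((p ^ r : ℕ) : ℤ) ∣ (z - 1) * (z + 1) := by
    rw [← ZMod.intCast_zmod_eq_zero_iff_dvd]
    push_cast
    rw [hz]
    have := congrArg (Units.val) hu
    push_cast at this
    linear_combination this
  push_cast at h1
  have hpz : Prime (p : ℤ) := Nat.prime_iff_prime_int.1 hp'
  have h2 : (p : ℤ) ^ r ∣ z - 1 ∨ (p : ℤ) ^ r ∣ z + 1 := by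
    by_cases h : (p : ℤ) ∣ z - 1
    · left
      have h3 : ¬ (p : ℤ) ∣ z + 1 := fun h' => by
        have : (p : ℤ) ∣ 2 := by
          have := dvd_sub h' h
          ring_nf at this
          exact this
        have := Int.le_of_dvd two_pos this
        have := hp'.two_le
        omega
      exact ((hpz.coprime_iff_not_dvd.2 h3).pow_left).dvd_of_dvd_mul_right h1
    · right
      exact ((hpz.coprime_iff_not_dvd.2 h).pow_left).dvd_of_dvd_mul_left h1
  rcases h2 with h | h
  · left
    ext
    have := (ZMod.intCast_zmod_eq_zero_iff_dvd _ (p ^ r)).2 (by exact_mod_cast h)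
    push_cast at this
    rw [hz] at this
    rw [Units.val_one]
    linear_combination this
  · right
    ext
    have := (ZMod.intCast_zmod_eq_zero_iff_dvd _ (p ^ r)).2 (by exact_mod_cast h)
    push_cast at this
    rw [hz] at this
    rw [Units.val_neg, Units.val_one]
    linear_combination this

instance instNeZeroPrimePow (r : ℕ) : NeZero (p ^ r) :=
  ⟨pow_ne_zero r (Fact.out : p.Prime).ne_zero⟩

/-- Wilson's theorem modulo an odd prime power. -/
lemma prod_zmod_units (hp : p ≠ 2) (r : ℕ) : ∏ u : (ZMod (p ^ r))ˣ, u = -1 := by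
  classical
  rw [← Finset.mul_prod_erase _ _ (Finset.mem_univ (-1 : (ZMod (p ^ r))ˣ))]
  convert mul_one (-1 : (ZMod (p ^ r))ˣ)
  refine Finset.prod_involution (fun u _ => u⁻¹) (fun u _ => mul_inv_cancel u) ?_ ?_ ?_
  · intro u hu h1 h
    rcases zmod_units_sq_eq_one hp (u := u) (by have := mul_inv_cancel u; rwa [h] at this)
      with h | h
    · exact h1 h
    · simp [h] at hu
  · intro u hu
    simp only [Finset.mem_erase, Finset.mem_univ, and_true] at hu ⊢
    intro h
    apply hu
    rw [← inv_inv u, h, inv_neg, inv_one]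
  · intro u _; simp

/-- The factor of `j` in the `p`-adic factorial: `j` if it is prime to `p`, and `1` otherwise. -/
def coprimePart (p j : ℕ) : ℤ := if Nat.Coprime j p then j else 1

lemma moritaGammaNat_eq_prod (p k : ℕ) (hp : p ≠ 1) :
    moritaGammaNat p k = ∏ j ∈ Finset.range k, -coprimePart p j := by
  have h : ∀ j, -coprimePart p j = (-1) * coprimePart p j := fun j => by ring
  simp_rw [moritaGammaNat, h, Finset.prod_mul_distrib, Finset.prod_const, Finset.card_range]
  congr 1
  rw [Finset.prod_filter]
  refine Finset.prod_subset (fun j hj => ?_) (fun j hj hj' => ?_)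
  · exact Finset.mem_range.2 (Finset.mem_Ioo.1 hj).2
  · have h0 : j = 0 := by
      by_contra h
      exact hj' (Finset.mem_Ioo.2 ⟨Nat.pos_of_ne_zero h, Finset.mem_range.1 hj⟩)
    subst h0
    simp [hp]

lemma moritaGammaNat_zero (p : ℕ) : moritaGammaNat p 0 = 1 := by simp [moritaGammaNat]

lemma moritaGammaNat_succ (p k : ℕ) (hp : p ≠ 1) :
    moritaGammaNat p (k + 1) = moritaGammaNat p k * -coprimePart p k := by
  rw [moritaGammaNat_eq_prod _ _ hp, moritaGammaNat_eq_prod _ _ hp, Finset.prod_range_succ]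

lemma moritaGammaNat_add (p k l : ℕ) (hp : p ≠ 1) :
    moritaGammaNat p (k + l) =
      moritaGammaNat p k * ∏ j ∈ Finset.range l, -coprimePart p (k + j) := by
  rw [moritaGammaNat_eq_prod _ _ hp, moritaGammaNat_eq_prod _ _ hp, Finset.prod_range_add]

lemma not_dvd_moritaGammaNat (k : ℕ) : ¬ (p : ℤ) ∣ moritaGammaNat p k := by
  have hp' := (Fact.out : p.Prime)
  rw [moritaGammaNat_eq_prod _ _ hp'.ne_one]
  intro h
  obtain ⟨j, -, hj⟩ := (Nat.prime_iff_prime_int.1 hp').exists_mem_finset_dvd h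
  rw [dvd_neg, coprimePart] at hj
  split_ifs at hj with h
  · exact (hp'.coprime_iff_not_dvd.1 h.symm) (Int.natCast_dvd_natCast.1 hj)
  · have := Int.le_of_dvd one_pos hj
    have := hp'.two_le
    omega

/-- Morita's gamma function on natural numbers is periodic modulo every power of `p`. -/
lemma moritaGammaNat_add_pow (hp : p ≠ 2) (r k : ℕ) :
    ((moritaGammaNat p (k + p ^ r) : ℤ) : ZMod (p ^ r)) = (moritaGammaNat p k : ZMod (p ^ r)) := by
  classical
  have hp' := (Fact.out : p.Prime)
  rcases Nat.eq_zero_or_pos r with rfl | hr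
  · have : Subsingleton (ZMod (p ^ 0)) := by rw [pow_zero]; infer_instance
    exact Subsingleton.elim _ _
  rw [moritaGammaNat_add _ _ _ hp'.ne_one, Int.cast_mul]
  convert mul_one _
  push_cast
  have h1 : ∀ j : ℕ, ((coprimePart p j : ℤ) : ZMod (p ^ r)) =
      if IsUnit (j : ZMod (p ^ r)) then (j : ZMod (p ^ r)) else 1 := fun j => by
    have hu : IsUnit (j : ZMod (p ^ r)) ↔ Nat.Coprime j p := by
      rw [ZMod.isUnit_iff_coprime, Nat.coprime_pow_right_iff hr]
    by_cases h : Nat.Coprime j p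
    · rw [coprimePart, if_pos h, if_pos (hu.2 h), Int.cast_natCast]
    · rw [coprimePart, if_neg h, if_neg (mt hu.1 h), Int.cast_one]
  simp_rw [h1]
  rw [prod_range_natCast_zmod (p ^ r)
    (fun x : ZMod (p ^ r) => -(if IsUnit x then x else 1)) k]
  have h2 : ∀ x : ZMod (p ^ r), -(if IsUnit x then x else 1) =
    (-1) * (if IsUnit x then x else 1) := fun x => by ring
  simp_rw [h2, Finset.prod_mul_distrib, Finset.prod_const, Finset.card_univ, ZMod.card]
  rw [Odd.neg_one_pow ((hp'.odd_of_ne_two hp).pow)]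
  have h3 : ∏ u : (ZMod (p ^ r))ˣ, (u : ZMod (p ^ r)) =
      ∏ x : ZMod (p ^ r), if IsUnit x then x else 1 := by
    refine Finset.prod_of_injOn (fun u : (ZMod (p ^ r))ˣ => (u : ZMod (p ^ r)))
      Units.val_injective.injOn (fun _ _ => by simp) ?_ ?_
    · intro x _ hx
      rw [if_neg]
      rintro ⟨u, rfl⟩
      exact hx ⟨u, by simp, rfl⟩
    · intro u _; simp
  rw [← h3, ← Units.coe_prod, prod_zmod_units hp r]
  simp

lemma moritaGammaNat_congr (hp : p ≠ 2) {r k l : ℕ} (h : k ≡ l [MOD p ^ r]) :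
    ((moritaGammaNat p k : ℤ) : ZMod (p ^ r)) = (moritaGammaNat p l : ZMod (p ^ r)) := by
  have key : ∀ k t : ℕ, ((moritaGammaNat p (k + p ^ r * t) : ℤ) : ZMod (p ^ r)) =
      (moritaGammaNat p k : ZMod (p ^ r)) := by
    intro k t
    induction t with
    | zero => simp
    | succ t ih => rw [mul_add, mul_one, ← add_assoc, moritaGammaNat_add_pow hp, ih]
  wlog hkl : k ≤ l generalizing k l
  · exact (this h.symm (by omega)).symm
  obtain ⟨t, ht⟩ := (Nat.modEq_iff_dvd' hkl).1 h
  rw [show l = k + p ^ r * t by omega, key]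

end GammaNat

section Gamma

variable {p : ℕ} [Fact p.Prime]

lemma padicCongr_natCast_iff {r k l : ℕ} :
    PadicCongr p r (k : ℚ_[p]) (l : ℚ_[p]) ↔ k ≡ l [MOD p ^ r] := by
  rw [padicCongr_iff, ← Int.natCast_modEq_iff, Int.modEq_comm, Int.modEq_iff_dvd]
  have := Padic.norm_int_le_pow_iff_dvd (p := p) ((k : ℤ) - l) r
  push_cast at this ⊢
  exact this

lemma padicCongr_intCast_iff {r : ℕ} {k l : ℤ} :
    PadicCongr p r (k : ℚ_[p]) (l : ℚ_[p]) ↔ (k : ZMod (p ^ r)) = l := by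
  rw [padicCongr_iff, eq_comm, ZMod.intCast_eq_intCast_iff, Int.modEq_iff_dvd]
  have := Padic.norm_int_le_pow_iff_dvd (p := p) (k - l) r
  push_cast at this ⊢
  exact this

lemma exists_natCast_congr {x : ℚ_[p]} (hx : ‖x‖ ≤ 1) (r : ℕ) :
    ∃ k : ℕ, PadicCongr p r x k := by
  obtain ⟨X, rfl⟩ := exists_padicInt_coe hx
  obtain ⟨z, hz⟩ := Ideal.mem_span_singleton'.1 (PadicInt.appr_spec r X)
  refine ⟨X.appr r, z, ?_⟩
  have := congrArg (fun y : ℤ_[p] => (y : ℚ_[p])) hz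
  push_cast at this
  rw [← this, mul_comm]

lemma comap_natCast_nhds_neBot (s : ℤ_[p]) :
    (Filter.comap (fun k : ℕ => (k : ℤ_[p])) (nhds s)).NeBot := by
  refine Filter.comap_neBot_iff.2 fun t ht => ?_
  obtain ⟨_, h, k, rfl⟩ := mem_closure_iff_nhds.1 (PadicInt.denseRange_natCast s) t ht
  exact ⟨k, h⟩

lemma padicGamma_coe (s : ℤ_[p]) : padicGamma p (s : ℚ_[p]) = (moritaGamma p s : ℤ_[p]) :=
  dif_pos s.2

/-- The limit defining Morita's gamma function exists. -/
lemma tendsto_moritaGamma (hp : p ≠ 2) (s : ℤ_[p]) :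
    Filter.Tendsto (fun k : ℕ => ((moritaGammaNat p k : ℤ) : ℤ_[p]))
      (Filter.comap (fun k : ℕ => (k : ℤ_[p])) (nhds s)) (nhds (moritaGamma p s)) := by
  refine tendsto_nhds_limUnder ?_
  have hne : (Filter.comap (fun k : ℕ => (k : ℤ_[p])) (nhds s)).NeBot :=
    comap_natCast_nhds_neBot s
  have hc : Cauchy (Filter.map (fun k : ℕ => ((moritaGammaNat p k : ℤ) : ℤ_[p]))
      (Filter.comap (fun k : ℕ => (k : ℤ_[p])) (nhds s))) := by
    refine Metric.cauchy_iff.2 ⟨hne.map _, fun ε hε => ?_⟩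
    obtain ⟨n, hn⟩ := PadicInt.exists_pow_neg_lt p hε
    have hn0 : (0 : ℝ) < (p : ℝ) ^ (-(n : ℤ)) :=
      zpow_pos (Nat.cast_pos.2 (Fact.out : p.Prime).pos) _
    refine ⟨_, Filter.image_mem_map (Filter.preimage_mem_comap
      (Metric.closedBall_mem_nhds s hn0)), ?_⟩
    rintro _ ⟨k, hk, rfl⟩ _ ⟨l, hl, rfl⟩
    refine lt_of_le_of_lt ?_ hn
    have hkl : PadicCongr p n (k : ℚ_[p]) (l : ℚ_[p]) := by
      rw [padicCongr_iff]
      have h1 := PadicInt.nonarchimedean ((k : ℤ_[p]) - s) (s - l)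
      rw [sub_add_sub_cancel] at h1
      rw [Set.mem_preimage, Metric.mem_closedBall, dist_eq_norm] at hk hl
      rw [norm_sub_rev] at hl
      have := h1.trans (max_le hk hl)
      rw [PadicInt.norm_def] at this
      push_cast at this
      exact this
    have := (padicCongr_intCast_iff (p := p)).2
      (moritaGammaNat_congr hp (padicCongr_natCast_iff.1 hkl))
    rw [padicCongr_iff] at this
    rw [dist_eq_norm, PadicInt.norm_def]
    push_cast
    exact this
  obtain ⟨x, hx⟩ := CompleteSpace.complete hc
  exact ⟨x, hx⟩

/-- The gamma function is determined modulo `p ^ r` by any natural number congruent to its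
argument. -/
theorem padicGamma_congr_nat (hp : p ≠ 2) {x : ℚ_[p]} {k r : ℕ} (hxk : PadicCongr p r x k) :
    PadicCongr p r (padicGamma p x) ((moritaGammaNat p k : ℤ) : ℚ_[p]) := by
  have hx : ‖x‖ ≤ 1 := hxk.symm.norm_le (norm_natCast_le_one k)
  obtain ⟨X, rfl⟩ := exists_padicInt_coe hx
  rw [padicGamma_coe, padicCongr_iff]
  have hne : (Filter.comap (fun k : ℕ => (k : ℤ_[p])) (nhds X)).NeBot :=
    comap_natCast_nhds_neBot _
  have hr0 : (0 : ℝ) < (p : ℝ) ^ (-(r : ℤ)) :=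
    zpow_pos (Nat.cast_pos.2 (Fact.out : p.Prime).pos) _
  have hlim := (tendsto_moritaGamma hp X).sub_const
    ((moritaGammaNat p k : ℤ) : ℤ_[p])
  have hle := le_of_tendsto hlim.norm (b := (p : ℝ) ^ (-(r : ℤ))) ?_
  · rw [PadicInt.norm_def] at hle
    push_cast at hle
    exact hle
  · filter_upwards [Filter.preimage_mem_comap (Metric.closedBall_mem_nhds X hr0)]
      with l hl
    rw [Set.mem_preimage, Metric.mem_closedBall, dist_eq_norm, PadicInt.norm_def] at hl
    have hl' : PadicCongr p r (l : ℚ_[p]) X := by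
      rw [padicCongr_iff]
      push_cast at hl
      exact hl
    have := (padicCongr_intCast_iff (p := p)).2
      (moritaGammaNat_congr hp (padicCongr_natCast_iff.1 (hl'.trans hxk)))
    rw [padicCongr_iff] at this
    rw [PadicInt.norm_def]
    push_cast
    exact this

end Gamma

/-! ### Functional equation, reflection formula and differences of the gamma function -/

section GammaFunctional

variable {p : ℕ} [Fact p.Prime]

lemma norm_moritaGammaNat (k : ℕ) : ‖((moritaGammaNat p k : ℤ) : ℚ_[p])‖ = 1 :=
  Padic.norm_intCast_eq_one_iff.2 (((Nat.prime_iff_prime_int.1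
    (Fact.out : p.Prime)).coprime_iff_not_dvd.2 (not_dvd_moritaGammaNat k)).symm)

lemma norm_padicGamma (hp : p ≠ 2) {x : ℚ_[p]} (hx : ‖x‖ ≤ 1) : ‖padicGamma p x‖ = 1 := by
  obtain ⟨k, hk⟩ := exists_natCast_congr hx 1
  exact (padicGamma_congr_nat hp hk).symm.norm_eq_one (norm_moritaGammaNat k)

lemma padicGamma_ne_zero (hp : p ≠ 2) {x : ℚ_[p]} (hx : ‖x‖ ≤ 1) : padicGamma p x ≠ 0 :=
  ne_zero_of_norm_eq_one (norm_padicGamma hp hx)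

lemma padicGamma_congr (hp : p ≠ 2) {x y : ℚ_[p]} (hx : ‖x‖ ≤ 1) {r : ℕ}
    (h : PadicCongr p r x y) : PadicCongr p r (padicGamma p x) (padicGamma p y) := by
  obtain ⟨k, hk⟩ := exists_natCast_congr hx r
  exact (padicGamma_congr_nat hp hk).trans (padicGamma_congr_nat hp (h.symm.trans hk)).symm

lemma padicGamma_natCast (hp : p ≠ 2) (k : ℕ) :
    padicGamma p (k : ℚ_[p]) = (moritaGammaNat p k : ℤ) :=
  PadicCongr.eq_of_forall fun _ => padicGamma_congr_nat hp (PadicCongr.refl _)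

lemma padicGamma_zero (hp : p ≠ 2) : padicGamma p 0 = 1 := by
  have := padicGamma_natCast (p := p) hp 0
  rwa [moritaGammaNat_zero, Nat.cast_zero, Int.cast_one] at this

lemma coprime_iff_norm {k : ℕ} : Nat.Coprime k p ↔ ‖(k : ℚ_[p])‖ = 1 := by
  rw [Padic.norm_natCast_eq_one_iff, Nat.coprime_comm]

/-- The functional equation at units. -/
theorem padicGamma_add_one (hp : p ≠ 2) {x : ℚ_[p]} (hx : ‖x‖ = 1) :
    padicGamma p (x + 1) = -x * padicGamma p x := by
  refine PadicCongr.eq_of_forall fun r => ?_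
  obtain ⟨k, hk⟩ := exists_natCast_congr hx.le (r + 1)
  have h1 : PadicCongr p (r + 1) (x + 1) ((k + 1 : ℕ) : ℚ_[p]) := by
    push_cast; exact hk.add (PadicCongr.refl 1)
  have h2 := padicGamma_congr_nat hp h1
  rw [moritaGammaNat_succ _ _ (Fact.out : p.Prime).ne_one, coprimePart,
    if_pos (coprime_iff_norm.2 ((hk.mono (by omega)).norm_eq_one hx))] at h2
  have h3 := hk.neg.mul (padicGamma_congr_nat hp hk) (by rw [norm_neg, hx])
    (norm_moritaGammaNat k).le
  refine (h2.trans ?_).mono (Nat.le_succ r)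
  refine PadicCongr.trans (PadicCongr.of_eq ?_) h3.symm
  push_cast; ring

/-- The functional equation at non-units. -/
theorem padicGamma_add_one_of_congr (hp : p ≠ 2) {x : ℚ_[p]} (hx : PadicCongr p 1 x 0) :
    padicGamma p (x + 1) = -padicGamma p x := by
  refine PadicCongr.eq_of_forall fun r => ?_
  obtain ⟨k, hk⟩ := exists_natCast_congr hx.norm_le_of_zero (r + 1)
  have h1 : PadicCongr p (r + 1) (x + 1) ((k + 1 : ℕ) : ℚ_[p]) := by
    push_cast; exact hk.add (PadicCongr.refl 1)
  have h2 := padicGamma_congr_nat hp h1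
  have hk0 := PadicCongr.zero_iff_lt.1 ((hk.mono (show 1 ≤ r + 1 by omega)).symm.trans hx)
  rw [moritaGammaNat_succ _ _ (Fact.out : p.Prime).ne_one, coprimePart,
    if_neg (mt coprime_iff_norm.1 hk0.ne)] at h2
  refine (h2.trans ?_).mono (Nat.le_succ r)
  refine PadicCongr.trans (PadicCongr.of_eq ?_) (padicGamma_congr_nat hp hk).symm.neg
  push_cast; ring

lemma padicGamma_one (hp : p ≠ 2) : padicGamma p 1 = -1 := by
  have := padicGamma_add_one_of_congr (p := p) hp (PadicCongr.refl 0)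
  rwa [zero_add, padicGamma_zero hp] at this

/-- The functional equation iterated over a range of units. -/
theorem padicGamma_add_natCast (hp : p ≠ 2) {x : ℚ_[p]} {n : ℕ} (hx : ∀ j < n, ‖x + j‖ = 1) :
    padicGamma p (x + n) = (-1) ^ n * pochhammer x n * padicGamma p x := by
  induction n with
  | zero => simp [pochhammer_zero]
  | succ n ih =>
    rw [Nat.cast_succ, ← add_assoc, padicGamma_add_one hp (hx n (by omega)),
      ih fun j hj => hx j (by omega), pochhammer_succ, pow_succ]
    ring

lemma pochhammer_eq_padicGamma (hp : p ≠ 2) {x : ℚ_[p]} {n : ℕ} (hx1 : ‖x‖ ≤ 1)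
    (hx : ∀ j < n, ‖x + j‖ = 1) :
    pochhammer x n = (-1) ^ n * (padicGamma p (x + n) / padicGamma p x) := by
  have h0 := padicGamma_ne_zero hp hx1
  rw [padicGamma_add_natCast hp hx, mul_div_assoc', eq_div_iff h0]
  have : ((-1 : ℚ_[p]) ^ n) * (-1) ^ n = 1 := by rw [← mul_pow]; simp
  linear_combination (-(pochhammer x n * padicGamma p x)) * this

lemma padicGamma_reflect_add_one (hp : p ≠ 2) {x : ℚ_[p]} (hx : ‖x‖ = 1) :
    padicGamma p (x + 1) * padicGamma p (1 - (x + 1)) =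
      -(padicGamma p x * padicGamma p (1 - x)) := by
  have h1 : padicGamma p (1 - x) = x * padicGamma p (-x) := by
    have := padicGamma_add_one hp (x := -x) (by rwa [norm_neg])
    rw [neg_neg] at this
    rw [← this]; congr 1; ring
  rw [padicGamma_add_one hp hx, h1, show 1 - (x + 1) = -x by ring]
  ring

lemma padicGamma_reflect_add_one_of_congr (hp : p ≠ 2) {x : ℚ_[p]} (hx : PadicCongr p 1 x 0) :
    padicGamma p (x + 1) * padicGamma p (1 - (x + 1)) =
      padicGamma p x * padicGamma p (1 - x) := by
  have h1 : padicGamma p (1 - x) = -padicGamma p (-x) := by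
    have := padicGamma_add_one_of_congr hp (x := -x) (by simpa using hx.neg)
    rw [← this]; congr 1; ring
  rw [padicGamma_add_one_of_congr hp hx, h1, show 1 - (x + 1) = -x by ring]
  ring

lemma padicGamma_reflect_add (hp : p ≠ 2) {y : ℚ_[p]} (hy : PadicCongr p 1 y 0) {k : ℕ}
    (hk : k + 1 ≤ p) :
    padicGamma p (y + (k + 1 : ℕ)) * padicGamma p (1 - (y + (k + 1 : ℕ))) =
      (-1) ^ k * (padicGamma p y * padicGamma p (1 - y)) := by
  induction k with
  | zero => simpa using padicGamma_reflect_add_one_of_congr hp hy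
  | succ k ih =>
    have hu : ‖y + (k + 1 : ℕ)‖ = 1 := by
      rw [add_comm]
      exact norm_add_eq_one hy (norm_natCast_eq_one (by omega) (by omega))
    rw [Nat.cast_succ (k + 1), ← add_assoc, padicGamma_reflect_add_one hp hu, ih (by omega),
      pow_succ]
    ring

/-- The reflection formula. -/
theorem padicGamma_reflect (hp : p ≠ 2) {x : ℚ_[p]} {k : ℕ} (hk0 : 0 < k) (hk : k ≤ p)
    (hx : PadicCongr p 1 x k) : padicGamma p x * padicGamma p (1 - x) = (-1) ^ k := by
  have hp' := (Fact.out : p.Prime)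
  have h1 : ∀ l : ℕ, padicGamma p ((p * l : ℕ) : ℚ_[p]) * padicGamma p (1 - ((p * l : ℕ) : ℚ_[p]))
      = -1 := by
    intro l
    induction l with
    | zero => simp [padicGamma_zero hp, padicGamma_one hp]
    | succ l ih =>
      have hy : PadicCongr p 1 ((p * l : ℕ) : ℚ_[p]) 0 := ⟨l, by push_cast; ring⟩
      have := padicGamma_reflect_add hp hy (k := p - 1) (by have := hp'.pos; omega)
      rw [Nat.sub_add_cancel hp'.one_le, ih,
        ((hp'.even_sub_one hp)).neg_one_pow, one_mul] at this
      rw [mul_add, mul_one]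
      push_cast at this ⊢
      exact this
  have h2 : ∀ y : ℚ_[p], PadicCongr p 1 y 0 → padicGamma p y * padicGamma p (1 - y) = -1 := by
    intro y hy
    refine PadicCongr.eq_of_forall fun r => ?_
    have hy1 := hy.norm_le_of_zero
    obtain ⟨k, hk⟩ := exists_natCast_congr hy1 (r + 1)
    have hk0 := (hk.mono (show 1 ≤ r + 1 by omega)).symm.trans hy
    have hpk : p ∣ k := by
      rw [PadicCongr.zero_iff_lt, Padic.norm_natCast_lt_one_iff] at hk0
      exact hk0
    obtain ⟨l, rfl⟩ := hpk
    rw [← h1 l]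
    have hy2 : ‖1 - y‖ ≤ 1 := norm_sub_le_one (by simp) hy1
    have hy3 : ‖1 - ((p * l : ℕ) : ℚ_[p])‖ ≤ 1 := norm_sub_le_one (by simp) (norm_natCast_le_one _)
    exact (((padicGamma_congr hp hy1 hk).mul
      (padicGamma_congr hp hy2 ((PadicCongr.refl 1).sub hk)) (norm_padicGamma hp hy1).le
      (norm_padicGamma hp hy3).le).mono (Nat.le_succ r))
  have hy : PadicCongr p 1 (x - k) 0 := PadicCongr.iff_sub.1 hx
  obtain ⟨k, rfl⟩ : ∃ k', k = k' + 1 := ⟨k - 1, by omega⟩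
  have := padicGamma_reflect_add hp hy hk
  rw [sub_add_cancel, h2 _ hy] at this
  rw [this, pow_succ]

end GammaFunctional

section GammaDifference

variable {p : ℕ} [Fact p.Prime]

/-- The inverse of `j` if it is prime to `p`, and `0` otherwise. -/
noncomputable def coprimeInv (p : ℕ) [Fact p.Prime] (j : ℕ) : ℚ_[p] :=
  if Nat.Coprime j p then (j : ℚ_[p])⁻¹ else 0

lemma norm_coprimeInv_le (j : ℕ) : ‖coprimeInv p j‖ ≤ 1 := by
  rw [coprimeInv]
  split_ifs with h
  · rw [norm_inv, coprime_iff_norm.1 h, inv_one]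
  · simp

lemma coprimePart_add (j l : ℕ) :
    ((coprimePart p (j + p * l) : ℤ) : ℚ_[p]) =
      (coprimePart p j : ℤ) * (1 + (p * l : ℕ) * coprimeInv p j) := by
  have h1 : Nat.Coprime (j + p * l) p ↔ Nat.Coprime j p := by
    rw [Nat.coprime_add_mul_left_left]
  rw [coprimePart, coprimePart, coprimeInv]
  by_cases h : Nat.Coprime j p
  · have h0 := ne_zero_of_norm_eq_one (coprime_iff_norm.1 h)
    rw [if_pos h, if_pos h, if_pos (h1.2 h)]
    push_cast
    field_simp
  · rw [if_neg h, if_neg h, if_neg (mt h1.1 h)]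
    simp

/-- First-order expansion of a product of factors `1 + c w j` with `c` divisible by `p ^ s`. -/
lemma prod_one_add_mul_congr {s : ℕ} {c : ℚ_[p]} (hc : PadicCongr p s c 0) {w : ℕ → ℚ_[p]}
    {n : ℕ} (hw : ∀ j < n, ‖w j‖ ≤ 1) :
    PadicCongr p (s + s) (∏ j ∈ Finset.range n, (1 + c * w j))
      (1 + c * ∑ j ∈ Finset.range n, w j) := by
  induction n with
  | zero => simpa using PadicCongr.refl _
  | succ n ih =>
    have ih := ih fun j hj => hw j (by omega)
    have hn := hw n (Nat.lt_succ_self n)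
    have h0 : ‖1 + c * w n‖ ≤ 1 :=
      norm_add_le_one (by simp) (norm_mul_le_one hc.norm_le_of_zero hn)
    rw [Finset.prod_range_succ, Finset.sum_range_succ]
    refine (ih.mul_right h0).trans ?_
    have h1 : ‖∑ j ∈ Finset.range n, w j‖ ≤ 1 := norm_sum_le_one fun j hj =>
      hw j (Nat.lt_succ_of_lt (Finset.mem_range.1 hj))
    have h2 := (hc.zero_mul hc).zero_mul_le (norm_mul_le_one h1 hn)
    rw [PadicCongr.iff_sub]
    convert h2 using 1
    ring

/-- Power sums of inverses over full periods vanish modulo `p`. -/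
lemma sum_coprimeInv_pow_congr {i : ℕ} (hi : i < p - 1) (x l : ℕ) :
    PadicCongr p 1 (∑ j ∈ Finset.range (p * l), coprimeInv p (x + j) ^ i) 0 := by
  have hp' := (Fact.out : p.Prime)
  have hw : ∀ j, ∃ w : ℤ_[p], (w : ℚ_[p]) = coprimeInv p j ∧
      PadicInt.toZMod w = ((j : ZMod p))⁻¹ := by
    intro j
    obtain ⟨w, hw⟩ := exists_padicInt_coe (norm_coprimeInv_le (p := p) j)
    refine ⟨w, hw, ?_⟩
    by_cases h : Nat.Coprime j p
    · have h0 := ne_zero_of_norm_eq_one (coprime_iff_norm.1 h)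
      have h1 : w * (j : ℤ_[p]) = 1 := by
        apply Subtype.coe_injective
        push_cast
        rw [hw, coprimeInv, if_pos h, inv_mul_cancel₀ h0]
      have h2 := congrArg (PadicInt.toZMod (p := p)) h1
      rw [map_mul, map_natCast, map_one] at h2
      exact eq_inv_of_mul_eq_one_left h2
    · have h1 : w = 0 := by
        apply Subtype.coe_injective
        change (w : ℚ_[p]) = ((0 : ℤ_[p]) : ℚ_[p])
        rw [hw, coprimeInv, if_neg h, PadicInt.coe_zero]
      have h2 : (j : ZMod p) = 0 := by
        rw [ZMod.natCast_eq_zero_iff]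
        by_contra h'
        exact h ((hp'.coprime_iff_not_dvd.2 h').symm)
      rw [h1, h2, map_zero, inv_zero]
  choose w hw1 hw2 using hw
  have hsum : ∀ l : ℕ, ∑ j ∈ Finset.range (p * l), ((x + j : ℕ) : ZMod p)⁻¹ ^ i = 0 := by
    intro l
    induction l with
    | zero => simp
    | succ l ih =>
      rw [mul_add, mul_one, Finset.sum_range_add, ih, zero_add]
      have h1 := sum_range_natCast_zmod p (fun y : ZMod p => y⁻¹ ^ i) (x + p * l)
      simp_rw [← add_assoc]
      rw [h1]
      have h2 := Equiv.sum_comp (Equiv.inv (ZMod p)) (fun y : ZMod p => y ^ i)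
      simp only [Equiv.inv_apply] at h2
      rw [h2]
      exact FiniteField.sum_pow_lt_card_sub_one (ZMod p) i (by rwa [ZMod.card])
  have h3 : PadicInt.toZMod (∑ j ∈ Finset.range (p * l), w (x + j) ^ i) = 0 := by
    rw [map_sum, ← hsum l]
    refine Finset.sum_congr rfl fun j _ => ?_
    rw [map_pow, hw2]
  have h4 : ∑ j ∈ Finset.range (p * l), w (x + j) ^ i ∈ RingHom.ker (PadicInt.toZMod (p := p)) := h3
  rw [PadicInt.ker_toZMod, PadicInt.maximalIdeal_eq_span_p, Ideal.mem_span_singleton] at h4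
  obtain ⟨z, hz⟩ := h4
  refine ⟨z, ?_⟩
  have h5 := congrArg (fun y : ℤ_[p] => (y : ℚ_[p])) hz
  push_cast at h5
  rw [sub_zero, pow_one, ← h5, PadicInt.coe_sum]
  simp_rw [PadicInt.coe_pow]
  exact Finset.sum_congr rfl fun j _ => by rw [hw1]

/-- The quotient of gamma values at natural numbers differing by `h`. -/
noncomputable def gammaBlock (p : ℕ) [Fact p.Prime] (x h : ℕ) : ℚ_[p] :=
  ∏ j ∈ Finset.range h, (-(coprimePart p (x + j) : ℤ) : ℚ_[p])

lemma cast_moritaGammaNat_add (x h : ℕ) :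
    ((moritaGammaNat p (x + h) : ℤ) : ℚ_[p]) =
      (moritaGammaNat p x : ℤ) * gammaBlock p x h := by
  rw [moritaGammaNat_add _ _ _ (Fact.out : p.Prime).ne_one, gammaBlock]
  push_cast
  rfl

lemma norm_gammaBlock (x h : ℕ) : ‖gammaBlock p x h‖ = 1 := by
  have := congrArg norm (cast_moritaGammaNat_add (p := p) x h)
  rw [norm_mul, norm_moritaGammaNat, norm_moritaGammaNat, one_mul] at this
  exact this.symm

lemma gammaBlock_add (x l h : ℕ) :
    gammaBlock p (x + p * l) h =
      gammaBlock p x h * ∏ j ∈ Finset.range h, (1 + (p * l : ℕ) * coprimeInv p (x + j)) := by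
  rw [gammaBlock, gammaBlock, ← Finset.prod_mul_distrib]
  refine Finset.prod_congr rfl fun j _ => ?_
  rw [show x + p * l + j = x + j + p * l by ring, coprimePart_add]
  ring

lemma natCast_mul_congr_zero (l : ℕ) : PadicCongr p 1 ((p * l : ℕ) : ℚ_[p]) 0 :=
  ⟨l, by push_cast; ring⟩

/-- The first-order change of a block over a full period is a sum of inverses, divisible by `p`. -/
lemma gammaBlock_add_congr (hp : 5 ≤ p) (x l : ℕ) :
    PadicCongr p 2 (gammaBlock p (x + p * l) (p * l)) (gammaBlock p x (p * l)) := by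
  rw [gammaBlock_add]
  have h1 := prod_one_add_mul_congr (natCast_mul_congr_zero (p := p) l)
    (n := p * l) (fun j _ => norm_coprimeInv_le (p := p) (x + j))
  have h2 := sum_coprimeInv_pow_congr (p := p) (i := 1) (by omega) x l
  simp only [pow_one] at h2
  have h3 := (PadicCongr.refl (p := p) (r := 2) 1).add ((natCast_mul_congr_zero l).zero_mul h2)
  have h4 := (h1.trans h3).mul_left (norm_gammaBlock (p := p) x (p * l)).le
  simpa using h4

/-- The two neighbours of a block over full periods are its multiples by `∏ (1 ± p l w_j)`, where
the `w_j` are the inverses of its units; the product `∏ (1 - (p l w_j) ^ 2)` is trivial modulo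
`p ^ 3`. -/
lemma gammaBlock_mul_congr (hp : 5 ≤ p) (x l : ℕ) :
    PadicCongr p 3 (gammaBlock p (x + p * l + p * l) (p * l) * gammaBlock p x (p * l))
      (gammaBlock p (x + p * l) (p * l) ^ 2) := by
  have h1 := gammaBlock_add (p := p) (x + p * l) l (p * l)
  have h2 := gammaBlock_add (p := p) x l (p * l)
  have hlow : ∀ j, (1 + ((p * l : ℕ) : ℚ_[p]) * coprimeInv p (x + j)) *
      (1 - ((p * l : ℕ) : ℚ_[p]) * coprimeInv p (x + p * l + j)) = 1 := by
    intro j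
    have h3 := coprimePart_add (p := p) (x + j) l
    have hc : Nat.Coprime (x + j + p * l) p ↔ Nat.Coprime (x + j) p := by
      rw [Nat.coprime_add_mul_left_left]
    rw [show x + p * l + j = x + j + p * l by ring, coprimeInv, coprimeInv]
    by_cases h : Nat.Coprime (x + j) p
    · have h0 := ne_zero_of_norm_eq_one (coprime_iff_norm.1 h)
      have h0' := ne_zero_of_norm_eq_one (coprime_iff_norm.1 (hc.2 h))
      rw [if_pos h, if_pos (hc.2 h)]
      push_cast at h0 h0' ⊢
      field_simp
      ring
    · rw [if_neg h, if_neg (mt hc.1 h)]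
      simp
  have h3 : gammaBlock p x (p * l) = gammaBlock p (x + p * l) (p * l) *
      ∏ j ∈ Finset.range (p * l), (1 - ((p * l : ℕ) : ℚ_[p]) * coprimeInv p (x + p * l + j)) := by
    rw [h2, mul_assoc, ← Finset.prod_mul_distrib, Finset.prod_congr rfl fun j _ => hlow j,
      Finset.prod_const_one, mul_one]
  have h4 : gammaBlock p (x + p * l + p * l) (p * l) * gammaBlock p x (p * l) =
      gammaBlock p (x + p * l) (p * l) ^ 2 * ∏ j ∈ Finset.range (p * l),
        (1 + (-((p * l : ℕ) : ℚ_[p]) ^ 2) * coprimeInv p (x + p * l + j) ^ 2) := by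
    rw [h3, h1]
    have : ∏ j ∈ Finset.range (p * l),
        (1 + (-((p * l : ℕ) : ℚ_[p]) ^ 2) * coprimeInv p (x + p * l + j) ^ 2) =
        (∏ j ∈ Finset.range (p * l), (1 + ((p * l : ℕ) : ℚ_[p]) * coprimeInv p (x + p * l + j))) *
        ∏ j ∈ Finset.range (p * l),
          (1 - ((p * l : ℕ) : ℚ_[p]) * coprimeInv p (x + p * l + j)) := by
      rw [← Finset.prod_mul_distrib]
      exact Finset.prod_congr rfl fun j _ => by ring
    rw [this]
    ring
  rw [h4]
  have hsq : PadicCongr p 2 (-((p * l : ℕ) : ℚ_[p]) ^ 2) 0 := by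
    simpa using ((natCast_mul_congr_zero (p := p) l).zero_pow 2).neg
  have h5 := prod_one_add_mul_congr hsq (n := p * l)
    (fun j _ => norm_pow_le_one (norm_coprimeInv_le (p := p) (x + p * l + j)) 2)
  have h6 := sum_coprimeInv_pow_congr (p := p) (i := 2) (by omega) (x + p * l) l
  have h7 := (PadicCongr.refl (p := p) (r := 3) 1).add (hsq.zero_mul h6)
  have h8 := ((h5.mono (show 3 ≤ 4 by norm_num)).trans h7).mul_left
    (norm_pow_le_one (norm_gammaBlock (p := p) (x + p * l) (p * l)).le 2)
  simpa using h8

/-- Arithmetic progressions with step in `p ℤ_p` are approximated by progressions of natural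
numbers. -/
lemma exists_nat_congr_pair {x h : ℚ_[p]} (hx : ‖x‖ ≤ 1) (hh : PadicCongr p 1 h 0) (r : ℕ) :
    ∃ k l : ℕ, ∀ i : ℕ, PadicCongr p r (x + i * h) ((k + i * (p * l) : ℕ) : ℚ_[p]) := by
  obtain ⟨k, hk⟩ := exists_natCast_congr hx r
  obtain ⟨n, hn⟩ := exists_natCast_congr hh.norm_le_of_zero (r + 1)
  have hn0 := (hn.mono (show 1 ≤ r + 1 by omega)).symm.trans hh
  rw [PadicCongr.zero_iff_lt, Padic.norm_natCast_lt_one_iff] at hn0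
  obtain ⟨l, rfl⟩ := hn0
  refine ⟨k, l, fun i => ?_⟩
  rw [Nat.cast_add, Nat.cast_mul i]
  exact hk.add ((hn.mono (Nat.le_succ r)).mul_left (norm_natCast_le_one i))

/-- The second multiplicative difference of the gamma function along `p ℤ_p`. -/
theorem padicGamma_second_difference (hp : 5 ≤ p) {x h : ℚ_[p]} (hx : ‖x‖ ≤ 1)
    (hh : PadicCongr p 1 h 0) :
    PadicCongr p 2 (padicGamma p (x + h) * padicGamma p (x - h)) (padicGamma p x ^ 2) := by
  have hp2 : p ≠ 2 := by omega
  have hh1 := hh.norm_le_of_zero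
  have hxh : ‖x - h‖ ≤ 1 := norm_sub_le_one hx hh1
  obtain ⟨k, l, hkl⟩ := exists_nat_congr_pair hxh hh 2
  have h0 := padicGamma_congr_nat hp2 (hkl 0)
  have h1 := padicGamma_congr_nat hp2 (hkl 1)
  have h2 := padicGamma_congr_nat hp2 (hkl 2)
  rw [show x - h + ((0 : ℕ) : ℚ_[p]) * h = x - h by simp, zero_mul, add_zero] at h0
  rw [show x - h + ((1 : ℕ) : ℚ_[p]) * h = x by simp, one_mul, cast_moritaGammaNat_add] at h1
  rw [show x - h + ((2 : ℕ) : ℚ_[p]) * h = x + h by push_cast; ring, two_mul, ← add_assoc,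
    cast_moritaGammaNat_add, cast_moritaGammaNat_add] at h2
  have hb := gammaBlock_add_congr hp k l
  have hg := norm_moritaGammaNat (p := p) k
  refine (h2.mul h0 (norm_padicGamma hp2 (norm_add_le_one hx hh1)).le hg.le).trans ?_
  refine PadicCongr.trans ?_ (h1.pow (norm_padicGamma hp2 hx).le 2).symm
  have := (hb.mul_left (norm_gammaBlock (p := p) k (p * l)).le).mul_left (norm_pow_le_one hg.le 2)
  convert this using 1 <;> ring

/-- The third multiplicative difference of the gamma function along `p ℤ_p`. -/
theorem padicGamma_third_difference (hp : 5 ≤ p) {x h : ℚ_[p]} (hx : ‖x‖ ≤ 1)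
    (hh : PadicCongr p 1 h 0) :
    PadicCongr p 3 (padicGamma p (x + 2 * h) * padicGamma p x ^ 3)
      (padicGamma p (x - h) * padicGamma p (x + h) ^ 3) := by
  have hp2 : p ≠ 2 := by omega
  have hh1 := hh.norm_le_of_zero
  have hxh : ‖x - h‖ ≤ 1 := norm_sub_le_one hx hh1
  have hxh' : ‖x + h‖ ≤ 1 := norm_add_le_one hx hh1
  have hxh2 : ‖x + 2 * h‖ ≤ 1 := by
    rw [two_mul, ← add_assoc]; exact norm_add_le_one hxh' hh1
  obtain ⟨k, l, hkl⟩ := exists_nat_congr_pair hxh hh 3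
  have h0 := padicGamma_congr_nat hp2 (hkl 0)
  have h1 := padicGamma_congr_nat hp2 (hkl 1)
  have h2 := padicGamma_congr_nat hp2 (hkl 2)
  have h3 := padicGamma_congr_nat hp2 (hkl 3)
  rw [show x - h + ((0 : ℕ) : ℚ_[p]) * h = x - h by simp, zero_mul, add_zero] at h0
  rw [show x - h + ((1 : ℕ) : ℚ_[p]) * h = x by simp, one_mul, cast_moritaGammaNat_add] at h1
  rw [show x - h + ((2 : ℕ) : ℚ_[p]) * h = x + h by push_cast; ring, two_mul, ← add_assoc,
    cast_moritaGammaNat_add, cast_moritaGammaNat_add] at h2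
  rw [show x - h + ((3 : ℕ) : ℚ_[p]) * h = x + 2 * h by push_cast; ring,
    show k + 3 * (p * l) = k + p * l + p * l + p * l by ring,
    cast_moritaGammaNat_add, cast_moritaGammaNat_add, cast_moritaGammaNat_add] at h3
  have hb := gammaBlock_mul_congr hp k l
  have hg := norm_moritaGammaNat (p := p) k
  have hb0 := norm_gammaBlock (p := p) k (p * l)
  have hb1 := norm_gammaBlock (p := p) (k + p * l) (p * l)
  refine (h3.mul (h1.pow (norm_padicGamma hp2 hx).le 3) (norm_padicGamma hp2 hxh2).le
    (norm_pow_le_one (norm_mul_le_one hg.le hb0.le) 3)).trans ?_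
  refine PadicCongr.trans ?_ (h0.mul (h2.pow (norm_padicGamma hp2 hxh').le 3)
    (norm_padicGamma hp2 hxh).le (norm_pow_le_one
      (norm_mul_le_one (norm_mul_le_one hg.le hb0.le) hb1.le) 3)).symm
  have := hb.mul_left (norm_mul_le_one (norm_mul_le_one (norm_pow_le_one hg.le 4)
    (norm_pow_le_one hb0.le 3)) hb1.le)
  convert this using 1 <;> ring

end GammaDifference

/-! ### The sums with modulus `p ^ 4` -/

section FourthPower

variable {p : ℕ} [Fact p.Prime] {N : ℕ}

/-- `3 x - x ^ 3 - 2 = -(x - 1) ^ 2 (x + 2)`. -/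
lemma PadicCongr.three_mul_sub_cube {x : ℚ_[p]} (h : PadicCongr p 2 x 1) :
    PadicCongr p 4 (3 * x - x ^ 3) 2 := by
  have h1 : ‖x‖ ≤ 1 := h.symm.norm_le (by simp)
  have h0 := PadicCongr.iff_sub.1 h
  have h2 := (h0.zero_mul h0).zero_mul_le (x := -(x + 2))
    (by rw [norm_neg]; exact norm_add_le_one h1 (by exact_mod_cast norm_natCast_le_one (p := p) 2))
  rw [PadicCongr.iff_sub]
  convert h2 using 1
  ring

/-- The duplication congruence `Γ(2h) ≡ Γ(h)^2`. -/
lemma padicGamma_two_mul_congr (hp : 5 ≤ p) {h : ℚ_[p]} (hh : PadicCongr p 1 h 0) :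
    PadicCongr p 3 (padicGamma p (2 * h)) (padicGamma p h ^ 2) := by
  have hp2 : p ≠ 2 := by omega
  have h1 := padicGamma_third_difference hp (x := 0) (by simp) hh
  have hpp : PadicCongr p 1 h (p : ℕ) := hh.trans PadicCongr.p_zero.symm
  have h2 := padicGamma_reflect hp2 (by omega) le_rfl hpp
  rw [((Fact.out : p.Prime).odd_of_ne_two hp2).neg_one_pow] at h2
  have h3 := padicGamma_add_one_of_congr hp2 (x := -h) (by simpa using hh.neg)
  rw [neg_add_eq_sub] at h3
  rw [h3] at h2
  rw [padicGamma_zero hp2, zero_add, zero_sub, zero_add, one_pow, mul_one] at h1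
  refine h1.trans (PadicCongr.of_eq ?_)
  linear_combination (-padicGamma p h ^ 2) * h2

/-- The value of the gamma function after two steps of size `h`, through those after at most one
step. -/
lemma padicGamma_two_steps (hp : 5 ≤ p) {x h : ℚ_[p]} (hx : ‖x‖ ≤ 1) (hh : PadicCongr p 1 h 0) :
    PadicCongr p 3 (padicGamma p (x + 2 * h))
      (padicGamma p (x - h) * padicGamma p (x + h) ^ 3 / padicGamma p x ^ 3) := by
  have hp2 : p ≠ 2 := by omega
  have hg := norm_padicGamma hp2 hx
  have h0 := padicGamma_ne_zero hp2 hx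
  refine PadicCongr.cancel_left (c := padicGamma p x ^ 3) (by rw [norm_pow, hg, one_pow]) ?_
  rw [mul_div_cancel₀ _ (pow_ne_zero 3 h0), mul_comm]
  exact padicGamma_third_difference hp hx hh

/-- The second difference, written as a quotient. -/
lemma padicGamma_ratio_congr (hp : 5 ≤ p) {x h : ℚ_[p]} (hx : ‖x‖ ≤ 1) (hh : PadicCongr p 1 h 0) :
    PadicCongr p 2 (padicGamma p (x + h) * padicGamma p (x - h) / padicGamma p x ^ 2) 1 := by
  have hp2 : p ≠ 2 := by omega
  have hg := norm_padicGamma hp2 hx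
  have h0 := padicGamma_ne_zero hp2 hx
  refine PadicCongr.cancel_left (c := padicGamma p x ^ 2) (by rw [norm_pow, hg, one_pow]) ?_
  rw [mul_div_cancel₀ _ (pow_ne_zero 2 h0), mul_one]
  exact padicGamma_second_difference hp hx hh

namespace TerminatingData

variable {m : ℕ} {a : ℚ_[p]} (S : TerminatingData p m N a)
include S

lemma norm_two_mul_add {j : ℕ} (hj : j < N) : ‖2 * a + j‖ = 1 := by
  have h1 := S.eq
  have h2 := S.one_lt
  have h4 : m * (j + 1) ≤ m * N := Nat.mul_le_mul_left m hj
  rw [mul_add, mul_one] at h4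
  have h3 := norm_natCast_div_add_eq_one (p := p) (m := m) (i := 2) (j := j) (by omega) S.lt
    (by omega) (by omega)
  rw [S.def_a]
  convert h3 using 2
  push_cast; ring

lemma norm_one_add {j : ℕ} (hj : j < N) : ‖(1 + j : ℚ_[p])‖ = 1 :=
  norm_one_add_natCast_eq_one (by have := S.two_mul_lt; omega)

lemma norm_a : ‖a‖ ≤ 1 := by
  have := (S.norm_add S.pos).le
  rwa [Nat.cast_zero, add_zero] at this

end TerminatingData

/-- The sum of fourth powers for `a = 1 / 4`: the two perturbed sums are, modulo `p ^ 4`, the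
claimed value times `ρ` and `ρ ^ 3`, where `ρ` is the second difference of the gamma function, and
`3 ρ - ρ ^ 3 ≡ 2` because `ρ ≡ 1` modulo `p ^ 2`. -/
theorem sum_fourth_quarter_congr (S : TerminatingData p 4 N (1 / 4 : ℚ_[p])) :
    PadicCongr p 4 (∑ n ∈ Finset.range (N + 1), (2 * (4 : ℕ) * n + 1) *
      (pochhammer (1 / 4 : ℚ_[p]) n ^ 4 / pochhammer (1 : ℚ_[p]) n ^ 4))
      (p * padicGamma p (1 / 2) * padicGamma p (1 / 4) / padicGamma p (3 / 4)) := by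
  have hpN := S.eq
  have hNpos := S.pos
  have hp5 : 5 ≤ p := by omega
  have hp2 : p ≠ 2 := by omega
  have hkey := two_mul_sum_congr_perturbedSum (q := 1) (s := 1) S.mul_eq_one S.add_congr
    (fun j hj => S.norm_add hj) S.lt' (by norm_num)
  set a : ℚ_[p] := 1 / 4 with ha
  set h : ℚ_[p] := a + N with hh
  have hh0 : PadicCongr p 1 h 0 := S.add_congr
  have hh1 := hh0.norm_le_of_zero
  have ha1 := S.norm_a
  have h2h0 : PadicCongr p 1 (2 * h) 0 := by rw [two_mul]; simpa using hh0.add hh0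
  rw [S.perturbedSum_one S.one_sub_ne_zero
      (fun j => by rw [sub_zero, add_comm]; exact Nat.cast_add_one_ne_zero j),
    S.perturbedSum_one (fun j => by rw [sub_neg_eq_add]; exact S.one_add_ne_zero j)
      (fun j => S.ne_zero (z := 0) (t := -2) (by decide) (1 + j)
        (by push_cast; ring))] at hkey
  have e1 : pochhammer (1 - h) N = (-1) ^ N * pochhammer a N := pochhammer_one_sub_add a N
  have e2 : pochhammer (1 - a - h - 0) N = (-1) ^ N * pochhammer (2 * a) N := by
    rw [pochhammer_reflect]; congr 2; rw [hh]; ring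
  have e3 : pochhammer (1 - a - -h - 2 * h) N = (-1) ^ N * pochhammer (2 * a) N := by
    rw [pochhammer_reflect]; congr 2; rw [hh]; ring
  have e4 : pochhammer (1 - 2 * h) N = (-1) ^ N * pochhammer (a + h) N := by
    rw [pochhammer_reflect]; congr 2; rw [hh]; ring
  rw [e1, e2, e3, e4, sub_zero, sub_neg_eq_add] at hkey
  -- The rising factorials as gamma quotients.
  have f1 : pochhammer a N = (-1) ^ N * (padicGamma p h / padicGamma p a) :=
    pochhammer_eq_padicGamma hp2 ha1 fun j hj => S.norm_add hj
  have f2 : pochhammer (2 * a) N =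
      (-1) ^ N * (padicGamma p (a + h) / padicGamma p (2 * a)) := by
    rw [pochhammer_eq_padicGamma hp2 ?_ fun j hj => S.norm_two_mul_add hj]
    · congr 3; rw [hh]; ring
    · exact norm_mul_le_one (by exact_mod_cast norm_natCast_le_one (p := p) 2) ha1
  have f3 : pochhammer (1 : ℚ_[p]) N = (-1) ^ N * (padicGamma p (1 - (a - h)) / -1) := by
    rw [pochhammer_eq_padicGamma hp2 (by simp) fun j hj => S.norm_one_add hj, padicGamma_one hp2]
    congr 3; rw [hh]; ring
  have f4 : pochhammer (1 + h) N =
      (-1) ^ N * (padicGamma p (1 - (a - 2 * h)) / -padicGamma p h) := by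
    rw [pochhammer_eq_padicGamma hp2 (norm_add_le_one (by simp) hh1) fun j hj => ?_, add_comm 1 h,
      padicGamma_add_one_of_congr hp2 hh0]
    · congr 3; rw [hh, ha]; ring
    · rw [add_right_comm]; exact norm_add_eq_one hh0 (S.norm_one_add hj)
  have f5 : pochhammer (a + h) N =
      (-1) ^ N * (padicGamma p (2 * h) / padicGamma p (a + h)) := by
    rw [pochhammer_eq_padicGamma hp2 (norm_add_le_one ha1 hh1) fun j hj => ?_]
    · congr 3; rw [hh]; ring
    · rw [add_right_comm]; exact norm_add_eq_one hh0 (S.norm_add hj)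
  -- The reflection formula at `a`, `a - h`, `a - 2 h`; they are congruent to `3 N + 1`.
  have ha3 : PadicCongr p 1 a ((3 * N + 1 : ℕ) : ℚ_[p]) := by
    have := hh0.mul_left (c := -3) (by
      rw [norm_neg]; exact_mod_cast norm_natCast_le_one (p := p) 3)
    rw [PadicCongr.iff_sub]
    convert this using 1
    · rw [hh, ha]; push_cast; ring
    · ring
  have r0 := padicGamma_reflect hp2 (by omega) (by omega) ha3
  have hm1 : PadicCongr p 1 (a - h) ((3 * N + 1 : ℕ) : ℚ_[p]) := by simpa using ha3.sub hh0
  have hm2 : PadicCongr p 1 (a - 2 * h) ((3 * N + 1 : ℕ) : ℚ_[p]) := by simpa using ha3.sub h2h0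
  have r1 := padicGamma_reflect hp2 (by omega) (by omega) hm1
  have r2 := padicGamma_reflect hp2 (by omega) (by omega) hm2
  have hhalf : PadicCongr p 1 (2 * a) ((2 * N + 1 : ℕ) : ℚ_[p]) := by
    have := h2h0.neg
    rw [PadicCongr.iff_sub]
    convert this using 1
    · rw [hh, ha]; push_cast; ring
    · ring
  have rh := padicGamma_reflect hp2 (by omega) (by omega) hhalf
  rw [show 1 - 2 * a = 2 * a by rw [ha]; norm_num, pow_succ, pow_mul, neg_one_sq, one_pow,
    one_mul] at rh
  have n0 := padicGamma_ne_zero hp2 ha1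
  have nm1' : ‖a - h‖ ≤ 1 := norm_sub_le_one ha1 hh1
  have np1' : ‖a + h‖ ≤ 1 := norm_add_le_one ha1 hh1
  have nm1 := padicGamma_ne_zero hp2 nm1'
  have nm2' := hm2.symm.norm_le (norm_natCast_le_one _)
  have nm2 := padicGamma_ne_zero hp2 nm2'
  have nh := padicGamma_ne_zero hp2 hh1
  have n2h := padicGamma_ne_zero hp2 h2h0.norm_le_of_zero
  have c1 := padicGamma_ratio_congr hp5 ha1 hh0
  have c2 := padicGamma_two_mul_congr hp5 hh0
  have c3 := padicGamma_two_steps hp5 ha1 (h := -h) (by simpa using hh0.neg)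
  rw [show a + 2 * -h = a - 2 * h by ring, sub_neg_eq_add, ← sub_eq_add_neg] at c3
  have b0 := norm_padicGamma hp2 ha1
  have bp1 := norm_padicGamma hp2 np1'
  have bh := norm_padicGamma hp2 hh1
  have b2h := norm_padicGamma hp2 h2h0.norm_le_of_zero
  have bm2 := norm_padicGamma hp2 nm2'
  have hhalf1 : ‖2 * a‖ ≤ 1 := hhalf.symm.norm_le (norm_natCast_le_one _)
  have br := norm_padicGamma hp2 hhalf1
  have nr := padicGamma_ne_zero hp2 hhalf1
  rw [show (1 / 2 : ℚ_[p]) = 2 * a by rw [ha]; norm_num,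
    show (3 / 4 : ℚ_[p]) = 1 - a by rw [ha]; norm_num]
  have hσ : ((-1 : ℚ_[p]) ^ (3 * N + 1)) ^ 2 = 1 := by
    rw [← pow_mul, mul_comm, pow_mul, neg_one_sq, one_pow]
  have hσ1 : ‖(-1 : ℚ_[p]) ^ (3 * N + 1)‖ = 1 := by simp
  have hε1 : ((-1 : ℚ_[p]) ^ N) ≠ 0 := by simp
  have hσ0 : ((-1 : ℚ_[p]) ^ (3 * N + 1)) ≠ 0 := by simp
  rw [f1, f2, f3, f4, f5] at hkey
  generalize ((-1 : ℚ_[p]) ^ (3 * N + 1)) = σ at *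
  generalize ((-1 : ℚ_[p]) ^ N) = ε at *
  generalize padicGamma p (1 - a) = g0' at *
  generalize padicGamma p (1 - (a - h)) = gm1' at *
  generalize padicGamma p (1 - (a - 2 * h)) = gm2' at *
  generalize padicGamma p a = g0 at *
  generalize padicGamma p (a - h) = gm1 at *
  generalize padicGamma p (a - 2 * h) = gm2 at *
  generalize padicGamma p (a + h) = g1 at *
  generalize padicGamma p h = d1 at *
  generalize padicGamma p (2 * h) = d2 at *
  generalize padicGamma p (2 * a) = r at *
  obtain rfl : g0' = σ / g0 := by rw [← r0]; field_simp
  obtain rfl : gm1' = σ / gm1 := by rw [← r1]; field_simp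
  obtain rfl : gm2' = σ / gm2 := by rw [← r2]; field_simp
  have hσi : 1 / σ = σ := by rw [div_eq_iff hσ0, ← hσ, sq]
  have hri : 1 / r = -r := by rw [div_eq_iff nr]; linear_combination rh
  -- `ρ` is the second difference of the gamma function at `a`.
  set ρ : ℚ_[p] := g1 * gm1 / g0 ^ 2 with hρ
  have t1 : ε * (d1 / g0) * (ε * (ε * (g1 / r))) /
      (ε * (ε * (d1 / g0)) * (ε * (σ / gm1 / -1))) = σ * r * g0 ^ 2 * ρ := by
    have : ε * (d1 / g0) * (ε * (ε * (g1 / r))) /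
      (ε * (ε * (d1 / g0)) * (ε * (σ / gm1 / -1))) = -(1 / σ) * (1 / r) * (g1 * gm1) := by
      field_simp
    rw [this, hσi, hri, hρ]
    field_simp
  have t2 : ε * (d1 / g0) * (ε * (ε * (g1 / r))) /
      (ε * (σ / gm2 / -d1) * (ε * (ε * (d2 / g1)))) =
      σ * r * (g1 ^ 2 * gm2 / g0) * (d1 ^ 2 / d2) := by
    have : ε * (d1 / g0) * (ε * (ε * (g1 / r))) /
      (ε * (σ / gm2 / -d1) * (ε * (ε * (d2 / g1)))) =
        -(1 / σ) * (1 / r) * (g1 ^ 2 * gm2 / g0) * (d1 ^ 2 / d2) := by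
      field_simp
    rw [this, hσi, hri]
    ring
  rw [t1, t2] at hkey
  have hd : PadicCongr p 3 (d1 ^ 2 / d2) 1 := by
    have := c2.symm.div (PadicCongr.refl d2) (by rw [norm_pow, bh, one_pow]) b2h b2h
    rwa [div_self n2h] at this
  have hq : PadicCongr p 3 (g1 ^ 2 * gm2 / g0) (g0 ^ 2 * ρ ^ 3) := by
    have := (c3.mul_left (c := g1 ^ 2) (by rw [norm_pow, bp1, one_pow])).mul_right (c := g0⁻¹)
      (by rw [norm_inv, b0, inv_one])
    rw [← div_eq_mul_inv] at this
    refine this.trans (PadicCongr.of_eq ?_)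
    rw [hρ]
    field_simp
  have hq2 := (hq.mul_left (c := σ * r) (by rw [norm_mul, hσ1, br, one_mul])).mul hd
    (by simp [hσ1, br, bp1, bm2, b0]) (by simp)
  have hfin : PadicCongr p 3 (3 * (σ * r * g0 ^ 2 * ρ) -
      σ * r * (g1 ^ 2 * gm2 / g0) * (d1 ^ 2 / d2)) (2 * (σ * r * g0 ^ 2)) := by
    refine ((PadicCongr.refl _).sub hq2).trans ?_
    have := (c1.three_mul_sub_cube.mono (show 3 ≤ 4 by norm_num)).mul_left
      (c := σ * r * g0 ^ 2) (by simp [hσ1, br, b0])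
    convert this using 1 <;> ring
  have hfin2 := PadicCongr.p_zero.mul_of_zero hfin
  have hp2' : ‖(2 : ℚ_[p])‖ = 1 := by
    exact_mod_cast norm_natCast_eq_one (p := p) (n := 2) two_pos (by omega)
  refine PadicCongr.cancel_left (c := 2) hp2' ?_
  have e : 2 * ((p : ℚ_[p]) * r * g0 / (σ / g0)) = p * (2 * (σ * r * g0 ^ 2)) := by
    have : (p : ℚ_[p]) * r * g0 / (σ / g0) = p * r * g0 ^ 2 * (1 / σ) := by field_simp
    rw [this, hσi]; ring
  rw [e]
  have hkey' := hkey.trans ((PadicCongr.of_eq (by ring)).trans hfin2)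
  simpa only [one_pow, mul_one, div_pow] using hkey'

end FourthPower

section SixthPower

variable {p : ℕ} [Fact p.Prime] {N : ℕ}

lemma perturbedSum_swap (m N q : ℕ) (a s β γ δ : ℚ_[p]) :
    perturbedSum m N q a s β γ δ = perturbedSum m N q a s β δ γ := by
  refine Finset.sum_congr rfl fun n _ => ?_
  rw [wellPoisedFactor, wellPoisedFactor]
  ring

/-- The sum of sixth powers for `a = 1 / 3`: the two perturbed sums are, modulo `p ^ 4`, the claimed
value times the third and the ninth power of the second difference `ρ` of the gamma function, and
`3 ρ ^ 3 - ρ ^ 9 ≡ 2` because `ρ ≡ 1` modulo `p ^ 2`. -/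
theorem sum_sixth_third_congr (S : TerminatingData p 3 N (1 / 3 : ℚ_[p])) :
    PadicCongr p 4 (∑ n ∈ Finset.range (N + 1), (2 * (3 : ℕ) * n + 1) *
      (pochhammer (1 / 3 : ℚ_[p]) n ^ 6 / pochhammer (1 : ℚ_[p]) n ^ 6))
      (-(p : ℚ_[p]) * padicGamma p (1 / 3) ^ 9) := by
  have hpN := S.eq
  have hNpos := S.pos
  have hp2 : p ≠ 2 := by omega
  have hN : Even N := by
    have := (Fact.out : p.Prime).odd_of_ne_two hp2
    rw [Nat.odd_iff] at this
    rw [Nat.even_iff]; omega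
  have hp5 : 5 ≤ p := by rw [Nat.even_iff] at hN; omega
  have hkey := two_mul_sum_congr_perturbedSum (q := 3) (s := 1) S.mul_eq_one S.add_congr
    (fun j hj => S.norm_add hj) S.lt' (by norm_num)
  set a : ℚ_[p] := 1 / 3 with ha
  set h : ℚ_[p] := a + N with hh
  have hh0 : PadicCongr p 1 h 0 := S.add_congr
  have hh1 := hh0.norm_le_of_zero
  have ha1 := S.norm_a
  have h2h0 : PadicCongr p 1 (2 * h) 0 := by rw [two_mul]; simpa using hh0.add hh0
  have ha2 : ∀ j : ℤ, 2 * a + j ≠ 0 := fun j =>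
    S.ne_zero (z := 2) (t := 0) (by decide) j (by rw [ha]; push_cast; ring)
  have hs1 : perturbedSum 3 N 3 a 1 (-h) h 0 = perturbedSum 3 N 3 a 1 (-h) 0 (h - 0) := by
    rw [perturbedSum_swap, sub_zero]
  have hs2 : perturbedSum 3 N 3 a 1 (-h) (-h) (2 * h) =
      perturbedSum 3 N 3 a 1 (-h) (-h) (h - -h) := by
    congr 1; ring
  rw [hs1, hs2, S.perturbedSum_three rfl
      (fun j => by rw [sub_zero, add_comm]; exact Nat.cast_add_one_ne_zero j)
      (fun j => by rw [add_zero]; exact ha2 j) (fun j => by rw [sub_zero]; exact ha2 j),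
    S.perturbedSum_three rfl (fun j => by rw [sub_neg_eq_add]; exact S.one_add_ne_zero j)
      (fun j => S.ne_zero (z := 2) (t := -1) (by decide) j (by rw [ha]; push_cast; ring))
      (fun j => ?_)] at hkey
  swap
  -- Here `2 a + h = N + 1`.
  · have : 2 * a - -h + (j : ℚ_[p]) = ((N + j : ℕ) : ℚ_[p]) + 1 := by
      rw [hh, ha]; push_cast; ring
    rw [this]
    exact Nat.cast_add_one_ne_zero _
  rw [sub_zero, sub_zero, sub_zero, sub_neg_eq_add, sub_neg_eq_add, sub_neg_eq_add] at hkey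
  -- The rising factorials as gamma quotients.
  have f1 : pochhammer a N = padicGamma p h / padicGamma p a := by
    rw [pochhammer_eq_padicGamma hp2 ha1 fun j hj => S.norm_add hj, hN.neg_one_pow, one_mul]
  have f2 : pochhammer (2 * a) N = padicGamma p (a + h) / padicGamma p (1 - a) := by
    rw [pochhammer_eq_padicGamma hp2 ?_ fun j hj => S.norm_two_mul_add hj, hN.neg_one_pow, one_mul]
    · congr 2
      · rw [hh]; ring
      · rw [ha]; norm_num
    · exact norm_mul_le_one (by exact_mod_cast norm_natCast_le_one (p := p) 2) ha1
  have f3 : pochhammer (1 : ℚ_[p]) N = padicGamma p (1 - (a - h)) / -1 := by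
    rw [pochhammer_eq_padicGamma hp2 (by simp) fun j hj => S.norm_one_add hj, padicGamma_one hp2,
      hN.neg_one_pow, one_mul]
    congr 2; rw [hh]; ring
  have f4 : pochhammer (1 + h) N = padicGamma p (1 - (a - 2 * h)) / -padicGamma p h := by
    rw [pochhammer_eq_padicGamma hp2 (norm_add_le_one (by simp) hh1) fun j hj => ?_, add_comm 1 h,
      padicGamma_add_one_of_congr hp2 hh0, hN.neg_one_pow, one_mul]
    · congr 2; rw [hh, ha]; ring
    · rw [add_right_comm]; exact norm_add_eq_one hh0 (S.norm_one_add hj)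
  have f5 : pochhammer (a + h) N = padicGamma p (2 * h) / padicGamma p (a + h) := by
    rw [pochhammer_eq_padicGamma hp2 (norm_add_le_one ha1 hh1) fun j hj => ?_, hN.neg_one_pow,
      one_mul]
    · congr 2; rw [hh]; ring
    · rw [add_right_comm]; exact norm_add_eq_one hh0 (S.norm_add hj)
  have f6 : pochhammer (2 * a + h) N = padicGamma p (a + 2 * h) / padicGamma p (1 - (a - h)) := by
    rw [pochhammer_eq_padicGamma hp2 ?_ fun j hj => ?_, hN.neg_one_pow, one_mul]
    · congr 2
      · rw [hh]; ring
      · rw [hh, ha]; ring_nf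
    · exact norm_add_le_one
        (norm_mul_le_one (by exact_mod_cast norm_natCast_le_one (p := p) 2) ha1) hh1
    · rw [add_right_comm]; exact norm_add_eq_one hh0 (S.norm_two_mul_add hj)
  -- The reflection formula at `a`, `a - h`, `a - 2 h`; they are congruent to `2 N + 1`.
  have ha3 : PadicCongr p 1 a ((2 * N + 1 : ℕ) : ℚ_[p]) := by
    have := h2h0.neg
    rw [PadicCongr.iff_sub]
    convert this using 1
    · rw [hh, ha]; push_cast; ring
    · ring
  have r0 := padicGamma_reflect hp2 (by omega) (by omega) ha3
  have hm1 : PadicCongr p 1 (a - h) ((2 * N + 1 : ℕ) : ℚ_[p]) := by simpa using ha3.sub hh0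
  have hm2 : PadicCongr p 1 (a - 2 * h) ((2 * N + 1 : ℕ) : ℚ_[p]) := by simpa using ha3.sub h2h0
  have r1 := padicGamma_reflect hp2 (by omega) (by omega) hm1
  have r2 := padicGamma_reflect hp2 (by omega) (by omega) hm2
  have hσ : ((-1 : ℚ_[p]) ^ (2 * N + 1)) = -1 := Odd.neg_one_pow ⟨N, rfl⟩
  rw [hσ] at r0 r1 r2
  have n0 := padicGamma_ne_zero hp2 ha1
  have nm1' : ‖a - h‖ ≤ 1 := norm_sub_le_one ha1 hh1
  have np1' : ‖a + h‖ ≤ 1 := norm_add_le_one ha1 hh1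
  have np2' : ‖a + 2 * h‖ ≤ 1 := norm_add_le_one ha1 h2h0.norm_le_of_zero
  have nm1 := padicGamma_ne_zero hp2 nm1'
  have nm2' := hm2.symm.norm_le (norm_natCast_le_one _)
  have nm2 := padicGamma_ne_zero hp2 nm2'
  have nh := padicGamma_ne_zero hp2 hh1
  have n2h := padicGamma_ne_zero hp2 h2h0.norm_le_of_zero
  have c1 := padicGamma_ratio_congr hp5 ha1 hh0
  have c2 := padicGamma_two_mul_congr hp5 hh0
  have c3 := padicGamma_two_steps hp5 ha1 (h := -h) (by simpa using hh0.neg)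
  rw [show a + 2 * -h = a - 2 * h by ring, sub_neg_eq_add, ← sub_eq_add_neg] at c3
  have c4 := padicGamma_two_steps hp5 ha1 hh0
  have b0 := norm_padicGamma hp2 ha1
  have bp1 := norm_padicGamma hp2 np1'
  have bp2 := norm_padicGamma hp2 np2'
  have bm1 := norm_padicGamma hp2 nm1'
  have bh := norm_padicGamma hp2 hh1
  have b2h := norm_padicGamma hp2 h2h0.norm_le_of_zero
  have bm2 := norm_padicGamma hp2 nm2'
  rw [f1, f2, f3, f4, f5, f6] at hkey
  clear f1 f2 f3 f4 f5 f6
  generalize padicGamma p (1 - a) = g0' at *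
  generalize padicGamma p (1 - (a - h)) = gm1' at *
  generalize padicGamma p (1 - (a - 2 * h)) = gm2' at *
  generalize padicGamma p a = g0 at *
  generalize padicGamma p (a - h) = gm1 at *
  generalize padicGamma p (a - 2 * h) = gm2 at *
  generalize padicGamma p (a + h) = g1 at *
  generalize padicGamma p (a + 2 * h) = g2 at *
  generalize padicGamma p h = d1 at *
  generalize padicGamma p (2 * h) = d2 at *
  obtain rfl : g0' = -1 / g0 := by rw [← r0]; field_simp
  obtain rfl : gm1' = -1 / gm1 := by rw [← r1]; field_simp
  obtain rfl : gm2' = -1 / gm2 := by rw [← r2]; field_simp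
  -- `ρ` is the second difference of the gamma function at `a`.
  set ρ : ℚ_[p] := g1 * gm1 / g0 ^ 2 with hρ
  have t1 : d1 / g0 * (g1 / (-1 / g0)) * (g1 / (-1 / g0)) ^ 2 /
      ((-1 / gm1 / -1) ^ 2 * (-1 / gm1 / -1) * (d1 / g0)) = -g0 ^ 9 * ρ ^ 3 := by
    rw [hρ]; field_simp
  have t2 : d1 / g0 * (g1 / (-1 / g0)) * (g2 / (-1 / gm1)) ^ 2 /
      ((-1 / gm1 / -1) ^ 2 * (-1 / gm2 / -d1) * (d2 / g1)) =
      -(g1 ^ 2 * gm1 ^ 4) * g2 ^ 2 * gm2 * (d1 ^ 2 / d2) := by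
    field_simp
  rw [t1, t2] at hkey
  have hd : PadicCongr p 3 (d1 ^ 2 / d2) 1 := by
    have := c2.symm.div (PadicCongr.refl d2) (by rw [norm_pow, bh, one_pow]) b2h b2h
    rwa [div_self n2h] at this
  have hq : PadicCongr p 3 (-(g1 ^ 2 * gm1 ^ 4) * g2 ^ 2 * gm2 * (d1 ^ 2 / d2))
      (-g0 ^ 9 * (ρ ^ 3) ^ 3) := by
    have h1 := (((c4.pow bp2.le 2).mul_left (c := -(g1 ^ 2 * gm1 ^ 4)) (by simp [bp1, bm1])).mul c3
      (by simp [bp1, bm1, bp2]) (by simp [bp1, bm1, b0])).mul hd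
      (by simp [bp1, bm1, bp2, bm2]) (by simp)
    refine h1.trans (PadicCongr.of_eq ?_)
    rw [hρ]; field_simp
  have hρ1 : ‖ρ‖ ≤ 1 := by rw [hρ]; simp [bp1, bm1, b0]
  have hρ3 := c1.pow hρ1 3
  rw [one_pow] at hρ3
  have hfin : PadicCongr p 3 (3 * (-g0 ^ 9 * ρ ^ 3) -
      -(g1 ^ 2 * gm1 ^ 4) * g2 ^ 2 * gm2 * (d1 ^ 2 / d2)) (2 * -g0 ^ 9) := by
    refine ((PadicCongr.refl _).sub hq).trans ?_
    have := (hρ3.three_mul_sub_cube.mono (show 3 ≤ 4 by norm_num)).mul_left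
      (c := -g0 ^ 9) (by simp [b0])
    convert this using 1 <;> ring
  have hfin2 := PadicCongr.p_zero.mul_of_zero hfin
  have hp2' : ‖(2 : ℚ_[p])‖ = 1 := by
    exact_mod_cast norm_natCast_eq_one (p := p) (n := 2) two_pos (by omega)
  refine PadicCongr.cancel_left (c := 2) hp2' ?_
  have hkey' := hkey.trans ((PadicCongr.of_eq (by ring)).trans hfin2)
  refine PadicCongr.trans ?_ (hkey'.trans (PadicCongr.of_eq (by ring)))
  simpa only [one_pow, mul_one, div_pow] using PadicCongr.refl _

end SixthPower

/-! ### The sum of cubes without prefactor -/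

section CubeSum

/-- The sum `₃F₂(1 / 2, -N, N + 1; 1, 1; 1)`: two of the three parameters `1 / 2` of the sum of
cubes are replaced by `-N` and `N + 1`. -/
noncomputable def legendreSum (K : Type*) [Field K] (N : ℕ) : K :=
  ∑ k ∈ Finset.range (N + 1), pochhammer (1 / 2 : K) k * pochhammer (-(N : K)) k *
    pochhammer (N + 1 : K) k / (pochhammer 1 k : K) ^ 3

lemma legendreSum_odd {K : Type*} [Field K] [CharZero K] (L : ℕ) :
    legendreSum K (2 * L + 1) = 0 := by
  induction L with
  | zero =>
    simp [legendreSum, Finset.sum_range_succ, pochhammer_succ, pochhammer_zero]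
    norm_num
  | succ L ih =>
    have h := sum_whipple_step (K := K) (2 * L + 1)
    rw [legendreSum] at ih ⊢
    rw [ih, mul_zero] at h
    exact h

lemma legendreSum_even {K : Type*} [Field K] [CharZero K] (M : ℕ) :
    legendreSum K (2 * M) = (pochhammer (1 / 2) M / pochhammer 1 M) ^ 2 := by
  induction M with
  | zero => simp [legendreSum, pochhammer_zero]
  | succ M ih =>
    have h := sum_whipple_step (K := K) (2 * M)
    rw [legendreSum] at ih ⊢
    rw [ih] at h
    refine h.trans ?_
    rw [pochhammer_succ, pochhammer_succ, mul_div_mul_comm, mul_pow, mul_comm]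
    congr 1
    have h1 : (M : K) + 1 ≠ 0 := Nat.cast_add_one_ne_zero M
    have h2 : (1 : K) + M ≠ 0 := by rwa [add_comm]
    push_cast
    rw [← div_pow]
    congr 1
    field_simp
    ring

variable {p : ℕ} [Fact p.Prime] {N : ℕ}

/-- The sum of the inverse squares of the factors of a rising factorial. -/
noncomputable def invSquareSum (a : ℚ_[p]) (n : ℕ) : ℚ_[p] :=
  ∑ j ∈ Finset.range n, (a + j)⁻¹ ^ 2

lemma norm_invSquareSum_le {a : ℚ_[p]} {n : ℕ} (ha : ∀ j < n, ‖a + j‖ = 1) :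
    ‖invSquareSum a n‖ ≤ 1 := by
  refine norm_sum_le_one fun j hj => norm_pow_le_one ?_ 2
  rw [norm_inv, ha j (Finset.mem_range.1 hj), inv_one]

lemma norm_pochhammer_le_one {x : ℚ_[p]} (hx : ‖x‖ ≤ 1) (n : ℕ) : ‖pochhammer x n‖ ≤ 1 := by
  induction n with
  | zero => simp [pochhammer_zero]
  | succ n ih =>
    rw [pochhammer_succ]
    exact norm_mul_le_one ih (norm_add_le_one hx (norm_natCast_le_one n))

lemma pochhammer_congr {r : ℕ} {x y : ℚ_[p]} (h : PadicCongr p r x y) (hx : ‖x‖ ≤ 1) (n : ℕ) :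
    PadicCongr p r (pochhammer x n) (pochhammer y n) := by
  induction n with
  | zero => simpa [pochhammer_zero] using PadicCongr.refl _
  | succ n ih =>
    rw [pochhammer_succ, pochhammer_succ]
    exact ih.mul (h.add (PadicCongr.refl _)) (norm_pochhammer_le_one hx n)
      (norm_add_le_one (h.norm_le hx) (norm_natCast_le_one n))

/-- Moving two parameters apart changes the product of the rising factorials to second order. -/
lemma pochhammer_sub_mul_add_congr {a h : ℚ_[p]} (hh : PadicCongr p 1 h 0) {n : ℕ}
    (ha : ∀ j < n, ‖a + j‖ = 1) :
    PadicCongr p 4 (pochhammer (a - h) n * pochhammer (a + h) n)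
      (pochhammer a n ^ 2 * (1 - h ^ 2 * invSquareSum a n)) := by
  have h2 : PadicCongr p 2 (-h ^ 2) 0 := by simpa using (hh.zero_pow 2).neg
  have h1 := prod_one_add_mul_congr h2 (w := fun j => (a + j)⁻¹ ^ 2) (n := n) fun j hj =>
    norm_pow_le_one (by rw [norm_inv, ha j hj, inv_one]) 2
  have h3 := h1.mul_left (c := pochhammer a n ^ 2)
    (by rw [norm_pow, norm_pochhammer_eq_one ha, one_pow])
  have h4 : pochhammer (a - h) n * pochhammer (a + h) n =
      pochhammer a n ^ 2 * ∏ j ∈ Finset.range n, (1 + -h ^ 2 * (a + j)⁻¹ ^ 2) := by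
    rw [pochhammer_eq_prod, pochhammer_eq_prod, pochhammer_eq_prod, ← Finset.prod_pow,
      ← Finset.prod_mul_distrib, ← Finset.prod_mul_distrib]
    refine Finset.prod_congr rfl fun j hj => ?_
    have := ne_zero_of_norm_eq_one (ha j (Finset.mem_range.1 hj))
    field_simp
    ring
  rw [h4]
  refine h3.trans (PadicCongr.of_eq ?_)
  rw [invSquareSum]
  ring

/-- The sum of the cubes compared with the exactly summable one; here `-N` and `N + 1` are
`1 / 2 ∓ h` with `h = 1 / 2 + N = p / 2`. -/
theorem sum_cube_half_congr (S : TerminatingData p 2 N (1 / 2 : ℚ_[p])) :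
    PadicCongr p 4 (∑ n ∈ Finset.range (N + 1),
      pochhammer (1 / 2 : ℚ_[p]) n ^ 3 / pochhammer (1 : ℚ_[p]) n ^ 3)
      (legendreSum ℚ_[p] N + (1 / 2 + N) ^ 2 * ∑ n ∈ Finset.range (N + 1),
        pochhammer (1 / 2 : ℚ_[p]) n ^ 3 / pochhammer (1 : ℚ_[p]) n ^ 3 *
          invSquareSum (1 / 2) n) := by
  rw [legendreSum, Finset.mul_sum, ← Finset.sum_add_distrib]
  refine PadicCongr.sum fun n hn => ?_
  have hn := Nat.lt_succ_iff.1 (Finset.mem_range.1 hn)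
  have h1 := pochhammer_sub_mul_add_congr S.add_congr (n := n) fun j hj => S.norm_add (by omega)
  rw [show (1 / 2 : ℚ_[p]) - (1 / 2 + N) = -N by ring,
    show (1 / 2 : ℚ_[p]) + (1 / 2 + N) = N + 1 by ring] at h1
  have hu : ‖pochhammer (1 / 2 : ℚ_[p]) n / pochhammer 1 n ^ 3‖ ≤ 1 := by
    rw [norm_div, norm_pow, norm_pochhammer_eq_one fun j hj => S.norm_add (by omega),
      norm_pochhammer_eq_one fun j hj => S.norm_one_add (by omega)]
    norm_num
  have h2 := (h1.mul_left hu).symm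
  rw [PadicCongr.iff_sub] at h2 ⊢
  convert h2 using 1
  ring

/-- The sum of cubes for `p ≡ 1 (mod 4)`, from the exactly summable part alone. -/
theorem sum_cube_half_congr_of_even {M : ℕ} (S : TerminatingData p 2 (2 * M) (1 / 2 : ℚ_[p])) :
    PadicCongr p 2 (∑ n ∈ Finset.range (2 * M + 1),
      pochhammer (1 / 2 : ℚ_[p]) n ^ 3 / pochhammer (1 : ℚ_[p]) n ^ 3)
      (-padicGamma p (1 / 4) ^ 4) := by
  have hpM := S.eq
  have hpos := S.pos
  have hp5 : 5 ≤ p := by omega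
  have hp2 : p ≠ 2 := by omega
  have hcast : (p : ℚ_[p]) = 4 * M + 1 := by
    have := congrArg (Nat.cast : ℕ → ℚ_[p]) hpM
    rw [this]; push_cast; ring
  have h4 : ‖(4 : ℚ_[p])‖ = 1 := by
    exact_mod_cast norm_natCast_eq_one (p := p) (n := 4) (by norm_num) (by omega)
  obtain ⟨h, hh⟩ : ∃ h : ℚ_[p], h = p / 4 := ⟨_, rfl⟩
  have hh0 : PadicCongr p 1 h 0 := by
    rw [hh, div_eq_mul_inv]
    exact PadicCongr.p_zero.zero_mul_le (by rw [norm_inv, h4, inv_one])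
  have hq1 : ‖(1 / 4 : ℚ_[p])‖ ≤ 1 := by
    rw [norm_div, norm_one, h4, div_one]
  have hX : ∀ n ∈ Finset.range (2 * M + 1), ‖pochhammer (1 / 2 : ℚ_[p]) n ^ 3 /
      pochhammer (1 : ℚ_[p]) n ^ 3 * invSquareSum (1 / 2) n‖ ≤ 1 := by
    intro n hn
    have hn := Nat.lt_succ_iff.1 (Finset.mem_range.1 hn)
    refine norm_mul_le_one ?_ (norm_invSquareSum_le fun j hj => S.norm_add (by omega))
    rw [norm_div, norm_pow, norm_pow, norm_pochhammer_eq_one fun j hj => S.norm_add (by omega),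
      norm_pochhammer_eq_one fun j hj => S.norm_one_add (by omega)]
    norm_num
  have h1 := (S.add_congr.zero_pow 2).zero_mul_le (norm_sum_le_one hX)
  have h2 := (sum_cube_half_congr S).mono (show 2 ≤ 4 by norm_num)
  have h3 := h2.trans ((PadicCongr.refl (legendreSum ℚ_[p] (2 * M))).add h1)
  rw [add_zero, legendreSum_even] at h3
  refine h3.trans ?_
  -- The quotient of rising factorials as a gamma quotient.
  have f1 : pochhammer (1 / 2 : ℚ_[p]) M =
      (-1) ^ M * (padicGamma p (1 / 4 + h) / padicGamma p (1 / 2)) := by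
    rw [pochhammer_eq_padicGamma hp2 S.norm_a fun j hj => S.norm_add (by omega)]
    congr 3; rw [hh, hcast]; ring
  have f2 : pochhammer (1 : ℚ_[p]) M = (-1) ^ M * (padicGamma p (1 - (1 / 4 - h)) / -1) := by
    rw [pochhammer_eq_padicGamma hp2 (by simp) fun j hj => S.norm_one_add (by omega),
      padicGamma_one hp2]
    congr 3; rw [hh, hcast]; ring
  have r1 := padicGamma_reflect hp2 (x := 1 / 4 - h) (k := 3 * M + 1) (by omega) (by omega) (by
    rw [PadicCongr.iff_sub, show (1 / 4 - h - (3 * M + 1 : ℕ) : ℚ_[p]) = -p by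
      rw [hh, hcast]; push_cast; ring]
    simpa using (PadicCongr.p_zero (p := p)).neg)
  have r2 := padicGamma_reflect hp2 (x := 1 / 2) (k := 2 * M + 1) (by omega) (by omega) (by
    rw [PadicCongr.iff_sub, show (1 / 2 - (2 * M + 1 : ℕ) : ℚ_[p]) = -(1 / 2 + (2 * M : ℕ)) by
      push_cast; ring]
    simpa using S.add_congr.neg)
  rw [show (1 : ℚ_[p]) - 1 / 2 = 1 / 2 by norm_num, Odd.neg_one_pow ⟨M, rfl⟩] at r2
  have hσ : ((-1 : ℚ_[p]) ^ (3 * M + 1)) ^ 2 = 1 := by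
    rw [← pow_mul, mul_comm, pow_mul, neg_one_sq, one_pow]
  have hε : ((-1 : ℚ_[p]) ^ M) ≠ 0 := by simp
  have hd := padicGamma_second_difference hp5 hq1 hh0
  have hd2 := (hd.pow (by rw [norm_mul, norm_padicGamma hp2
    (norm_sub_le_one hq1 hh0.norm_le_of_zero), norm_padicGamma hp2
    (norm_add_le_one hq1 hh0.norm_le_of_zero), one_mul]) 2).neg
  rw [f1, f2]
  refine PadicCongr.trans (PadicCongr.of_eq ?_) (hd2.trans (PadicCongr.of_eq (by ring)))
  rw [mul_div_mul_left _ _ hε]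
  have n3 : padicGamma p (1 - (1 / 4 - h)) ≠ 0 := fun h0 => by
    rw [h0, mul_zero] at r1
    rw [← r1] at hσ
    norm_num at hσ
  generalize (-1 : ℚ_[p]) ^ (3 * M + 1) = σ at *
  generalize padicGamma p (1 - (1 / 4 - h)) = x at *
  generalize padicGamma p (1 / 4 - h) = y at *
  generalize padicGamma p (1 / 4 + h) = z at *
  generalize padicGamma p (1 / 2) = w at *
  have e : (z / w / (x / -1)) ^ 2 = z ^ 2 / ((w * w) * x ^ 2) := by
    field_simp
  rw [e, r2, div_eq_iff (by simpa using n3)]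
  have : y ^ 2 * x ^ 2 = 1 := by rw [← mul_pow, r1, hσ]
  linear_combination (-z ^ 2) * this

end CubeSum

section CubeSumOdd

variable {p : ℕ} [Fact p.Prime] {L : ℕ}

lemma prod_odd_mul_even (K : Type*) [Field K] (N : ℕ) :
    ∏ i ∈ Finset.range N, ((2 * i + 1) * (2 * i + 2) : K) = ((2 * N).factorial : K) := by
  induction N with
  | zero => simp
  | succ N ih =>
    rw [Finset.prod_range_succ, ih, show 2 * (N + 1) = 2 * N + 1 + 1 by ring, Nat.factorial_succ,
      Nat.factorial_succ]
    push_cast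
    ring

/-- An arithmetic progression of step `2` symmetric about `h`. -/
lemma prod_symm_progression {K : Type*} [Field K] (h : K) (L : ℕ) :
    ∏ i ∈ Finset.range (2 * L + 1), (h + 2 * i - 2 * L) =
      h * ∏ i ∈ Finset.range L, (h ^ 2 - 4 * (i + 1) ^ 2) := by
  rw [show 2 * L + 1 = L + (L + 1) by ring, Finset.prod_range_add, Finset.prod_range_succ',
    ← Finset.prod_range_reflect]
  have h1 : ∏ j ∈ Finset.range L, (h + 2 * ((L - 1 - j : ℕ) : K) - 2 * L) =
      ∏ j ∈ Finset.range L, (h - 2 * (j + 1)) := by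
    refine Finset.prod_congr rfl fun j hj => ?_
    have hj := Finset.mem_range.1 hj
    rw [Nat.sub_sub, Nat.cast_sub (by omega)]
    push_cast
    ring
  rw [h1, ← mul_assoc, ← Finset.prod_mul_distrib, mul_comm]
  congr 1
  · push_cast; ring
  · refine Finset.prod_congr rfl fun j _ => ?_
    push_cast
    ring

/-- Wilson's theorem, from `Γ(p) ≡ Γ(0)`. -/
lemma factorial_sub_one_congr (hp : p ≠ 2) : PadicCongr p 1 ((p - 1).factorial : ℚ_[p]) (-1) := by
  have hp' := (Fact.out : p.Prime)
  have h1 := pochhammer_eq_padicGamma (p := p) hp (x := 1) (n := p - 1) (by simp) fun j hj =>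
    norm_one_add_natCast_eq_one (by omega)
  have h2 : (1 : ℚ_[p]) + (p - 1 : ℕ) = p := by
    rw [Nat.cast_sub hp'.one_le]; push_cast; ring
  have he : Even (p - 1) := by
    have := hp'.odd_of_ne_two hp
    rw [Nat.odd_iff] at this
    rw [Nat.even_iff]; omega
  rw [pochhammer_one, h2, padicGamma_one hp, he.neg_one_pow, one_mul, div_neg, div_one] at h1
  rw [h1]
  have h3 := padicGamma_congr hp (norm_natCast_le_one p) (PadicCongr.p_zero (p := p))
  rw [padicGamma_zero hp] at h3
  exact h3.neg

/-- Fermat's little theorem. -/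
lemma natCast_pow_sub_one_congr {n : ℕ} (h0 : 0 < n) (hn : n < p) :
    PadicCongr p 1 ((n : ℚ_[p]) ^ (p - 1)) 1 := by
  have hp' := (Fact.out : p.Prime)
  have h := Nat.ModEq.pow_totient (Nat.coprime_of_lt_prime h0.ne' hn hp').symm
  rw [Nat.totient_prime hp'] at h
  have := (padicCongr_natCast_iff (p := p) (r := 1) (k := n ^ (p - 1)) (l := 1)).2
    (by rwa [pow_one])
  push_cast at this
  exact this

/-- Congruences may be divided by a multiple of `p` by a unit. -/
lemma PadicCongr.of_mul_pow {h c x y : ℚ_[p]} {r s : ℕ} (hc : ‖c‖ = 1) (hh : c * h = p)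
    (hxy : PadicCongr p (s + r) (h ^ s * x) (h ^ s * y)) : PadicCongr p r x y := by
  obtain ⟨u, hu⟩ := hxy.mul_left (c := c ^ s) (by rw [norm_pow, hc, one_pow])
  have hp : (p : ℚ_[p]) ^ s ≠ 0 :=
    pow_ne_zero s (Nat.cast_ne_zero.2 (Fact.out : p.Prime).ne_zero)
  refine ⟨u, mul_left_cancel₀ hp ?_⟩
  rw [← mul_assoc, ← pow_add, ← hu, ← hh]
  ring

/-- The second-order term of the sum of cubes when `N` is odd. With `h = p / 2`, the series
`∑ v_n (1/2 - t)_n (1/2 + t)_n` has a product formula; comparing its values at `t = h` (which is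
zero) and `t = 0` (which is `h ^ 2` times a unit) yields its second-order term in `t`, and
`v_n (1/2)_n ^ 2` agrees modulo `p` with the summand of the sum of cubes. -/
lemma sum_cube_invSquareSum_congr (S : TerminatingData p 2 (2 * L + 1) (1 / 2 : ℚ_[p])) :
    PadicCongr p 1 (4 * ∑ n ∈ Finset.range (2 * L + 1 + 1),
      pochhammer (1 / 2 : ℚ_[p]) n ^ 3 / pochhammer (1 : ℚ_[p]) n ^ 3 * invSquareSum (1 / 2) n)
      (-padicGamma p (1 / 4) ^ 4) := by
  have hpL := S.eq
  have hp2 : p ≠ 2 := by omega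
  have h2 : ‖(2 : ℚ_[p])‖ = 1 := by exact_mod_cast S.norm_m
  have h4 : ‖(4 : ℚ_[p])‖ = 1 := by
    rw [show (4 : ℚ_[p]) = 2 * 2 by norm_num, norm_mul, h2, one_mul]
  have hcast : (p : ℚ_[p]) = 4 * L + 3 := by
    have := congrArg (Nat.cast : ℕ → ℚ_[p]) hpL
    rw [this]; push_cast; ring
  set N := 2 * L + 1 with hN
  have hadd := S.add_congr
  obtain ⟨h, hh⟩ : ∃ h : ℚ_[p], h = 1 / 2 + N := ⟨_, rfl⟩
  rw [← hh] at hadd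
  have hhL : h = 2 * L + 3 / 2 := by rw [hh, hN]; push_cast; ring
  have h2h : 2 * h = p := by rw [hhL, hcast]; ring
  have e1 : (1 / 2 : ℚ_[p]) - h = -N := by rw [hh]; ring
  have e2 : (1 / 2 : ℚ_[p]) + h = 1 - -N := by rw [hh]; ring
  -- The weights `v`, and their values modulo `p`.
  obtain ⟨v, hv⟩ : ∃ v : ℕ → ℚ_[p], ∀ n, v n =
    pochhammer (-(N : ℚ_[p])) n / (pochhammer 1 n ^ 2 * pochhammer (-(2 * N : ℚ_[p])) n) :=
    ⟨_, fun _ => rfl⟩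
  have n1 : ∀ n ≤ N, ‖pochhammer (1 : ℚ_[p]) n‖ = 1 := fun n hn =>
    norm_pochhammer_eq_one fun j hj => S.norm_one_add (by omega)
  have na : ∀ n ≤ N, ‖pochhammer (1 / 2 : ℚ_[p]) n‖ = 1 := fun n hn =>
    norm_pochhammer_eq_one fun j hj => S.norm_add (by omega)
  have cN : ∀ n, PadicCongr p 1 (pochhammer (1 / 2 : ℚ_[p]) n) (pochhammer (-(N : ℚ_[p])) n) :=
    pochhammer_congr (by rw [PadicCongr.iff_sub, sub_neg_eq_add, ← hh]; exact hadd) S.norm_a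
  have c2N : ∀ n, PadicCongr p 1 (pochhammer (1 : ℚ_[p]) n) (pochhammer (-(2 * N : ℚ_[p])) n) :=
    pochhammer_congr (by
      rw [PadicCongr.iff_sub, sub_neg_eq_add, show (1 : ℚ_[p]) + 2 * N = p by
        rw [← h2h, hh]; ring]
      exact PadicCongr.p_zero) (by simp)
  have n2N : ∀ n ≤ N, ‖pochhammer (-(2 * N : ℚ_[p])) n‖ = 1 := fun n hn =>
    (c2N n).norm_eq_one (n1 n hn)
  have nv : ∀ n ≤ N, ‖v n‖ ≤ 1 := fun n hn => by
    rw [hv, norm_div, norm_mul, norm_pow, n1 n hn, n2N n hn, one_pow, one_mul, div_one]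
    exact (cN n).norm_le (na n hn).le
  have cv : ∀ n ≤ N, PadicCongr p 1 (v n * pochhammer (1 / 2 : ℚ_[p]) n ^ 2)
      (pochhammer (1 / 2 : ℚ_[p]) n ^ 3 / pochhammer (1 : ℚ_[p]) n ^ 3) := fun n hn => by
    have h1 := ((cN n).div ((c2N n).mul_left (c := pochhammer 1 n ^ 2)
      (by rw [norm_pow, n1 n hn, one_pow])) (na n hn).le
      (by rw [norm_mul, norm_pow, n1 n hn, one_pow, one_mul])
      (by rw [norm_mul, norm_pow, n1 n hn, n2N n hn, one_pow, one_mul])).mul_right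
      (c := pochhammer (1 / 2 : ℚ_[p]) n ^ 2) (by rw [norm_pow, na n hn, one_pow])
    rw [← hv] at h1
    refine h1.symm.trans (PadicCongr.of_eq ?_)
    ring
  -- The two exact evaluations.
  have w1 := sum_whipple_free (-(N : ℚ_[p])) N S.pos
  have w2 := sum_whipple_free (1 / 2 : ℚ_[p]) N S.pos
  rw [Finset.prod_eq_zero (i := L) (Finset.mem_range.2 (by omega))
    (by rw [hN]; push_cast; ring)] at w1
  obtain ⟨Q, hQ⟩ : ∃ Q : ℚ_[p], Q = ∏ i ∈ Finset.range L, (h ^ 2 - 4 * (i + 1) ^ 2) := ⟨_, rfl⟩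
  have w3 : ∏ i ∈ Finset.range N, ((1 / 2 : ℚ_[p]) + 2 * i + 1) * (2 * i + 2 - 1 / 2) /
      ((2 * i + 1) * (2 * i + 2)) = h ^ 2 * (Q ^ 2 / (p - 1).factorial) := by
    rw [Finset.prod_div_distrib, prod_odd_mul_even, show p - 1 = 2 * N by omega]
    have : ∏ i ∈ Finset.range N, ((1 / 2 : ℚ_[p]) + 2 * i + 1) * (2 * i + 2 - 1 / 2) =
        (∏ i ∈ Finset.range N, (h + 2 * i - 2 * L)) ^ 2 := by
      rw [← Finset.prod_pow]
      refine Finset.prod_congr rfl fun i _ => ?_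
      rw [hhL]; ring
    rw [this, prod_symm_progression, hQ]
    ring
  rw [w3] at w2
  have k1 : PadicCongr p 4 0 (h ^ 2 * (Q ^ 2 / (p - 1).factorial) - h ^ 2 *
      ∑ n ∈ Finset.range (N + 1), v n * pochhammer (1 / 2 : ℚ_[p]) n ^ 2 *
        invSquareSum (1 / 2) n) := by
    rw [← w1, ← w2, Finset.mul_sum, ← Finset.sum_sub_distrib]
    refine PadicCongr.sum fun n hn => ?_
    have hn := Nat.lt_succ_iff.1 (Finset.mem_range.1 hn)
    have h1 := pochhammer_sub_mul_add_congr hadd (n := n) (a := 1 / 2)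
      fun j hj => S.norm_add (by omega)
    rw [e1, e2] at h1
    have h2 := h1.mul_left (nv n hn)
    rw [hv] at h2 ⊢
    convert h2 using 1
    · ring
    · rw [show (1 : ℚ_[p]) - 1 / 2 = 1 / 2 by norm_num]
      ring
  have k2 : PadicCongr p 2 (∑ n ∈ Finset.range (N + 1), v n * pochhammer (1 / 2 : ℚ_[p]) n ^ 2 *
        invSquareSum (1 / 2) n) (Q ^ 2 / (p - 1).factorial) := by
    refine PadicCongr.of_mul_pow (s := 2) h2 h2h ?_
    rw [PadicCongr.iff_sub]
    simpa using k1.symm.neg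
  have k3 : PadicCongr p 1 (∑ n ∈ Finset.range (N + 1),
      pochhammer (1 / 2 : ℚ_[p]) n ^ 3 / pochhammer (1 : ℚ_[p]) n ^ 3 * invSquareSum (1 / 2) n)
      (Q ^ 2 / (p - 1).factorial) := by
    refine PadicCongr.trans (PadicCongr.sum fun n hn => ?_) (k2.mono one_le_two)
    have hn := Nat.lt_succ_iff.1 (Finset.mem_range.1 hn)
    exact (cv n hn).symm.mul_right (norm_invSquareSum_le fun j hj => S.norm_add (by omega))
  -- The value of the right-hand side modulo `p`.
  have q1 : PadicCongr p 1 Q ((-4) ^ L * (L.factorial : ℚ_[p]) ^ 2) := by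
    have h1 : ∀ l : ℕ, PadicCongr p 1 (∏ i ∈ Finset.range l, (h ^ 2 - 4 * ((i : ℚ_[p]) + 1) ^ 2))
        ((-4) ^ l * (l.factorial : ℚ_[p]) ^ 2) := by
      intro l
      induction l with
      | zero => simpa using PadicCongr.refl _
      | succ l ih =>
        have h3 : PadicCongr p 1 (h ^ 2 - 4 * ((l : ℚ_[p]) + 1) ^ 2)
            (-4 * ((l : ℚ_[p]) + 1) ^ 2) := by
          rw [PadicCongr.iff_sub]
          convert (hadd.zero_pow 2).mono one_le_two using 1
          ring
        have n3 : ‖(-4 * ((l : ℚ_[p]) + 1) ^ 2)‖ ≤ 1 := by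
          refine norm_mul_le_one (by rw [norm_neg, h4]) (norm_pow_le_one ?_ 2)
          exact_mod_cast norm_natCast_le_one (p := p) (l + 1)
        have n4 : ‖((-4) ^ l * (l.factorial : ℚ_[p]) ^ 2)‖ ≤ 1 :=
          norm_mul_le_one (by rw [norm_pow, norm_neg, h4, one_pow])
            (norm_pow_le_one (norm_natCast_le_one _) 2)
        rw [Finset.prod_range_succ]
        refine (ih.mul h3 (ih.symm.norm_le n4) n3).trans (PadicCongr.of_eq ?_)
        rw [Nat.factorial_succ]
        push_cast
        ring
    rw [hQ]
    exact h1 L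
  have q2 : PadicCongr p 1 (4 * (Q ^ 2 / (p - 1).factorial)) (-(L.factorial : ℚ_[p]) ^ 4) := by
    have f1 := factorial_sub_one_congr (p := p) hp2
    have f2 := natCast_pow_sub_one_congr (p := p) (n := 2) two_pos (by omega)
    have nL : ‖((-4) ^ L * (L.factorial : ℚ_[p]) ^ 2)‖ ≤ 1 :=
      norm_mul_le_one (by rw [norm_pow, norm_neg, h4, one_pow])
        (norm_pow_le_one (norm_natCast_le_one _) 2)
    have nQ : ‖Q‖ ≤ 1 := q1.symm.norm_le nL
    have f3 := ((q1.pow nQ 2).div f1 (norm_pow_le_one nQ 2)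
      (f1.symm.norm_eq_one (by simp)) (by simp)).mul_left h4.le
    refine f3.trans ?_
    have f4 := f2.mul_left (c := -(L.factorial : ℚ_[p]) ^ 4)
      (by rw [norm_neg]; exact norm_pow_le_one (norm_natCast_le_one _) 4)
    rw [mul_one] at f4
    refine PadicCongr.trans (PadicCongr.of_eq ?_) f4
    have f5 : ((2 : ℕ) : ℚ_[p]) ^ (p - 1) = 4 * ((-4) ^ L) ^ 2 := by
      rw [show p - 1 = 2 * (2 * L) + 2 by omega, pow_add, ← mul_assoc, pow_mul,
        ← pow_mul (-4 : ℚ_[p]), mul_comm L, pow_mul (-4 : ℚ_[p])]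
      norm_num
      ring
    rw [f5]
    ring
  have g1 : PadicCongr p 1 (padicGamma p (1 / 4)) (-((-1) ^ L * L.factorial)) := by
    have h1 : PadicCongr p 1 (1 / 4 : ℚ_[p]) (1 + L) := by
      rw [PadicCongr.iff_sub, show (1 / 4 - (1 + L) : ℚ_[p]) = p * -(1 / 4) by rw [hcast]; ring]
      exact PadicCongr.p_zero.zero_mul_le (by rw [norm_neg, norm_div, norm_one, h4, div_one])
    have h3 := padicGamma_congr hp2 (by rw [norm_div, norm_one, h4, div_one]) h1
    rw [padicGamma_add_natCast hp2 fun j hj => S.norm_one_add (by omega), pochhammer_one,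
      padicGamma_one hp2] at h3
    exact h3.trans (PadicCongr.of_eq (by ring))
  have g2 := (g1.pow (norm_padicGamma hp2 (by rw [norm_div, norm_one, h4, div_one])).le 4).neg
  refine ((k3.mul_left h4.le).trans q2).trans (g2.trans (PadicCongr.of_eq ?_)).symm
  rw [Even.neg_pow (by decide), mul_pow, ← pow_mul, mul_comm L, pow_mul]
  norm_num

/-- The sum of cubes for `p ≡ 3 (mod 4)`: the exactly summable part vanishes, and the second-order
term carries the factor `(p / 2) ^ 2`. -/
theorem sum_cube_half_congr_of_odd (S : TerminatingData p 2 (2 * L + 1) (1 / 2 : ℚ_[p])) :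
    PadicCongr p 3 (∑ n ∈ Finset.range (2 * L + 1 + 1),
      pochhammer (1 / 2 : ℚ_[p]) n ^ 3 / pochhammer (1 : ℚ_[p]) n ^ 3)
      (-(p : ℚ_[p]) ^ 2 * padicGamma p (1 / 4) ^ 4 / 16) := by
  have h2 : ‖(2 : ℚ_[p])‖ = 1 := by exact_mod_cast S.norm_m
  have h16 : ‖(16 : ℚ_[p])‖ = 1 := by
    rw [show (16 : ℚ_[p]) = 2 ^ 4 by norm_num, norm_pow, h2, one_pow]
  have h1 := (sum_cube_half_congr S).mono (show 3 ≤ 4 by norm_num)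
  rw [legendreSum_odd, zero_add] at h1
  refine h1.trans (PadicCongr.cancel_left (c := 16) h16 ?_)
  have h3 := (PadicCongr.p_zero.zero_pow 2).mul_of_zero (sum_cube_invSquareSum_congr S)
  have h4 : (p : ℚ_[p]) = 2 * (1 / 2 + (2 * L + 1 : ℕ)) := by
    exact_mod_cast S.mul_add_eq.symm
  refine PadicCongr.trans (PadicCongr.of_eq ?_) (h3.trans (PadicCongr.of_eq ?_))
  · rw [h4]; ring
  · ring

end CubeSumOdd

theorem theorem2 (p : ℕ) [Fact p.Prime] :
    -- (B.2)
    (2 < p →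
      PadicCongr p 3
        (∑ n ∈ Finset.range ((p - 1) / 2 + 1),
          (4 * (n : ℚ_[p]) + 1) * (-1) ^ n *
            (pochhammer (1 / 2 : ℚ_[p]) n ^ 3 / pochhammer (1 : ℚ_[p]) n ^ 3))
        (-(p : ℚ_[p]) / padicGamma p (1 / 2) ^ 2)) ∧
    -- (C.2)
    (2 < p →
      PadicCongr p 3
        (∑ n ∈ Finset.range ((p - 1) / 2 + 1),
          (4 * (n : ℚ_[p]) + 1) *
            (pochhammer (1 / 2 : ℚ_[p]) n ^ 4 / pochhammer (1 : ℚ_[p]) n ^ 4))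
        (p : ℚ_[p])) ∧
    -- (D.2)
    (p % 6 = 1 →
      PadicCongr p 4
        (∑ n ∈ Finset.range ((p - 1) / 3 + 1),
          (6 * (n : ℚ_[p]) + 1) *
            (pochhammer (1 / 3 : ℚ_[p]) n ^ 6 / pochhammer (1 : ℚ_[p]) n ^ 6))
        (-(p : ℚ_[p]) * padicGamma p (1 / 3) ^ 9)) ∧
    -- (E.2)
    (p % 6 = 1 →
      PadicCongr p 3
        (∑ n ∈ Finset.range ((p - 1) / 3 + 1),
          (6 * (n : ℚ_[p]) + 1) * (-1) ^ n *
            (pochhammer (1 / 3 : ℚ_[p]) n ^ 3 / pochhammer (1 : ℚ_[p]) n ^ 3))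
        (p : ℚ_[p])) ∧
    -- (F.2)
    (p % 4 = 1 →
      PadicCongr p 3
        (∑ n ∈ Finset.range ((p - 1) / 4 + 1),
          (8 * (n : ℚ_[p]) + 1) * (-1) ^ n *
            (pochhammer (1 / 4 : ℚ_[p]) n ^ 3 / pochhammer (1 : ℚ_[p]) n ^ 3))
        (-(p : ℚ_[p]) / (padicGamma p (1 / 4) * padicGamma p (3 / 4)))) ∧
    -- (G.2), in the stronger form modulo `p ^ 4`
    (p % 4 = 1 →
      PadicCongr p 4
        (∑ n ∈ Finset.range ((p - 1) / 4 + 1),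
          (8 * (n : ℚ_[p]) + 1) *
            (pochhammer (1 / 4 : ℚ_[p]) n ^ 4 / pochhammer (1 : ℚ_[p]) n ^ 4))
        ((p : ℚ_[p]) * padicGamma p (1 / 2) * padicGamma p (1 / 4) / padicGamma p (3 / 4))) ∧
    -- (H.2), `p ≡ 1 (mod 4)`
    (p % 4 = 1 →
      PadicCongr p 2
        (∑ n ∈ Finset.range ((p - 1) / 2 + 1),
          pochhammer (1 / 2 : ℚ_[p]) n ^ 3 / pochhammer (1 : ℚ_[p]) n ^ 3)
        (-padicGamma p (1 / 4) ^ 4)) ∧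
    -- (H.2), `p ≡ 3 (mod 4)`
    (p % 4 = 3 →
      PadicCongr p 2
        (∑ n ∈ Finset.range ((p - 1) / 2 + 1),
          pochhammer (1 / 2 : ℚ_[p]) n ^ 3 / pochhammer (1 : ℚ_[p]) n ^ 3)
        0) ∧
    -- the extension of (H.2) modulo `p ^ 3`, `p ≡ 3 (mod 4)`
    (p % 4 = 3 →
      PadicCongr p 3
        (∑ n ∈ Finset.range ((p - 1) / 2 + 1),
          pochhammer (1 / 2 : ℚ_[p]) n ^ 3 / pochhammer (1 : ℚ_[p]) n ^ 3)
        (-(p : ℚ_[p]) ^ 2 * padicGamma p (1 / 4) ^ 4 / 16)) := by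
  have hp' := (Fact.out : p.Prime)
  have hodd : 2 < p → p % 2 = 1 := fun h => Nat.odd_iff.1 (hp'.odd_of_ne_two (by omega))
  have S2 : 2 < p → TerminatingData p 2 ((p - 1) / 2) (1 / 2 : ℚ_[p]) := fun h =>
    ⟨by have := hodd h; omega, by norm_num, by norm_num⟩
  have S3 : p % 6 = 1 → TerminatingData p 3 ((p - 1) / 3) (1 / 3 : ℚ_[p]) := fun h =>
    ⟨by have := hp'.two_le; omega, by norm_num, by norm_num⟩
  have S4 : p % 4 = 1 → TerminatingData p 4 ((p - 1) / 4) (1 / 4 : ℚ_[p]) := fun h =>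
    ⟨by have := hp'.two_le; omega, by norm_num, by norm_num⟩
  have h3 : p % 4 = 3 → PadicCongr p 3
      (∑ n ∈ Finset.range ((p - 1) / 2 + 1),
        pochhammer (1 / 2 : ℚ_[p]) n ^ 3 / pochhammer (1 : ℚ_[p]) n ^ 3)
      (-(p : ℚ_[p]) ^ 2 * padicGamma p (1 / 4) ^ 4 / 16) := fun h => by
    have S := S2 (by omega)
    rw [show (p - 1) / 2 = 2 * (p / 4) + 1 by omega] at S ⊢
    exact sum_cube_half_congr_of_odd S
  have e2 : ∀ n : ℕ, 2 * ((2 : ℕ) : ℚ_[p]) * n + 1 = 4 * n + 1 := fun n => by push_cast; ring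
  have e3 : ∀ n : ℕ, 2 * ((3 : ℕ) : ℚ_[p]) * n + 1 = 6 * n + 1 := fun n => by push_cast; ring
  have e4 : ∀ n : ℕ, 2 * ((4 : ℕ) : ℚ_[p]) * n + 1 = 8 * n + 1 := fun n => by push_cast; ring
  refine ⟨fun h => ?_, fun h => ?_, fun h => ?_, fun h => ?_, fun h => ?_, fun h => ?_,
    fun h => ?_, fun h => ?_, h3⟩
  · have S := S2 h
    have hc := S.sum_cube_congr
    have r := padicGamma_reflect (p := p) (by omega) (x := 1 / 2) (k := (p - 1) / 2 + 1) (by omega)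
      (by omega) (by
        rw [PadicCongr.iff_sub, show (1 / 2 - ((p - 1) / 2 + 1 : ℕ) : ℚ_[p]) =
          -(1 / 2 + ((p - 1) / 2 : ℕ)) by push_cast; ring]
        simpa using S.add_congr.neg)
    rw [show (1 : ℚ_[p]) - 1 / 2 = 1 / 2 by norm_num, ← sq] at r
    rw [r, pow_succ, mul_neg_one, neg_div_neg_eq]
    simp only [e2] at hc
    refine hc.trans (PadicCongr.of_eq ?_)
    rw [eq_div_iff (by simp), mul_right_comm, ← mul_pow, neg_one_mul, neg_neg, one_pow, one_mul]
  · have hc := sum_fourth_half_congr (S2 h)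
    simpa only [e2] using hc
  · have hc := sum_sixth_third_congr (S3 h)
    simpa only [e3] using hc
  · have hc := (S3 h).sum_cube_congr
    have he : Even ((p - 1) / 3) := by rw [Nat.even_iff]; omega
    rw [he.neg_one_pow, one_mul] at hc
    simpa only [e3] using hc
  · have S := S4 h
    have hc := S.sum_cube_congr
    have := hp'.two_le
    have r := padicGamma_reflect (p := p) (by omega) (x := 1 / 4) (k := 3 * ((p - 1) / 4) + 1)
      (by omega) (by omega) (by
        have := S.add_congr.mul_left (c := -3)
          (by rw [norm_neg]; exact_mod_cast norm_natCast_le_one (p := p) 3)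
        rw [mul_zero] at this
        rw [PadicCongr.iff_sub]
        refine (PadicCongr.of_eq ?_).trans this
        push_cast; ring)
    rw [show (1 : ℚ_[p]) - 1 / 4 = 3 / 4 by norm_num] at r
    rw [r, pow_succ, mul_neg_one, neg_div_neg_eq]
    simp only [e4] at hc
    refine hc.trans (PadicCongr.of_eq ?_)
    rw [eq_div_iff (by simp), mul_right_comm, ← pow_add,
      show (p - 1) / 4 + 3 * ((p - 1) / 4) = 2 * (2 * ((p - 1) / 4)) by ring, pow_mul, neg_one_sq,
      one_pow, one_mul]
  · have hc := sum_fourth_quarter_congr (S4 h)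
    simpa only [e4] using hc
  · have S := S2 (by have := hp'.two_le; omega)
    rw [show (p - 1) / 2 = 2 * (p / 4) by omega] at S ⊢
    exact sum_cube_half_congr_of_even S
  · refine ((h3 h).mono (show 2 ≤ 3 by norm_num)).trans ?_
    have S := S2 (by omega)
    have n2 : ‖(2 : ℚ_[p])‖ = 1 := by exact_mod_cast S.norm_m
    have n4 : ‖(4 : ℚ_[p])‖ = 1 := by
      rw [show (4 : ℚ_[p]) = 2 ^ 2 by norm_num, norm_pow, n2, one_pow]
    have n16 : ‖(16 : ℚ_[p])‖ = 1 := by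
      rw [show (16 : ℚ_[p]) = 2 ^ 4 by norm_num, norm_pow, n2, one_pow]
    have := ((PadicCongr.p_zero (p := p)).zero_pow 2).zero_mul_le
      (x := -(padicGamma p (1 / 4) ^ 4 / 16)) (by
        rw [norm_neg, norm_div, norm_pow, norm_padicGamma (by omega)
          (by rw [norm_div, norm_one, n4, div_one]), n16, one_pow, div_one])
    exact (PadicCongr.of_eq (by ring)).trans this
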